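/- Let $K/F$ be a finite Galois extension of number fields with Galois group $G$, and let $E/F$ be an elliptic curve. Let $\overline F\supseteq K$ be an algebraic closure of $F$, and put $G_F=\mathrm{Gal}(\overline F/F)$, $G_K=\mathrm{Gal}(\overline F/K)$. For every place $v$ (finite or infinite) of $F$ fix a place $w$ of $K$ above $v$, and put $G_w=\mathrm{Gal}(K_w/F_v)$, $G_{F_v}=\mathrm{Gal}(\overline{F_v}/F_v)$. For a field $k$ with absolute Galois group $G_k$ write $H^1(G_k,E)=H^1(G_k,E(\overline k))$ (continuous cohomology), and let Ш$(E/F)$, Ш$(E/K)$ be the groups of everywhere locally trivial classes in $H^1(G_F,E)$, $H^1(G_K,E)$. Let $$\mathcal F: H^1(G,E(K))\to\bigoplus_{v} H^1(G_w,E(K_w)),\qquad \mathcal G: H^1(G_F,E)\to\bigoplus_{v} H^1(G_{F_v},E)$$ be the localization maps, the sums being over all places $v$ of $F$, and let $\mathcal I:\mathrm{Coker}(\mathcal F)\to\mathrm{Coker}(\mathcal G)$ be the map induced by the local inflation maps $H^1(G_w,E(K_w))\to H^1(G_{F_v},E)$. Let $\mathrm{Res}: H^1(G_F,E)\to H^1(G_K,E)^G$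 be the restriction map and $\widetilde{\mathrm{Res}}$ its restriction to Ш$(E/F)$. Let $\mathrm{Trans}: H^1(G_K,E)^G\to H^2(G,E(K))$ be the transgression map, and $\mathrm{trans}$ its restriction to Ш$(E/K)^G$. Then $\mathrm{Im}(\widetilde{\mathrm{Res}})\subseteq\mathrm{Ker}(\mathrm{trans})$, and there is an isomorphism of abelian groups $$\mathrm{Ker}(\mathcal I)\;\cong\;\frac{\mathrm{Ker}(\mathrm{trans})}{\mathrm{Im}(\widetilde{\mathrm{Res}})}.$$ -/

import Mathlib

noncomputable section

open IsDedekindDomain NumberField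

/-- A place of a number field `F`: a nonzero prime of its ring of integers, or an infinite place. -/
inductive Place (F : Type*) [Field F] where
  | finite (v : HeightOneSpectrum (𝓞 F)) : Place F
  | infinite (v : InfinitePlace F) : Place F

theorem span_range_algebraMap_eq_top {F K A B : Type*} [Field F] [Field K] [Algebra F K]
    [FiniteDimensional F K] [NontriviallyNormedField A] [CompleteSpace A] [Field B] [Algebra A B]
    [Algebra F A] [Algebra K B] [TopologicalSpace B] [IsTopologicalAddGroup B] [T2Space B]
    [ContinuousSMul A B]
    (h : ∀ x : F, algebraMap A B (algebraMap F A x) = algebraMap K B (algebraMap F K x))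
    (hd : DenseRange (algebraMap K B)) :
    Submodule.span A (Set.range (algebraMap K B)) = ⊤ := by
  let b := Module.finBasis F K
  have hfin : Submodule.span A (Set.range (algebraMap K B)) =
      Submodule.span A (Set.range (algebraMap K B ∘ b)) := by
    apply le_antisymm
    · rw [Submodule.span_le]
      rintro _ ⟨k, rfl⟩
      rw [← b.sum_repr k, map_sum]
      refine Submodule.sum_mem _ fun i _ ↦ ?_
      rw [Algebra.smul_def, map_mul, ← h, ← Algebra.smul_def]
      exact Submodule.smul_mem _ _ (Submodule.subset_span ⟨i, rfl⟩)
    · exact Submodule.span_mono (Set.range_comp_subset_range _ _)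
  have : FiniteDimensional A (Submodule.span A (Set.range (algebraMap K B))) := by
    rw [hfin]
    exact FiniteDimensional.span_of_finite A (Set.finite_range _)
  rw [eq_top_iff]
  rintro x -
  have hc := (Submodule.span A (Set.range (algebraMap K B))).closed_of_finiteDimensional
  exact hc.closure_subset_iff.mpr Submodule.subset_span (hd x)

open IntermediateField in
theorem normal_of_span_range_algebraMap {F K A B : Type*} [Field F] [Field K] [Algebra F K]
    [Field A] [Field B] [Algebra A B] [Algebra F A] [Algebra K B] [Algebra F B]
    [IsScalarTower F K B] [IsScalarTower F A B] [Normal F K]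
    (h : Submodule.span A (Set.range (algebraMap K B)) = ⊤) : Normal A B := by
  have hint : ∀ x ∈ Set.range (algebraMap K B), IsIntegral A x ∧
      ((minpoly A x).map (algebraMap A B)).Splits := by
    rintro _ ⟨k, rfl⟩
    have hk : IsIntegral F (algebraMap K B k) := (Normal.isIntegral ‹_› k).map (Algebra.ofId K B |>.restrictScalars F)
    refine ⟨hk.tower_top, ?_⟩
    have hs := (Normal.splits (F := F) ‹_› k).map (algebraMap K B)
    rw [Polynomial.map_map, ← IsScalarTower.algebraMap_eq, IsScalarTower.algebraMap_eq F A B,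
      ← Polynomial.map_map, ← minpoly.algebraMap_eq (algebraMap K B).injective] at hs
    refine hs.of_dvd ?_ (Polynomial.map_dvd _ (minpoly.dvd_map_of_isScalarTower F A _))
    exact (Polynomial.map_ne_zero_iff (algebraMap A B).injective).mpr
      ((Polynomial.map_ne_zero_iff (algebraMap F A).injective).mpr (minpoly.ne_zero hk))
  have hadj : ∀ x : B, x ∈ adjoin A (Set.range (algebraMap K B)) := by
    intro x
    have hx : x ∈ Submodule.span A (Set.range (algebraMap K B)) := h ▸ Submodule.mem_top
    exact (Submodule.span_le (p := (adjoin A (Set.range (algebraMap K B))).toSubmodule)).mpr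
      (subset_adjoin A _) hx
  have : Algebra.IsAlgebraic A B := ⟨fun x ↦ by
    have := isAlgebraic_adjoin fun y hy ↦ (hint y hy).1
    exact IsIntegral.isAlgebraic ((Algebra.IsIntegral.isIntegral (R := A)
      (⟨x, hadj x⟩ : adjoin A (Set.range (algebraMap K B)))).map
        (adjoin A (Set.range (algebraMap K B))).val)⟩
  exact ⟨fun x ↦ splits_of_mem_adjoin A B hint (hadj x)⟩

namespace Place

section completion

variable {F : Type*} [Field F] [NumberField F]

/-- The completion `F_v`. -/
def Completion : Place F → Type _
  | finite v => v.adicCompletion F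
  | infinite v => v.Completion

instance (v : Place F) : Field v.Completion :=
  match v with
  | finite v => inferInstanceAs (Field (v.adicCompletion F))
  | infinite v => inferInstanceAs (Field v.Completion)

instance (v : Place F) : Algebra F v.Completion :=
  match v with
  | finite v => inferInstanceAs (Algebra F (v.adicCompletion F))
  | infinite v => inferInstanceAs (Algebra F v.Completion)

end completion

section tower

variable {F K : Type*} [Field F] [Field K] [NumberField K] [Algebra F K]

/-- The completion of `K` at a place of `K` is an `F`-algebra for every subfield `F` of `K`. -/
instance (priority := low) (w : Place K) : Algebra F w.Completion :=
  ((algebraMap K w.Completion).comp (algebraMap F K)).toAlgebra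

instance (priority := low) (w : Place K) : IsScalarTower F K w.Completion :=
  .of_algebraMap_eq fun _ ↦ rfl

end tower

variable {F K : Type*} [Field F] [NumberField F] [Field K] [NumberField K] [Algebra F K]

/-- The place `w` of `K` lies above the place `v` of `F`. -/
def LiesAbove : Place K → Place F → Prop
  | finite w, finite v => w.asIdeal.LiesOver v.asIdeal
  | infinite w, infinite v => w.LiesOver v
  | _, _ => False

/-- For nonzero primes `w ∣ v`, the continuous extension `F_v → K_w` of `F → K`. -/
def finiteMap (w : HeightOneSpectrum (𝓞 K)) (v : HeightOneSpectrum (𝓞 F))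
    [w.asIdeal.LiesOver v.asIdeal] : v.adicCompletion F →+* w.adicCompletion K :=
  ((HeightOneSpectrum.adicCompletion.equiv K w).symm.toRingHom.comp
    (UniformSpace.Completion.mapRingHom
      (algebraMap (WithVal (v.valuation F)) (WithVal (w.valuation K)))
      (HeightOneSpectrum.uniformContinuous_algebraMap_liesOver F K v w).continuous)).comp
    (HeightOneSpectrum.adicCompletion.equiv F v).toRingHom

theorem continuous_finiteMap (w : HeightOneSpectrum (𝓞 K)) (v : HeightOneSpectrum (𝓞 F))
    [w.asIdeal.LiesOver v.asIdeal] : Continuous (finiteMap w v) :=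
  (HeightOneSpectrum.adicCompletion.continuous_ofCompletion K w).comp <|
    UniformSpace.Completion.continuous_map.comp
      (HeightOneSpectrum.adicCompletion.continuous_toCompletion F v)

theorem finiteMap_algebraMap (w : HeightOneSpectrum (𝓞 K)) (v : HeightOneSpectrum (𝓞 F))
    [w.asIdeal.LiesOver v.asIdeal] (x : F) :
    finiteMap w v (algebraMap F (v.adicCompletion F) x) =
      algebraMap K (w.adicCompletion K) (algebraMap F K x) := by
  apply HeightOneSpectrum.adicCompletion.ext
  exact UniformSpace.Completion.mapRingHom_coe
    (HeightOneSpectrum.uniformContinuous_algebraMap_liesOver F K v w).continuous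
    (WithVal.toVal (v.valuation F) x)

/-- For `w ∣ v`, the continuous extension `F_v → K_w` of `F → K`. -/
def completionMap : ∀ {w : Place K} {v : Place F}, w.LiesAbove v → v.Completion →+* w.Completion
  | finite w, finite v, h => haveI : w.asIdeal.LiesOver v.asIdeal := h; finiteMap w v
  | infinite w, infinite v, h => haveI : w.LiesOver v := h; LiesOver.completionMap

theorem completionMap_algebraMap : ∀ {w : Place K} {v : Place F} (h : w.LiesAbove v) (x : F),
    completionMap h (algebraMap F v.Completion x) =
      algebraMap K w.Completion (algebraMap F K x)
  | finite w, finite v, h, x => by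
    have : w.asIdeal.LiesOver v.asIdeal := h
    exact finiteMap_algebraMap w v x
  | infinite w, infinite v, h, x => by
    have : w.LiesOver v := h
    exact LiesOver.completionMap_coe (v := v) (w := w) (WithAbs.toAbs v.1 x)

/-- The places of `K` above a place `v` of `F`. -/
def Above (K : Type*) [Field K] [NumberField K] [Algebra F K] (v : Place F) : Type _ :=
  {w : Place K // w.LiesAbove v}

/-- The completion `K_w` for a place `w` above `v`, regarded as an extension of `F_v`. -/
def Above.Completion {v : Place F} (w : v.Above K) : Type _ := w.1.Completion

namespace Above

variable {v : Place F} (w : v.Above K)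

instance : Field w.Completion := inferInstanceAs (Field w.1.Completion)

instance : Algebra K w.Completion := inferInstanceAs (Algebra K w.1.Completion)

instance : Algebra v.Completion w.Completion := (completionMap w.2).toAlgebra

instance : Algebra F w.Completion := inferInstanceAs (Algebra F w.1.Completion)

instance : IsScalarTower F K w.Completion := inferInstanceAs (IsScalarTower F K w.1.Completion)

instance : IsScalarTower F v.Completion w.Completion :=
  .of_algebraMap_eq fun x ↦ (completionMap_algebraMap w.2 x).symm

open scoped Valued in
/-- `K_w` is spanned by `K` over `F_v`: the span is finite dimensional, hence closed, and dense. -/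
theorem span_range_algebraMap : ∀ {v : Place F} (w : v.Above K),
    Submodule.span v.Completion (Set.range (algebraMap K w.Completion)) = ⊤
  | finite v, ⟨finite w, h⟩ => by
    have : w.asIdeal.LiesOver v.asIdeal := h
    let : Algebra (v.adicCompletion F) (w.adicCompletion K) := (finiteMap w v).toAlgebra
    have : ContinuousSMul (v.adicCompletion F) (w.adicCompletion K) :=
      ⟨((continuous_finiteMap w v).comp continuous_fst).mul continuous_snd⟩
    exact span_range_algebraMap_eq_top (F := F) (K := K) (A := v.adicCompletion F)
      (B := w.adicCompletion K) (finiteMap_algebraMap w v) (w.denseRange_algebraMap K)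
  | infinite v, ⟨infinite w, h⟩ => by
    have : w.LiesOver v := h
    let : Algebra v.Completion w.Completion := LiesOver.completionMap.toAlgebra
    have : ContinuousSMul v.Completion w.Completion :=
      ⟨(LiesOver.continuous_completionMap.comp continuous_fst).mul continuous_snd⟩
    have h2 : ‖(2 : v.Completion)‖ = 2 := by
      have := (InfinitePlace.Completion.isometry_extensionEmbedding v).norm_map_of_map_zero
        (map_zero _) 2
      rwa [map_ofNat, Complex.norm_ofNat, eq_comm] at this
    let : NontriviallyNormedField v.Completion := NontriviallyNormedField.ofNormNeOne
      ⟨2, fun h0 ↦ by simp [h0] at h2, by norm_num [h2]⟩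
    exact span_range_algebraMap_eq_top (F := F) (K := K) (A := v.Completion)
      (B := w.Completion) (completionMap_algebraMap (w := infinite w) (v := infinite v) h)
      ((InfinitePlace.Completion.denseRange_coe w).comp
        (WithAbs.equiv w.1).symm.surjective.denseRange
        (InfinitePlace.Completion.continuous_coe w))

instance [Normal F K] : Normal v.Completion w.Completion :=
  normal_of_span_range_algebraMap (F := F) w.span_range_algebraMap

end Above

end Place

open groupCohomology (IsCocycle₁ IsCocycle₂ IsCoboundary₁ IsCoboundary₂
  map_one_fst_of_isCocycle₂ map_one_snd_of_isCocycle₂)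

/-! ### Cohomology of discrete modules through cochains -/

section Cohomology

variable (Γ A : Type*) [Group Γ] [AddCommGroup A] [DistribMulAction Γ A]

/-- The continuous `1`-cocycles of a topological group `Γ` with values in a discrete `Γ`-module. -/
def Z1 [TopologicalSpace Γ] : AddSubgroup (Γ → A) where
  carrier := {f | IsCocycle₁ f ∧ IsLocallyConstant f}
  zero_mem' := ⟨fun g h ↦ by simp, IsLocallyConstant.const 0⟩
  add_mem' {a b} ha hb :=
    ⟨fun g h ↦ by simp only [Pi.add_apply, ha.1 g h, hb.1 g h, smul_add]; abel, ha.2.add hb.2⟩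
  neg_mem' {a} ha := ⟨fun g h ↦ by simp only [Pi.neg_apply, ha.1 g h, smul_neg]; abel, ha.2.neg⟩

/-- The `1`-coboundaries `g ↦ g • x - x`. -/
def B1 [TopologicalSpace Γ] : AddSubgroup (Z1 Γ A) where
  carrier := {f | IsCoboundary₁ (f : Γ → A)}
  zero_mem' := ⟨0, fun g ↦ by simp⟩
  add_mem' := by
    rintro a b ⟨x, hx⟩ ⟨y, hy⟩
    exact ⟨x + y, fun g ↦ by simp only [AddSubgroup.coe_add, Pi.add_apply, ← hx, ← hy, smul_add]; abel⟩
  neg_mem' := by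
    rintro a ⟨x, hx⟩
    exact ⟨-x, fun g ↦ by simp only [AddSubgroup.coe_neg, Pi.neg_apply, ← hx, smul_neg]; abel⟩

/-- `H¹(Γ, A)` for a topological group `Γ` and a discrete `Γ`-module `A`. -/
abbrev H1 [TopologicalSpace Γ] : Type _ := Z1 Γ A ⧸ B1 Γ A

/-- The `2`-cocycles of a (discrete) group. -/
def Z2 : AddSubgroup (Γ × Γ → A) where
  carrier := {f | IsCocycle₂ f}
  zero_mem' := fun g h j ↦ by simp
  add_mem' {a b} ha hb := fun g h j ↦ by
    have h1 := ha g h j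
    have h2 := hb g h j
    simp only [Pi.add_apply, smul_add]
    rw [add_add_add_comm, h1, h2]; abel
  neg_mem' {a} ha := fun g h j ↦ by
    simp only [Pi.neg_apply, smul_neg, ← neg_add, ha g h j]

/-- The `2`-coboundaries. -/
def B2 : AddSubgroup (Z2 Γ A) where
  carrier := {f | IsCoboundary₂ (f : Γ × Γ → A)}
  zero_mem' := ⟨0, fun g h ↦ by simp⟩
  add_mem' := by
    rintro a b ⟨x, hx⟩ ⟨y, hy⟩
    exact ⟨x + y, fun g h ↦ by
      simp only [AddSubgroup.coe_add, Pi.add_apply, ← hx, ← hy, smul_add]; abel⟩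
  neg_mem' := by
    rintro a ⟨x, hx⟩
    exact ⟨-x, fun g h ↦ by simp only [AddSubgroup.coe_neg, Pi.neg_apply, ← hx, smul_neg]; abel⟩

/-- `H²(Γ, A)` for a (discrete) group `Γ`. -/
abbrev H2 : Type _ := Z2 Γ A ⧸ B2 Γ A

variable {Γ A} {Γ' A' : Type*} [Group Γ'] [AddCommGroup A'] [DistribMulAction Γ' A']
  [TopologicalSpace Γ] [TopologicalSpace Γ']

/-- Pullback of cocycles along a pair of compatible homomorphisms. -/
def Z1.map (φ : Γ' →* Γ) (hφ : Continuous φ) (α : A →+ A')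
    (h : ∀ g a, α (φ g • a) = g • α a) : Z1 Γ A →+ Z1 Γ' A' where
  toFun f := ⟨fun g ↦ α (f.1 (φ g)), fun g g' ↦ by
    simp only [map_mul, f.2.1 (φ g) (φ g'), map_add, h], (f.2.2.comp_continuous hφ).comp α⟩
  map_zero' := Subtype.ext <| funext fun g ↦ map_zero α
  map_add' _ _ := Subtype.ext <| funext fun g ↦ map_add α _ _

/-- The map `H¹(Γ, A) → H¹(Γ', A')` induced by compatible homomorphisms `Γ' → Γ` and `A → A'`:
the class of `f` is sent to the class of `g ↦ α (f (φ g))`. -/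
def H1.map (φ : Γ' →* Γ) (hφ : Continuous φ) (α : A →+ A')
    (h : ∀ g a, α (φ g • a) = g • α a) : H1 Γ A →+ H1 Γ' A' :=
  QuotientAddGroup.map _ _ (Z1.map φ hφ α h) <| by
    rintro f ⟨x, hx⟩
    exact ⟨α x, fun g ↦ by simp [Z1.map, ← hx, h]⟩

end Cohomology

/-! ### Restriction and transgression -/

/-- A normal extension `1 → N → Γ → Q → 1` of topological groups together with a `Γ`-module `A`
and the `Q`-module `B = A ^ N`. -/
structure NormalExtension (N Γ Q B A : Type*) [Group N] [Group Γ] [Group Q]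
    [TopologicalSpace N] [TopologicalSpace Γ] [AddCommGroup A] [AddCommGroup B]
    [DistribMulAction N A] [DistribMulAction Γ A] [DistribMulAction Q B] where
  ι : N →* Γ
  π : Γ →* Q
  incl : B →+ A
  isInducing_ι : Topology.IsInducing ι
  ι_injective : Function.Injective ι
  π_surjective : Function.Surjective π
  exact : π.ker = ι.range
  smul_ι : ∀ (n : N) (a : A), ι n • a = n • a
  incl_smul : ∀ (g : Γ) (b : B), incl (π g • b) = g • incl b
  incl_injective : Function.Injective incl
  exists_incl : ∀ a, (∀ n : N, n • a = a) → ∃ b, incl b = a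

namespace NormalExtension

variable {N Γ Q B A : Type*} [Group N] [Group Γ] [Group Q]
    [TopologicalSpace N] [TopologicalSpace Γ]
    [AddCommGroup A] [AddCommGroup B]
    [DistribMulAction N A] [DistribMulAction Γ A] [DistribMulAction Q B]
    (D : NormalExtension N Γ Q B A)

/-- `d` is a transgression of `c`: there are a cocycle `f` representing `c`, a cochain `b` on `Γ`
extending `f`, and a `2`-cocycle `z` representing `d`, such that the coboundary of `b` is the
inflation of `z`. -/
def IsTransgression (c : H1 N A) (d : H2 Q B) : Prop :=
  ∃ (f : Z1 N A) (b : Γ → A) (z : Z2 Q B), (f : H1 N A) = c ∧ (z : H2 Q B) = d ∧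
    (∀ n, b (D.ι n) = f.1 n) ∧
    ∀ g h, g • b h - b (g * h) + b g = D.incl (z.1 (D.π g, D.π h))

variable {D} in
theorem IsTransgression.add {c c' : H1 N A} {d d' : H2 Q B} (h : D.IsTransgression c d)
    (h' : D.IsTransgression c' d') : D.IsTransgression (c + c') (d + d') := by
  obtain ⟨f, b, z, rfl, rfl, h1, h2⟩ := h
  obtain ⟨f', b', z', rfl, rfl, h1', h2'⟩ := h'
  refine ⟨f + f', b + b', z + z', rfl, rfl, fun n ↦ ?_, fun g h ↦ ?_⟩
  · simp [h1, h1']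
  · simp only [AddSubgroup.coe_add, Pi.add_apply, map_add, ← h2, ← h2', smul_add]
    abel

variable {D} in
theorem IsTransgression.neg {c : H1 N A} {d : H2 Q B} (h : D.IsTransgression c d) :
    D.IsTransgression (-c) (-d) := by
  obtain ⟨f, b, z, rfl, rfl, h1, h2⟩ := h
  refine ⟨-f, -b, -z, rfl, rfl, fun n ↦ ?_, fun g h ↦ ?_⟩
  · simp [h1]
  · simp only [AddSubgroup.coe_neg, Pi.neg_apply, map_neg, ← h2, smul_neg]
    abel

theorem π_ι (n : N) : D.π (D.ι n) = 1 := by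
  rw [← MonoidHom.mem_ker, D.exact]; exact ⟨n, rfl⟩

theorem exists_ι {g : Γ} (h : D.π g = 1) : ∃ n, D.ι n = g := by
  rwa [← MonoidHom.mem_ker, D.exact] at h

theorem exists_conj (g : Γ) (n : N) : ∃ m, D.ι m = g * D.ι n * g⁻¹ :=
  D.exists_ι (by simp [D.π_ι])

/-- Conjugation by `g : Γ` on the normal subgroup `N`. -/
def conj (g : Γ) : N →* N :=
  MonoidHom.mk' (fun n ↦ (D.exists_conj g n).choose) fun a b ↦ D.ι_injective <| by
    rw [(D.exists_conj g (a * b)).choose_spec, map_mul D.ι (Exists.choose _),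
      (D.exists_conj g a).choose_spec, (D.exists_conj g b).choose_spec, map_mul]
    group

theorem ι_conj (g : Γ) (n : N) : D.ι (D.conj g n) = g * D.ι n * g⁻¹ :=
  (D.exists_conj g n).choose_spec

variable {D} in
theorem IsTransgression.eq_zero {d : H2 Q B} (h : D.IsTransgression 0 d) : d = 0 := by
  obtain ⟨f, b, z, hf, rfl, h1, h2⟩ := h
  obtain ⟨x, hx⟩ := (QuotientAddGroup.eq_zero_iff f).mp hf
  -- subtract the coboundary of `x`
  let e : Γ → A := fun g ↦ b g - (g • x - x)
  have e1 (n) : e (D.ι n) = 0 := by simp [e, h1, ← hx, D.smul_ι]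
  have e2 (g h) : g • e h - e (g * h) + e g = D.incl (z.1 (D.π g, D.π h)) := by
    rw [← h2]; simp only [e, smul_sub, mul_smul]; abel
  have z11 : z.1 (1, 1) = 0 := D.incl_injective <| by
    have := e2 1 1
    rw [map_one, mul_one, ← map_one D.ι, e1] at this
    simp [← this]
  have z1 (q) : z.1 (1, q) = 0 := by
    rw [map_one_fst_of_isCocycle₂ z.2, z11]
  have z2 (q) : z.1 (q, 1) = 0 := by
    rw [map_one_snd_of_isCocycle₂ z.2, z11, smul_zero]
  have e3 (g n) : e (g * D.ι n) = e g := by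
    have := e2 g (D.ι n)
    rw [D.π_ι, z2, map_zero, e1, smul_zero, zero_sub, neg_add_eq_zero] at this
    exact this
  have e4 (n g) : e (D.ι n * g) = D.ι n • e g := by
    have := e2 (D.ι n) g
    rw [D.π_ι, z1, map_zero, e1, add_zero, sub_eq_zero] at this
    exact this.symm
  have e5 (g) (n : N) : n • e g = e g := by
    rw [← D.smul_ι, ← e4, ← e3 g (D.conj g⁻¹ n), D.ι_conj]
    congr 1; group
  choose y hy using fun g ↦ D.exists_incl (e g) (e5 g)
  obtain ⟨s, hs⟩ := D.π_surjective.hasRightInverse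
  have hys (g) : y (s (D.π g)) = y g := D.incl_injective <| by
    rw [hy, hy]
    obtain ⟨n, hn⟩ := D.exists_ι (g := g⁻¹ * s (D.π g)) (by rw [map_mul, hs, map_inv]; group)
    rw [← e3 g n, hn]; congr 1; group
  refine (QuotientAddGroup.eq_zero_iff z).mpr ⟨fun q ↦ y (s q), fun q r ↦ D.incl_injective ?_⟩
  have hm : y (s (q * r)) = y (s q * s r) := by rw [← hys (s q * s r), map_mul, hs, hs]
  have hq : D.incl (q • y (s r)) = s q • e (s r) := by
    rw [← hy, ← D.incl_smul, hs]
  change D.incl (q • y (s r) - y (s (q * r)) + y (s q)) = _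
  rw [map_add, map_sub, hq, hm, hy, hy, e2, hs, hs]

variable {D} in
theorem IsTransgression.unique {c : H1 N A} {d d' : H2 Q B} (h : D.IsTransgression c d)
    (h' : D.IsTransgression c d') : d = d' := by
  have := h.add h'.neg
  rw [add_neg_cancel] at this
  rw [← sub_eq_zero, sub_eq_add_neg, this.eq_zero]

variable [IsTopologicalGroup Γ]

theorem continuous_conj (g : Γ) : Continuous (D.conj g) := by
  rw [D.isInducing_ι.continuous_iff]
  have : D.ι ∘ D.conj g = fun n ↦ g * D.ι n * g⁻¹ := funext fun n ↦ D.ι_conj g n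
  rw [this]
  exact (continuous_const.mul D.isInducing_ι.continuous).mul continuous_const

/-- The action of `g : Γ` on `H¹(N, A)`: the class of `f` is sent to the class of
`n ↦ g • f (g⁻¹ n g)`. It factors through `Q`. -/
def conjAct (g : Γ) : H1 N A →+ H1 N A :=
  H1.map (D.conj g⁻¹) (D.continuous_conj _) (DistribSMul.toAddMonoidHom A g) fun n a ↦ by
    simp only [DistribSMul.toAddMonoidHom_apply, ← D.smul_ι, D.ι_conj, smul_smul]
    congr 1
    group

/-- The invariants `H¹(N, A) ^ Q`. -/
def invariants : AddSubgroup (H1 N A) where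
  carrier := {c | ∀ g, D.conjAct g c = c}
  zero_mem' := fun g ↦ map_zero _
  add_mem' {a b} ha hb := fun g ↦ by rw [map_add, ha g, hb g]
  neg_mem' {a} ha := fun g ↦ by rw [map_neg, ha g]

/-- The restriction map `H¹(Γ, A) → H¹(N, A) ^ Q`. -/
def res : H1 Γ A →+ D.invariants :=
  (H1.map D.ι D.isInducing_ι.continuous (AddMonoidHom.id A) fun n a ↦ D.smul_ι n a).codRestrict
    D.invariants <| by
      intro c g
      induction c using QuotientAddGroup.induction_on with
      | H f =>
      refine Eq.symm (QuotientAddGroup.eq.mpr ?_)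
      refine ⟨f.1 g, fun n ↦ ?_⟩
      have h1 := f.2.1 g (g⁻¹ * D.ι n * g)
      have h2 := f.2.1 (D.ι n) g
      rw [show g * (g⁻¹ * D.ι n * g) = D.ι n * g by group, h2] at h1
      have h3 : D.ι (D.conj g⁻¹ n) = g⁻¹ * D.ι n * g := by rw [D.ι_conj, inv_inv]
      simp only [Z1.map, AddMonoidHom.coe_mk, ZeroHom.coe_mk, AddSubgroup.coe_add,
        AddSubgroup.coe_neg, Pi.add_apply, Pi.neg_apply, AddMonoidHom.id_apply,
        DistribSMul.toAddMonoidHom_apply, h3, ← D.smul_ι]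
      rw [eq_neg_add_iff_add_eq, ← add_sub_assoc, sub_eq_iff_eq_add, ← h1]
      abel

variable {D}

theorem exists_isTransgression {c : H1 N A} (hc : c ∈ D.invariants) :
    ∃ d, D.IsTransgression c d := by
  induction c using QuotientAddGroup.induction_on with
  | H f =>
  -- a normalized section of `Γ → Q`
  obtain ⟨s, hs, hs1⟩ : ∃ s : Q → Γ, (∀ q, D.π (s q) = q) ∧ s 1 = 1 := by
    classical
    obtain ⟨s, hs⟩ := D.π_surjective.hasRightInverse
    refine ⟨Function.update s 1 1, fun q ↦ ?_, by simp⟩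
    by_cases h : q = 1
    · simp [h]
    · simp [h, hs q]
  have hinv (q : Q) : ∃ a : A, ∀ m m' : N, D.ι m' = s q * D.ι m * (s q)⁻¹ →
      s q • f.1 m - f.1 m' = D.ι m' • a - a := by
    obtain ⟨a, ha⟩ := QuotientAddGroup.eq.mp (hc (s q)).symm
    refine ⟨a, fun m m' h ↦ ?_⟩
    have hm : D.conj (s q)⁻¹ m' = m := D.ι_injective <| by rw [D.ι_conj, h]; group
    have := ha m'
    simp only [Z1.map, AddMonoidHom.coe_mk, ZeroHom.coe_mk, AddSubgroup.coe_add,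
        AddSubgroup.coe_neg, Pi.add_apply, Pi.neg_apply, 
        DistribSMul.toAddMonoidHom_apply, hm] at this
    rw [D.smul_ι, this]; abel
  obtain ⟨a, ha, ha1⟩ : ∃ a : Q → A, (∀ q, ∀ m m' : N, D.ι m' = s q * D.ι m * (s q)⁻¹ →
      s q • f.1 m - f.1 m' = D.ι m' • a q - a q) ∧ a 1 = 0 := by
    classical
    choose a ha using hinv
    refine ⟨Function.update a 1 0, fun q m m' h ↦ ?_, by simp⟩
    by_cases hq : q = 1
    · subst hq
      have : m' = m := D.ι_injective <| by simpa [hs1] using h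
      simp [hs1, this]
    · simpa [hq] using ha q m m' h
  have hn (g : Γ) : ∃ n, D.ι n = g * (s (D.π g))⁻¹ := D.exists_ι (by simp [hs])
  choose n hn using hn
  let b : Γ → A := fun g ↦ f.1 (n g) + D.ι (n g) • a (D.π g)
  have hb (m : N) (q : Q) : b (D.ι m * s q) = f.1 m + D.ι m • a q := by
    have hq : D.π (D.ι m * s q) = q := by rw [map_mul, D.π_ι, hs, one_mul]
    have : n (D.ι m * s q) = m := D.ι_injective <| by rw [hn, hq]; group
    simp only [b, hq, this]
  have hf (m m' : N) : f.1 (m * m') = D.ι m • f.1 m' + f.1 m := by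
    rw [f.2.1 m m', D.smul_ι]
  have hg (g : Γ) : g = D.ι (n g) * s (D.π g) := by rw [hn]; group
  have b0 (m : N) : b (D.ι m) = f.1 m := by
    have := hb m 1
    rwa [hs1, ha1, mul_one, smul_zero, add_zero] at this
  have b1 (m : N) (g : Γ) : b (D.ι m * g) = f.1 m + D.ι m • b g := by
    conv_lhs => rw [hg g, ← mul_assoc, ← map_mul, hb, hf]
    simp only [b, map_mul, mul_smul, smul_add]
    abel
  have b2 (g : Γ) (m : N) : b (g * D.ι m) = b g + g • f.1 m := by
    set q := D.π g with hqdef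
    have hm' := D.ι_conj (s q) m
    set m' := D.conj (s q) m
    have e : g * D.ι m = D.ι (n g * m') * s q := by
      rw [map_mul, hm']; conv_lhs => rw [hg g, ← hqdef]
      group
    have h1 := ha q m m' hm'
    rw [e, hb, hf, map_mul, mul_smul]
    have h2 : g • f.1 m = D.ι (n g) • s q • f.1 m := by rw [smul_smul, ← hg g]
    rw [h2, eq_add_of_sub_eq h1]
    simp only [b, ← hqdef, smul_add, smul_sub]
    abel
  let e : Γ → Γ → A := fun g h ↦ g • b h - b (g * h) + b g
  have e1 (m g h) : e (D.ι m * g) h = D.ι m • e g h := by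
    simp only [e, mul_assoc, b1, smul_add, smul_sub, mul_smul]; abel
  have e2 (g h m) : e g (h * D.ι m) = e g h := by
    simp only [e, ← mul_assoc, b2, smul_add, mul_smul]; abel
  have e0 (g h j) : e (g * h) j + e g h = g • e h j + e g (h * j) := by
    simp only [e, mul_assoc, smul_add, smul_sub, mul_smul]; abel
  have en (m h) : e (D.ι m) h = 0 := by simp only [e, b1, b0]; abel
  have en' (g m) : e g (D.ι m) = 0 := by simp only [e, b2, b0]; abel
  have e3 (g m h) : e (g * D.ι m) h = e g h := by
    have h1 := e0 g (D.ι m) h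
    rw [en, en', smul_zero, add_zero, zero_add] at h1
    have h2 := D.ι_conj h⁻¹ m
    rw [h1, ← e2 g h (D.conj h⁻¹ m), h2]
    congr 1; group
  have e4 (g h) (m : N) : m • e g h = e g h := by
    rw [← D.smul_ι, ← e1, ← e3 g (D.conj g⁻¹ m), D.ι_conj]
    congr 1; group
  have e5 {g g' h h'} (H : D.π g = D.π g') (H' : D.π h = D.π h') : e g h = e g' h' := by
    obtain ⟨m, hm⟩ := D.exists_ι (g := g⁻¹ * g') (by rw [map_mul, map_inv, H]; group)
    obtain ⟨m', hm'⟩ := D.exists_ι (g := h⁻¹ * h') (by rw [map_mul, map_inv, H']; group)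
    rw [← e3 g m, ← e2 _ h m', hm, hm']
    congr 1 <;> group
  choose y hy using fun g h ↦ D.exists_incl (e g h) (e4 g h)
  let z : Z2 Q B := ⟨fun p ↦ y (s p.1) (s p.2), fun p q r ↦ D.incl_injective <| by
    have h1 : D.incl (p • y (s q) (s r)) = s p • e (s q) (s r) := by
      rw [← hy, ← D.incl_smul, hs]
    rw [map_add, map_add, h1, hy, hy, hy, ← e5 (g := s p * s q) (h := s r) (by simp [hs]) rfl, e0,
      e5 (g := s p) (h := s q * s r) (g' := s p) (h' := s (q * r)) rfl (by simp [hs])]⟩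
  exact ⟨z, f, b, z, rfl, rfl, b0, fun g h ↦ by
    rw [hy]; exact e5 (by rw [hs]) (by rw [hs])⟩

variable (D) in
/-- The transgression map `H¹(N, A) ^ Q → H²(Q, A ^ N)`. -/
def trans : D.invariants →+ H2 Q B :=
  AddMonoidHom.mk' (fun c ↦ (exists_isTransgression c.2).choose) fun c c' ↦
    (exists_isTransgression (c + c').2).choose_spec.unique
      ((exists_isTransgression c.2).choose_spec.add (exists_isTransgression c'.2).choose_spec)

theorem isTransgression_trans (c : D.invariants) : D.IsTransgression c (D.trans c) :=
  (exists_isTransgression c.2).choose_spec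

end NormalExtension

/-! ### Points of an elliptic curve and Galois cohomology -/

section Points

variable {F : Type*} [Field F] (W : WeierstrassCurve F)

/-- The group `E(L)` of `L`-rational points, for an extension `L` of `F`. -/
def Points (L : Type*) [Field L] [Algebra F L] : Type _ := (W.baseChange L).toAffine.Point

variable {L L' L'' : Type*} [Field L] [Algebra F L] [Field L'] [Algebra F L']
  [Field L''] [Algebra F L'']

open scoped Classical in
instance : AddCommGroup (Points W L) :=
  inferInstanceAs (AddCommGroup (W.baseChange L).toAffine.Point)

open scoped Classical in
/-- The map `E(L) → E(L')` induced by an embedding `L → L'` over `F`. -/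
def Points.map (i : L →ₐ[F] L') : Points W L →+ Points W L' :=
  WeierstrassCurve.Affine.Point.map (W' := W.toAffine) i

variable {W}

theorem Points.map_map (i : L →ₐ[F] L') (j : L' →ₐ[F] L'') (P : Points W L) :
    Points.map W j (Points.map W i P) = Points.map W (j.comp i) P := by
  classical exact WeierstrassCurve.Affine.Point.map_map (W' := W.toAffine) i j P

theorem Points.map_id (P : Points W L) : Points.map W (AlgHom.id F L) P = P := by
  cases P <;> rfl

theorem Points.map_injective (i : L →ₐ[F] L') : Function.Injective (Points.map W i) := by
  classical exact WeierstrassCurve.Affine.Point.map_injective (W' := W.toAffine) i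

variable {S : Type*} [Field S] [Algebra F S] [Algebra S L] [IsScalarTower F S L]

/-- The action of `Gal(L/S)` on `E(L)`. -/
instance : DistribMulAction (L ≃ₐ[S] L) (Points W L) where
  smul σ := Points.map W (σ.restrictScalars F : L ≃ₐ[F] L).toAlgHom
  one_smul P := Points.map_id P
  mul_smul σ τ P := (Points.map_map (τ.restrictScalars F : L ≃ₐ[F] L).toAlgHom
    (σ.restrictScalars F : L ≃ₐ[F] L).toAlgHom P).symm
  smul_zero _ := map_zero _
  smul_add _ := map_add _

theorem Points.smul_def (σ : L ≃ₐ[S] L) (P : Points W L) :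
    σ • P = Points.map W (σ.restrictScalars F : L ≃ₐ[F] L).toAlgHom P := rfl

end Points

section GaloisRestriction

variable {S L L' : Type*} (S' : Type*) [Field S] [Field S'] [Field L] [Field L']
  [Algebra S L] [Normal S L] [Algebra S S'] [Algebra S' L'] [Algebra S L'] [IsScalarTower S S' L']

/-- For an embedding `i : L → L'` over `S`, with `L/S` normal and `L'` an extension of `S' ⊇ S`,
the homomorphism `Gal(L'/S') → Gal(L/S)` that restricts automorphisms to `L`. -/
def galRes (i : L →ₐ[S] L') : (L' ≃ₐ[S'] L') →* (L ≃ₐ[S] L) :=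
  letI : Algebra L L' := i.toRingHom.toAlgebra
  haveI : IsScalarTower S L L' := .of_algebraMap_eq fun x ↦ (i.commutes x).symm
  (AlgEquiv.restrictNormalHom L).comp (AlgEquiv.restrictScalarsHom S)

variable {S'}

theorem galRes_apply (i : L →ₐ[S] L') (σ : L' ≃ₐ[S'] L') (x : L) :
    i (galRes S' i σ x) = σ (i x) := by
  let : Algebra L L' := i.toRingHom.toAlgebra
  have : IsScalarTower S L L' := .of_algebraMap_eq fun x ↦ (i.commutes x).symm
  exact AlgEquiv.restrictNormal_commutes (σ.restrictScalars S) L x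

theorem continuous_galRes (i : L →ₐ[S] L') : Continuous (galRes S' i) := by
  refine continuous_of_continuousAt_one _ (continuousAt_def.mpr fun U hU ↦ ?_)
  rw [map_one, krullTopology_mem_nhds_one_iff] at hU
  obtain ⟨M, _, hM⟩ := hU
  let b := Module.finBasis S M
  let M' : IntermediateField S' L' := IntermediateField.adjoin S' (Set.range fun j ↦ i (b j))
  have : FiniteDimensional S' M' := IntermediateField.finiteDimensional_adjoin fun x hx ↦ by
    obtain ⟨j, rfl⟩ := hx
    exact ((Normal.isIntegral ‹_› (b j : L)).map i).tower_top
  rw [krullTopology_mem_nhds_one_iff]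
  refine ⟨M', this, fun σ hσ ↦ hM ?_⟩
  rw [SetLike.mem_coe, IntermediateField.mem_fixingSubgroup_iff] at hσ ⊢
  have hi : Function.Injective i := RingHom.injective _
  have hb : (galRes S' i σ).toLinearMap ∘ₗ M.val.toLinearMap = M.val.toLinearMap :=
    b.ext fun j ↦ hi <| (galRes_apply i σ _).trans <|
      hσ _ (IntermediateField.subset_adjoin _ _ ⟨j, rfl⟩)
  exact fun x hx ↦ LinearMap.congr_fun hb ⟨x, hx⟩

variable (S') {F : Type*} [Field F] (W : WeierstrassCurve F) [Algebra F S] [Algebra F S']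
  [Algebra F L] [Algebra F L'] [IsScalarTower F S L] [IsScalarTower F S L'] [IsScalarTower F S' L']

/-- The map `H¹(Gal(L/S), E(L)) → H¹(Gal(L'/S'), E(L'))` induced by an embedding `i : L → L'`
over `S`. -/
def galMap (i : L →ₐ[S] L') :
    H1 (L ≃ₐ[S] L) (Points W L) →+ H1 (L' ≃ₐ[S'] L') (Points W L') :=
  H1.map (galRes S' i) (continuous_galRes i) (Points.map W (i.restrictScalars F)) fun σ P ↦ by
    rw [Points.smul_def, Points.smul_def, Points.map_map, Points.map_map]
    congr 1
    exact congrArg _ (AlgHom.ext fun x ↦ galRes_apply i σ x)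

theorem galMap_comp {S'' L'' : Type*} [Field S''] [Field L''] [Normal S' L'] [Algebra S S'']
    [Algebra S' S''] [Algebra S'' L''] [Algebra S L''] [Algebra S' L''] [IsScalarTower S S'' L'']
    [IsScalarTower S' S'' L''] [Algebra F S''] [Algebra F L''] [IsScalarTower F S L'']
    [IsScalarTower F S' L''] [IsScalarTower F S'' L'']
    (i : L →ₐ[S] L') (j : L' →ₐ[S'] L'') (k : L →ₐ[S] L'') (h : ∀ x, j (i x) = k x)
    (c : H1 (L ≃ₐ[S] L) (Points W L)) :
    galMap S'' W j (galMap S' W i c) = galMap S'' W k c := by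
  induction c using QuotientAddGroup.induction_on with
  | H f =>
  have hres (σ : L'' ≃ₐ[S''] L'') : galRes S' i (galRes S'' j σ) = galRes S'' k σ :=
    AlgEquiv.ext fun x ↦ (show Function.Injective k from RingHom.injective _) <| by
      rw [← h, galRes_apply, galRes_apply, galRes_apply, h]
  have hmap : (j.restrictScalars F).comp (i.restrictScalars F) = k.restrictScalars F :=
    AlgHom.ext h
  refine congrArg _ (Subtype.ext (funext fun σ ↦ ?_))
  simp only [Z1.map, AddMonoidHom.coe_mk, ZeroHom.coe_mk, hres, Points.map_map, hmap]

end GaloisRestriction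

/-! ### The Tate–Shafarevich group and the transgression of an elliptic curve -/

section Global

theorem IsAlgClosure.normal_top (F K Ω : Type*) [Field F] [Field K] [Algebra F K] [Field Ω]
    [Algebra F Ω] [Algebra K Ω] [IsScalarTower F K Ω] [IsAlgClosure F Ω] : Normal K Ω :=
  Normal.tower_top_of_normal F K Ω

theorem IsAlgClosure.isAlgebraic_top (F K Ω : Type*) [Field F] [Field K] [Algebra F K] [Field Ω]
    [Algebra F Ω] [Algebra K Ω] [IsScalarTower F K Ω] [IsAlgClosure F Ω] :
    Algebra.IsAlgebraic K Ω :=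
  haveI : Algebra.IsAlgebraic F Ω := IsAlgClosure.isAlgebraic
  Algebra.IsAlgebraic.tower_top (K := F) K

variable (F K Ω : Type*) [Field F] [NumberField F] [Field K] [NumberField K] [Algebra F K]
  [Field Ω] [Algebra F Ω] [Algebra K Ω] [IsScalarTower F K Ω] [IsAlgClosure F Ω]
  (W : WeierstrassCurve F)

variable {K} in
/-- A fixed embedding over `K` of the algebraic closure `Ω` of `K` in an algebraic closure of the
completion `K_w`. -/
def Place.embed (w : Place K) : Ω →ₐ[K] AlgebraicClosure w.Completion :=
  haveI := IsAlgClosure.isAlgebraic_top F K Ω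
  IsAlgClosed.lift

variable {K} in
/-- The localization map `H¹(G_K, E) → H¹(G_{K_w}, E)` at a place `w` of `K`. -/
def localMap (w : Place K) : H1 (Ω ≃ₐ[K] Ω) (Points W Ω) →+
    H1 (AlgebraicClosure w.Completion ≃ₐ[w.Completion] AlgebraicClosure w.Completion)
      (Points W (AlgebraicClosure w.Completion)) :=
  haveI := IsAlgClosure.normal_top F K Ω
  galMap w.Completion W (w.embed F Ω)

/-- The Tate–Shafarevich group `Ш(E/K)`: the everywhere locally trivial classes in `H¹(G_K, E)`. -/
def sha : AddSubgroup (H1 (Ω ≃ₐ[K] Ω) (Points W Ω)) := ⨅ w : Place K, (localMap F Ω W w).ker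

variable [IsGalois F K]

theorem isInducing_restrictScalarsHom (F K Ω : Type*) [Field F] [Field K] [Algebra F K]
    [FiniteDimensional F K] [Field Ω] [Algebra F Ω] [Algebra K Ω] [IsScalarTower F K Ω]
    [Normal F Ω] :
    Topology.IsInducing (AlgEquiv.restrictScalarsHom F : (Ω ≃ₐ[K] Ω) →* (Ω ≃ₐ[F] Ω)) := by
  have heq : galRes K (AlgHom.id F Ω) = AlgEquiv.restrictScalarsHom F :=
    MonoidHom.ext fun σ ↦ AlgEquiv.ext fun x ↦ galRes_apply (AlgHom.id F Ω) σ x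
  have hcont : Continuous (AlgEquiv.restrictScalarsHom F : (Ω ≃ₐ[K] Ω) →* (Ω ≃ₐ[F] Ω)) :=
    heq ▸ continuous_galRes (S' := K) (AlgHom.id F Ω)
  refine ⟨IsTopologicalGroup.ext inferInstance (topologicalGroup_induced _) ?_⟩
  rw [nhds_induced, map_one]
  refine le_antisymm (Filter.map_le_iff_le_comap.mp (hcont.tendsto' 1 1 (map_one _))) ?_
  intro U hU
  obtain ⟨M, hM, hMU⟩ := (krullTopology_mem_nhds_one_iff K Ω U).mp hU
  have : FiniteDimensional F (M.restrictScalars F) := FiniteDimensional.trans F K M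
  exact ⟨(M.restrictScalars F).fixingSubgroup,
    (krullTopology_mem_nhds_one_iff F Ω _).mpr ⟨M.restrictScalars F, this, subset_rfl⟩,
    fun σ hσ ↦ hMU fun x ↦ hσ x⟩

theorem ker_restrictNormalHom (F K Ω : Type*) [Field F] [Field K] [Algebra F K] [Normal F K]
    [Field Ω] [Algebra F Ω] [Algebra K Ω] [IsScalarTower F K Ω] :
    (AlgEquiv.restrictNormalHom K : (Ω ≃ₐ[F] Ω) →* (K ≃ₐ[F] K)).ker =
      (AlgEquiv.restrictScalarsHom F : (Ω ≃ₐ[K] Ω) →* (Ω ≃ₐ[F] Ω)).range := by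
  ext σ
  rw [MonoidHom.mem_ker, MonoidHom.mem_range]
  constructor
  · intro h
    refine ⟨AlgEquiv.ofRingEquiv (f := σ.toRingEquiv) fun x ↦ ?_, rfl⟩
    have h1 := AlgEquiv.restrictNormal_commutes σ K x
    have h2 : σ.restrictNormal K = 1 := h
    rw [h2] at h1
    exact h1.symm
  · rintro ⟨τ, rfl⟩
    refine AlgEquiv.ext fun x ↦ (algebraMap K Ω).injective ?_
    exact (AlgEquiv.restrictNormal_commutes _ K x).trans (τ.commutes x)

theorem exists_map_eq_of_fixed (F K Ω : Type*) [Field F] [CharZero F] [Field K] [Algebra F K]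
    [Field Ω] [Algebra F Ω] [Algebra K Ω] [IsScalarTower F K Ω] [IsAlgClosure F Ω]
    (W : WeierstrassCurve F) (P : Points W Ω) (hP : ∀ σ : Ω ≃ₐ[K] Ω, σ • P = P) :
    ∃ Q : Points W K, Points.map W (IsScalarTower.toAlgHom F K Ω) Q = P := by
  have : Normal K Ω := IsAlgClosure.normal_top F K Ω
  have : CharZero K := charZero_of_injective_algebraMap (algebraMap F K).injective
  have : IsGalois K Ω := ⟨⟩
  have hfix (x : Ω) (h : ∀ σ : Ω ≃ₐ[K] Ω, σ x = x) : ∃ y : K, algebraMap K Ω y = x :=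
    (InfiniteGalois.mem_range_algebraMap_iff_fixed x).mpr h
  match P, hP with
  | .zero, _ => exact ⟨0, rfl⟩
  | .some x y h, hP =>
    have hx (σ : Ω ≃ₐ[K] Ω) : σ x = x ∧ σ y = y := by
      simpa using WeierstrassCurve.Affine.Point.some.inj (hP σ)
    obtain ⟨x', rfl⟩ := hfix x fun σ ↦ (hx σ).1
    obtain ⟨y', rfl⟩ := hfix y fun σ ↦ (hx σ).2
    exact ⟨.some x' y' ((W.toAffine.baseChange_nonsingular
      (f := IsScalarTower.toAlgHom F K Ω) (algebraMap K Ω).injective x' y').mp h), rfl⟩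

/-- The extension `1 → G_K → G_F → Gal(K/F) → 1` together with the `G_F`-module `E(Ω)` and its
`G_K`-invariants `E(K)`. -/
def galExtension :
    NormalExtension (Ω ≃ₐ[K] Ω) (Ω ≃ₐ[F] Ω) (K ≃ₐ[F] K) (Points W K) (Points W Ω) where
  ι := AlgEquiv.restrictScalarsHom F
  π := AlgEquiv.restrictNormalHom K
  incl := Points.map W (IsScalarTower.toAlgHom F K Ω)
  isInducing_ι := haveI : Normal F Ω := IsAlgClosure.normal F Ω
    isInducing_restrictScalarsHom F K Ω
  ι_injective := AlgEquiv.restrictScalars_injective F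
  π_surjective := haveI : Normal F Ω := IsAlgClosure.normal F Ω
    AlgEquiv.restrictNormalHom_surjective Ω
  exact := ker_restrictNormalHom F K Ω
  smul_ι _ _ := rfl
  incl_smul σ P := by
    rw [Points.smul_def, Points.smul_def, Points.map_map, Points.map_map]
    congr 1
    exact congrArg _ (AlgHom.ext fun x ↦ AlgEquiv.restrictNormal_commutes σ K x)
  incl_injective := Points.map_injective _
  exists_incl := exists_map_eq_of_fixed F K Ω W

/-- The restriction map `Res : H¹(G_F, E) → H¹(G_K, E) ^ G`. -/
def globalRes : H1 (Ω ≃ₐ[F] Ω) (Points W Ω) →+ (galExtension F K Ω W).invariants :=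
  (galExtension F K Ω W).res

/-- The transgression map `Trans : H¹(G_K, E) ^ G → H²(G, E(K))`. -/
def globalTrans : (galExtension F K Ω W).invariants →+ H2 (K ≃ₐ[F] K) (Points W K) :=
  (galExtension F K Ω W).trans

/-- `Ш(E/K) ^ G`, as a subgroup of `H¹(G_K, E) ^ G`. -/
def shaInvariants : AddSubgroup (galExtension F K Ω W).invariants :=
  (sha F K Ω W).addSubgroupOf (galExtension F K Ω W).invariants

/-- The restriction of `Res` to `Ш(E/F)`. -/
def resSha : sha F F Ω W →+ (galExtension F K Ω W).invariants :=
  (globalRes F K Ω W).comp (sha F F Ω W).subtype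

/-- The restriction of `Trans` to `Ш(E/K) ^ G`. -/
def transSha : shaInvariants F K Ω W →+ H2 (K ≃ₐ[F] K) (Points W K) :=
  (globalTrans F K Ω W).comp (shaInvariants F K Ω W).subtype

/-- The kernel of the restriction of `Trans` to `Ш(E/K) ^ G`, as a subgroup of `H¹(G_K, E) ^ G`. -/
def kerTransSha : AddSubgroup (galExtension F K Ω W).invariants :=
  (transSha F K Ω W).ker.map (shaInvariants F K Ω W).subtype

end Global

section Local

open scoped DirectSum

variable {F K : Type*} (Ω : Type*) [Field F] [NumberField F] [Field K] [NumberField K] [Algebra F K]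
  [Field Ω] [Algebra F Ω] [Algebra K Ω] [IsScalarTower F K Ω] [IsAlgClosure F Ω] [IsGalois F K]
  (W : WeierstrassCurve F)

/-- An algebraic closure of `K_w`, hence of `F_v`, for a place `w` above `v`. -/
abbrev Place.Above.Closure {v : Place F} (w : v.Above K) : Type _ := AlgebraicClosure w.Completion

/-- `H¹(G_w, E(K_w))`, where `G_w = Gal(K_w/F_v)`. -/
abbrev LocalH1 {v : Place F} (w : v.Above K) : Type _ :=
  H1 (w.Completion ≃ₐ[v.Completion] w.Completion) (Points W w.Completion)

/-- `H¹(G_{F_v}, E)`, with respect to the algebraic closure of `F_v` chosen for `w`. -/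
abbrev LocalAbsH1 {v : Place F} (w : v.Above K) : Type _ :=
  H1 (w.Closure ≃ₐ[v.Completion] w.Closure) (Points W w.Closure)

/-- The embedding of `Ω` in the algebraic closure of `K_w`. -/
def Place.Above.embed {v : Place F} (w : v.Above K) : Ω →ₐ[K] w.Closure := w.1.embed F Ω

/-- The component `H¹(G, E(K)) → H¹(G_w, E(K_w))` of the localization map `𝓕`. -/
def locF {v : Place F} (w : v.Above K) :
    H1 (K ≃ₐ[F] K) (Points W K) →+ LocalH1 W w :=
  galMap v.Completion W (IsScalarTower.toAlgHom F K w.Completion)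

/-- The component `H¹(G_F, E) → H¹(G_{F_v}, E)` of the localization map `𝓖`. -/
def locG {v : Place F} (w : v.Above K) :
    H1 (Ω ≃ₐ[F] Ω) (Points W Ω) →+ LocalAbsH1 W w :=
  galMap v.Completion W ((w.embed Ω).restrictScalars F)

/-- The inflation map `H¹(G, E(K)) → H¹(G_F, E)`. -/
def globalInf : H1 (K ≃ₐ[F] K) (Points W K) →+ H1 (Ω ≃ₐ[F] Ω) (Points W Ω) :=
  galMap F W (IsScalarTower.toAlgHom F K Ω)

/-- The local inflation map `H¹(G_w, E(K_w)) → H¹(G_{F_v}, E)`. -/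
def locInf {v : Place F} (w : v.Above K) : LocalH1 W w →+ LocalAbsH1 W w :=
  galMap v.Completion W (IsScalarTower.toAlgHom v.Completion w.Completion w.Closure)

theorem locInf_locF {v : Place F} (w : v.Above K) (c : H1 (K ≃ₐ[F] K) (Points W K)) :
    locInf W w (locF W w c) = locG Ω W w (globalInf Ω W c) := by
  let k : K →ₐ[F] w.Closure := IsScalarTower.toAlgHom F K w.Closure
  rw [locInf, locF, galMap_comp _ _ _ _ k (fun x ↦ rfl), locG, globalInf,
    galMap_comp _ _ _ _ k (fun x ↦ (w.embed Ω).commutes x)]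

variable (w : ∀ v : Place F, v.Above K)

/-- The image of `𝓕 : H¹(G, E(K)) → ⨁ᵥ H¹(G_w, E(K_w))`: the elements of the direct sum whose
components are the localizations of some global class. As a global class is locally trivial at all
but finitely many places, this is the whole image of the family of all localization maps. -/
def imF : AddSubgroup (⨁ v, LocalH1 W (w v)) :=
  (AddMonoidHom.pi fun v ↦ locF W (w v)).range.comap (DirectSum.coeFnAddMonoidHom _)

/-- The image of `𝓖 : H¹(G_F, E) → ⨁ᵥ H¹(G_{F_v}, E)`: the elements of the direct sum whose
components are the localizations of some global class. As a global class is locally trivial at all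
but finitely many places, this is the whole image of the family of all localization maps. -/
def imG : AddSubgroup (⨁ v, LocalAbsH1 W (w v)) :=
  (AddMonoidHom.pi fun v ↦ locG Ω W (w v)).range.comap (DirectSum.coeFnAddMonoidHom _)

/-- `Coker 𝓕`. -/
abbrev CokerF : Type _ := (⨁ v, LocalH1 W (w v)) ⧸ imF W w

/-- `Coker 𝓖`. -/
abbrev CokerG : Type _ := (⨁ v, LocalAbsH1 W (w v)) ⧸ imG Ω W w

/-- The map `𝓘 : Coker 𝓕 → Coker 𝓖` induced by the local inflation maps. -/
def mapI : CokerF W w →+ CokerG Ω W w :=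
  QuotientAddGroup.map _ _ (DirectSum.map fun v ↦ locInf W (w v)) <| by
    rintro x ⟨c, hc⟩
    refine ⟨globalInf (K := K) Ω W c, funext fun v ↦ ?_⟩
    have h : locF W (w v) c = x v := congrFun hc v
    change locG Ω W (w v) (globalInf Ω W c) = DirectSum.map (fun v ↦ locInf W (w v)) x v
    rw [DirectSum.map_apply, ← h, locInf_locF Ω]

end Local

end

/-! Consider the pairs (c, x) of a global class c in H¹(G_F, E) and an element x of ⨁ H¹(G_w,
E(K_w)) such that every localization of c is the inflation of the component of x
(`matchingClasses`). The isomorphism compares two surjections from this group. Sending (c, x) to the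
class of x maps onto Ker 𝓘, by the definition of the two cokernels. Sending (c, x) to Res c lands in
Ker(trans): by local inflation-restriction the localization of c at v is inflated from K_w exactly
when Res c dies at w, and the places above v have isomorphic completions over F, so Res c lies in
Ш(E/K) (`globalRes_mem_sha_iff`). Both quotients kill the same pairs: x = 𝓕(d) means that c - inf d
lies in Ш(E/F), and inf d generates exactly the ambiguity ker Res (`mem_imF_iff`, which uses that
local inflation is injective).

Surjectivity onto Ker(trans) needs two facts. A class with zero transgression is a restriction, by
exactness of the inflation-restriction sequence (`NormalExtension.exists_res_eq_of_trans_eq_zero`).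
And the local classes matching c must have finite support, which reduces to the arithmetic core: a
global class is locally trivial at almost all places (`finite_locG_ne_zero`).

For that core, divisibility of E(Ω) lets a cocycle be moved to one with values in the n-torsion that
vanishes on the fixator of a single element α (`exists_nsmul_eq_zero_of_cocycle`). At almost every
prime the curve has good reduction, n is invertible and the conjugates of α stay distinct modulo the
prime. The kernel of reduction has no n-power torsion there, so an automorphism acts on α and on
n-power torsion points through its residue action, and on finitely many such elements it agrees with
a power of Frobenius φ. Only finitely many n-power torsion points are fixed by φ, so φ - 1 is
surjective on that torsion (`exists_map_sub_eq`); subtracting a coboundary kills the cocycle at φ,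
hence everywhere (`H1.eq_zero_of_unramified`).

Divisibility and finiteness of torsion are obtained by specializing a generic point of the curve
over the algebraic closure of k(t) (`Points.exists_nsmul_eq_and_finite_torsion`). -/

namespace ValuationSubring

/-! ### Units and the maximal ideal of a valuation ring -/

variable {M : Type*} [Field M] (V : ValuationSubring M)

theorem ne_zero_and_inv_mem_of_sub_one {u : M} (h : V.valuation (u - 1) < 1) : u ≠ 0 ∧ u⁻¹ ∈ V := by
  have h1 : V.valuation u = 1 := by
    have := V.valuation.map_add_eq_of_lt_right (x := u - 1) (y := 1) (by simpa using h)
    simpa using this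
  refine ⟨fun h0 ↦ by simp [h0] at h1, ?_⟩
  rw [← V.valuation_le_one_iff, map_inv₀, h1, inv_one]

theorem valuation_mul_lt_one {a b : M} (ha : a ∈ V) (hb : V.valuation b < 1) :
    V.valuation (a * b) < 1 := by
  rw [map_mul]
  exact mul_lt_one_of_nonneg_of_lt_one_right ((V.valuation_le_one_iff a).mpr ha) zero_le hb

theorem mem_of_valuation_lt_one {a : M} (h : V.valuation a < 1) : a ∈ V :=
  (V.valuation_le_one_iff a).mp h.le

theorem inv_mem_of_notMem {a : M} (h : a ∉ V) : V.valuation a⁻¹ < 1 := by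
  rw [← V.valuation_le_one_iff, not_le] at h
  rw [map_inv₀]
  exact inv_lt_one_of_one_lt₀ h

theorem not_valuation_lt_one_of_inv_mem {a : M} (h0 : a ≠ 0) (h : a⁻¹ ∈ V) :
    ¬V.valuation a < 1 := fun ha ↦ by
  have := V.valuation_mul_lt_one h ha
  rw [inv_mul_cancel₀ h0, map_one] at this
  exact lt_irrefl _ this

end ValuationSubring

/-! ### Points near the origin of a Weierstrass curve -/

namespace WeierstrassCurve.Affine

variable {M : Type*} [Field M] (W : WeierstrassCurve.Affine M) (V : ValuationSubring M)

/-- The coefficients of a Weierstrass curve lie in the valuation ring `V`. -/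
structure CoeffMem : Prop where
  a₁ : W.a₁ ∈ V
  a₂ : W.a₂ ∈ V
  a₃ : W.a₃ ∈ V
  a₄ : W.a₄ ∈ V
  a₆ : W.a₆ ∈ V

variable {W V}

/-- A point whose `x`-coordinate is not integral: in terms of `z = -x/y`, the quotient `w / z³` is
integral for `w = -1/y`. -/
theorem CoeffMem.valuation_of_notMem (hW : W.CoeffMem V) {x y : M} (h : W.Equation x y)
    (hx : x ∉ V) : x ≠ 0 ∧ y ≠ 0 ∧ V.valuation (x / y) < 1 ∧ V.valuation y⁻¹ < 1 ∧
      y ^ 2 / x ^ 3 ∈ V := by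
  have hx1 : 1 < V.valuation x := by rwa [← V.valuation_le_one_iff, not_le] at hx
  have hx0 : x ≠ 0 := by rintro rfl; exact hx (zero_mem V)
  have hle {a : M} (ha : a ∈ V) : V.valuation a ≤ 1 := (V.valuation_le_one_iff a).mpr ha
  rw [equation_iff] at h
  have hxi := V.inv_mem_of_notMem hx
  have hxV := V.mem_of_valuation_lt_one hxi
  -- The cubic is x³ times a principal unit, because x⁻¹ lies in the maximal ideal.
  have hr : V.valuation (y ^ 2 + W.a₁ * x * y + W.a₃ * y) = V.valuation x ^ 3 := by
    rw [h, show x ^ 3 + W.a₂ * x ^ 2 + W.a₄ * x + W.a₆ =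
      x ^ 3 * (1 + (W.a₂ + W.a₄ * x⁻¹ + W.a₆ * x⁻¹ ^ 2) * x⁻¹) by field_simp; ring, map_mul, map_pow]
    have : V.valuation ((W.a₂ + W.a₄ * x⁻¹ + W.a₆ * x⁻¹ ^ 2) * x⁻¹) < 1 :=
      V.valuation_mul_lt_one (by
        have := hW.a₂; have := hW.a₄; have := hW.a₆
        apply_rules [add_mem, mul_mem, pow_mem]) hxi
    rw [V.valuation.map_one_add_of_lt this, mul_one]
  -- Otherwise all terms on the left of the Weierstrass equation have valuation at most v(x)², which
  -- is less than v(x)³.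
  have hlt : V.valuation x < V.valuation y := by
    by_contra! hle'
    have hb : V.valuation (y ^ 2 + W.a₁ * x * y + W.a₃ * y) ≤ V.valuation x ^ 2 := by
      have hy2 : V.valuation (y ^ 2) ≤ V.valuation x ^ 2 := by
        rw [map_pow]; exact pow_le_pow_left₀ zero_le hle' 2
      refine V.valuation.map_add_le (V.valuation.map_add_le hy2 ?_) ?_
      · rw [map_mul, map_mul, sq]
        exact mul_le_mul' (mul_le_of_le_one_left' (hle hW.a₁)) hle'
      · rw [map_mul, sq]
        exact mul_le_mul' ((hle hW.a₃).trans hx1.le) hle'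
    rw [hr] at hb
    exact absurd hb (not_le.mpr (pow_lt_pow_right₀ hx1 (by norm_num)))
  have hy1 : 1 < V.valuation y := hx1.trans hlt
  have hy0 : y ≠ 0 := by rintro rfl; simp at hlt
  have hxy : V.valuation (x / y) < 1 := by
    rw [map_div₀]; exact (div_lt_one₀ (zero_lt_one.trans hy1)).mpr hlt
  have hyi : V.valuation y⁻¹ < 1 := by
    rw [map_inv₀]; exact inv_lt_one_of_one_lt₀ hy1
  refine ⟨hx0, hy0, hxy, hyi, ?_⟩
  rw [← V.valuation_le_one_iff, map_div₀, map_pow V.valuation x, ← hr,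
    show y ^ 2 + W.a₁ * x * y + W.a₃ * y = y ^ 2 * (1 + (W.a₁ * (x / y) + W.a₃ * y⁻¹)) by
      field_simp; ring, map_mul]
  have : V.valuation (W.a₁ * (x / y) + W.a₃ * y⁻¹) < 1 :=
    V.valuation.map_add_lt (V.valuation_mul_lt_one hW.a₁ hxy) (V.valuation_mul_lt_one hW.a₃ hyi)
  rw [V.valuation.map_one_add_of_lt this, mul_one, div_self]
  simp [hy0]

end WeierstrassCurve.Affine

/-! ### Chords and tangents in the coordinates z = -x/y, w = -1/y -/

namespace WeierstrassCurve.Affine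

variable {M : Type*} [Field M] {W : WeierstrassCurve.Affine M} {V : ValuationSubring M}

/-- The symmetric functions of the abscissas of three collinear points. -/
theorem collinear_symmetric [DecidableEq M] {x₁ x₂ y₁ y₂ : M} (h₁ : W.Equation x₁ y₁)
    (h₂ : W.Equation x₂ y₂) (hxy : ¬(x₁ = x₂ ∧ y₁ = W.negY x₂ y₂)) {l m x₃ : M}
    (hl : W.slope x₁ x₂ y₁ y₂ = l) (hm : m = y₁ - l * x₁) (hx₃ : x₃ = W.addX x₁ x₂ l) :
    x₁ + x₂ + x₃ = l ^ 2 + W.a₁ * l - W.a₂ ∧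
    x₁ * x₂ + x₁ * x₃ + x₂ * x₃ = W.a₄ - W.a₃ * l - 2 * l * m - W.a₁ * m ∧
    x₁ * x₂ * x₃ = m ^ 2 + W.a₃ * m - W.a₆ := by
  have h := addPolynomial_slope h₁ h₂ hxy
  rw [hl, ← hx₃, addPolynomial_eq, neg_inj] at h
  have h0 := congrArg (Polynomial.coeff · 0) h
  have h1 := congrArg (Polynomial.coeff · 1) h
  have hr : (Polynomial.X - Polynomial.C x₁) * (Polynomial.X - Polynomial.C x₂) *
      (Polynomial.X - Polynomial.C x₃) = Cubic.toPoly ⟨1, -(x₁ + x₂ + x₃),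
        x₁ * x₂ + x₁ * x₃ + x₂ * x₃, -(x₁ * x₂ * x₃)⟩ := by
    simp only [Cubic.toPoly, map_neg, map_add, map_mul, map_one]; ring
  rw [hr] at h0 h1
  simp only [Cubic.coeff_eq_d, Cubic.coeff_eq_c] at h0 h1
  subst hm hx₃
  refine ⟨by rw [addX]; ring, by linear_combination -h1, by linear_combination h0⟩

/-- Three points on the line `w = L z + n` in the coordinates `z = -x/y`, `w = -1/y`. -/
theorem collinear_sum {a₁ a₂ a₃ a₄ a₆ x₁ x₂ x₃ L n : M} (hn : n ≠ 0)
    (e1 : x₁ + x₂ + x₃ = (L / n) ^ 2 + a₁ * (L / n) - a₂)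
    (e2 : x₁ * x₂ + x₁ * x₃ + x₂ * x₃ = a₄ - a₃ * (L / n) - 2 * (L / n) * (-1 / n) - a₁ * (-1 / n))
    (e3 : x₁ * x₂ * x₃ = (-1 / n) ^ 2 + a₃ * (-1 / n) - a₆)
    (hc : 1 + a₂ * L + a₄ * L ^ 2 + a₆ * L ^ 3 ≠ 0) :
    1 - L * x₁ ≠ 0 ∧ 1 - L * x₂ ≠ 0 ∧ 1 - L * x₃ ≠ 0 ∧
    x₁ * n / (1 - L * x₁) + x₂ * n / (1 - L * x₂) + x₃ * n / (1 - L * x₃) =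
      -(a₁ * L + a₂ * n + a₃ * L ^ 2 + 2 * a₄ * L * n + 3 * a₆ * L ^ 2 * n) *
        (1 + a₂ * L + a₄ * L ^ 2 + a₆ * L ^ 3)⁻¹ := by
  have hp : (1 - L * x₁) * (1 - L * x₂) * (1 - L * x₃) =
      1 + a₂ * L + a₄ * L ^ 2 + a₆ * L ^ 3 := by
    rw [show (1 - L * x₁) * (1 - L * x₂) * (1 - L * x₃) = 1 - L * (x₁ + x₂ + x₃) +
      L ^ 2 * (x₁ * x₂ + x₁ * x₃ + x₂ * x₃) - L ^ 3 * (x₁ * x₂ * x₃) by ring, e1, e2, e3]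
    field_simp
    ring
  have hne := hp.trans_ne hc
  have h1 : 1 - L * x₁ ≠ 0 := fun h ↦ hne (by rw [h]; ring)
  have h2 : 1 - L * x₂ ≠ 0 := fun h ↦ hne (by rw [h]; ring)
  have h3 : 1 - L * x₃ ≠ 0 := fun h ↦ hne (by rw [h]; ring)
  refine ⟨h1, h2, h3, ?_⟩
  rw [← hp, ← div_eq_mul_inv, eq_div_iff hne]
  have : -(a₁ * L + a₂ * n + a₃ * L ^ 2 + 2 * a₄ * L * n + 3 * a₆ * L ^ 2 * n) =
      n * (x₁ + x₂ + x₃) - 2 * L * n * (x₁ * x₂ + x₁ * x₃ + x₂ * x₃) +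
        3 * L ^ 2 * n * (x₁ * x₂ * x₃) := by
    rw [e1, e2, e3]
    field_simp
    ring
  rw [this, add_mul, add_mul]
  have k1 : x₁ * n / (1 - L * x₁) * ((1 - L * x₁) * (1 - L * x₂) * (1 - L * x₃)) =
      x₁ * n * ((1 - L * x₂) * (1 - L * x₃)) := by rw [div_mul_eq_mul_div, div_eq_iff h1]; ring
  have k2 : x₂ * n / (1 - L * x₂) * ((1 - L * x₁) * (1 - L * x₂) * (1 - L * x₃)) =
      x₂ * n * ((1 - L * x₁) * (1 - L * x₃)) := by rw [div_mul_eq_mul_div, div_eq_iff h2]; ring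
  have k3 : x₃ * n / (1 - L * x₃) * ((1 - L * x₁) * (1 - L * x₂) * (1 - L * x₃)) =
      x₃ * n * ((1 - L * x₁) * (1 - L * x₂)) := by rw [div_mul_eq_mul_div, div_eq_iff h3]; ring
  rw [k1, k2, k3]
  ring

/-- The line through two points `(z₁, w₁)` and `(z₂, w₂)` close to the origin. -/
theorem CoeffMem.exists_chord (hW : W.CoeffMem V) {x₁ x₂ y₁ y₂ p : M}
    (h₁ : W.Equation x₁ y₁) (h₂ : W.Equation x₂ y₂) (hx₁ : x₁ ∉ V) (hx₂ : x₂ ∉ V)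
    (hp : V.valuation p < 1) (hp0 : p ≠ 0) (hz₁ : x₁ / y₁ / p ∈ V) (hz₂ : x₂ / y₂ / p ∈ V)
    (hx : x₁ ≠ x₂) : ∃ L n, n ≠ 0 ∧ L / p ^ 2 ∈ V ∧ n / p ^ 3 ∈ V ∧
      (y₁ - y₂) / (x₁ - x₂) = L / n ∧ y₁ = (L * x₁ - 1) / n := by
  obtain ⟨hx₁0, hy₁0, hv₁, hi₁, hq₁⟩ := hW.valuation_of_notMem h₁ hx₁
  obtain ⟨hx₂0, hy₂0, hv₂, hi₂, hq₂⟩ := hW.valuation_of_notMem h₂ hx₂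
  rw [equation_iff] at h₁ h₂
  obtain ⟨z₁, hz₁e⟩ : ∃ z, z = -x₁ / y₁ := ⟨_, rfl⟩
  obtain ⟨z₂, hz₂e⟩ : ∃ z, z = -x₂ / y₂ := ⟨_, rfl⟩
  obtain ⟨w₁, hw₁e⟩ : ∃ z, z = -1 / y₁ := ⟨_, rfl⟩
  obtain ⟨w₂, hw₂e⟩ : ∃ z, z = -1 / y₂ := ⟨_, rfl⟩
  obtain ⟨t₁, ht₁⟩ : ∃ t, t = x₁ / y₁ / p := ⟨_, rfl⟩
  obtain ⟨t₂, ht₂⟩ : ∃ t, t = x₂ / y₂ / p := ⟨_, rfl⟩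
  obtain ⟨q₁, hq₁e⟩ : ∃ t, t = y₁ ^ 2 / x₁ ^ 3 := ⟨_, rfl⟩
  obtain ⟨q₂, hq₂e⟩ : ∃ t, t = y₂ ^ 2 / x₂ ^ 3 := ⟨_, rfl⟩
  rw [← ht₁] at hz₁
  rw [← ht₂] at hz₂
  rw [← hq₁e] at hq₁
  rw [← hq₂e] at hq₂
  have hz₁' : z₁ = p * -t₁ := by rw [hz₁e, ht₁]; field_simp
  have hz₂' : z₂ = p * -t₂ := by rw [hz₂e, ht₂]; field_simp
  have hw₁' : w₁ = p ^ 3 * -(q₁ * t₁ ^ 3) := by rw [hw₁e, hq₁e, ht₁]; field_simp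
  have hw₂' : w₂ = p ^ 3 * -(q₂ * t₂ ^ 3) := by rw [hw₂e, hq₂e, ht₂]; field_simp
  have hs₁ : -(q₁ * t₁ ^ 3) ∈ V := neg_mem (mul_mem hq₁ (pow_mem hz₁ 3))
  have hs₂ : -(q₂ * t₂ ^ 3) ∈ V := neg_mem (mul_mem hq₂ (pow_mem hz₂ 3))
  obtain ⟨s₁, hs₁e⟩ : ∃ s, s = -(q₁ * t₁ ^ 3) := ⟨_, rfl⟩
  obtain ⟨s₂, hs₂e⟩ : ∃ s, s = -(q₂ * t₂ ^ 3) := ⟨_, rfl⟩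
  rw [← hs₁e] at hw₁' hs₁
  rw [← hs₂e] at hw₂' hs₂
  have hE₁ : w₁ = z₁ ^ 3 + W.a₁ * z₁ * w₁ + W.a₂ * z₁ ^ 2 * w₁ + W.a₃ * w₁ ^ 2 +
      W.a₄ * z₁ * w₁ ^ 2 + W.a₆ * w₁ ^ 3 := by
    rw [hz₁e, hw₁e]; field_simp; linear_combination -h₁
  have hE₂ : w₂ = z₂ ^ 3 + W.a₁ * z₂ * w₂ + W.a₂ * z₂ ^ 2 * w₂ + W.a₃ * w₂ ^ 2 +
      W.a₄ * z₂ * w₂ ^ 2 + W.a₆ * w₂ ^ 3 := by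
    rw [hz₂e, hw₂e]; field_simp; linear_combination -h₂
  have hpV := V.mem_of_valuation_lt_one hp
  obtain ⟨a1, a2, a3, a4, a6⟩ := hW
  -- The difference of the two equations is collected into multiples of z₁ - z₂ and of w₁ - w₂. As B
  -- lies in the maximal ideal, the slope L = A / (1 - B) is as divisible by p as A.
  let A := z₁ ^ 2 + z₁ * z₂ + z₂ ^ 2 + W.a₁ * w₁ + W.a₂ * (z₁ + z₂) * w₁ + W.a₄ * w₁ ^ 2
  let B := W.a₁ * z₂ + W.a₂ * z₂ ^ 2 + W.a₃ * (w₁ + w₂) + W.a₄ * z₂ * (w₁ + w₂) +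
    W.a₆ * (w₁ ^ 2 + w₁ * w₂ + w₂ ^ 2)
  have hAB : (w₁ - w₂) * (1 - B) = (z₁ - z₂) * A := by
    simp only [A, B]; linear_combination hE₁ - hE₂
  have hA : A / p ^ 2 ∈ V := by
    have : A / p ^ 2 = t₁ ^ 2 + t₁ * t₂ + t₂ ^ 2 + W.a₁ * p * s₁ +
        W.a₂ * -(t₁ + t₂) * s₁ * p ^ 2 + W.a₄ * p ^ 4 * s₁ ^ 2 := by
      simp only [A, hz₁', hz₂', hw₁']; field_simp; ring
    rw [this]
    apply_rules [add_mem, mul_mem, pow_mem, neg_mem]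
  have hB : V.valuation B < 1 := by
    have : B = (W.a₁ * -t₂ + W.a₂ * t₂ ^ 2 * p + W.a₃ * p ^ 2 * (s₁ + s₂) +
        W.a₄ * (p * -t₂) * p ^ 2 * (s₁ + s₂) +
        W.a₆ * p ^ 5 * (s₁ ^ 2 + s₁ * s₂ + s₂ ^ 2)) * p := by
      simp only [B, hz₂', hw₁', hw₂']; ring
    rw [this]
    exact V.valuation_mul_lt_one (by apply_rules [add_mem, mul_mem, pow_mem, neg_mem]) hp
  obtain ⟨hu, hui⟩ := V.ne_zero_and_inv_mem_of_sub_one (u := 1 - B) (by simpa using hB)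
  have hx₁w : x₁ = z₁ / w₁ := by rw [hz₁e, hw₁e]; field_simp
  have hx₂w : x₂ = z₂ / w₂ := by rw [hz₂e, hw₂e]; field_simp
  have hw₁0 : w₁ ≠ 0 := by rw [hw₁e]; simp [hy₁0]
  have hw₂0 : w₂ ≠ 0 := by rw [hw₂e]; simp [hy₂0]
  have hy₁w : y₁ = -1 / w₁ := by rw [hw₁e]; field_simp
  have hy₂w : y₂ = -1 / w₂ := by rw [hw₂e]; field_simp
  have hz : z₁ - z₂ ≠ 0 := fun h0 ↦ by
    rw [h0, zero_mul, mul_eq_zero, or_iff_left hu] at hAB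
    apply hx
    rw [hx₁w, hx₂w, sub_eq_zero.mp h0, sub_eq_zero.mp hAB]
  let L := A * (1 - B)⁻¹
  have hL : L * (z₁ - z₂) = w₁ - w₂ := by
    simp only [L]; field_simp; linear_combination -hAB
  let n := w₁ - L * z₁
  have hn1 : n * (z₁ - z₂) = z₁ * w₂ - z₂ * w₁ := by
    simp only [n]; linear_combination -z₁ * hL
  -- With n = 0 the line would pass through (0, 0), so that z₁/w₁ = z₂/w₂, which is x₁ = x₂.
  have hn : n ≠ 0 := fun h0 ↦ by
    rw [h0, zero_mul] at hn1
    apply hx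
    rw [hx₁w, hx₂w, div_eq_div_iff hw₁0 hw₂0]
    linear_combination -hn1
  have hLV : L / p ^ 2 ∈ V := by
    rw [show L / p ^ 2 = A / p ^ 2 * (1 - B)⁻¹ by simp only [L]; ring]
    exact mul_mem hA hui
  refine ⟨L, n, hn, hLV, ?_, ?_, ?_⟩
  · rw [show n / p ^ 3 = s₁ + L / p ^ 2 * t₁ by
      simp only [n, hw₁', hz₁']; field_simp; ring]
    apply_rules [add_mem, mul_mem, pow_mem, neg_mem]
  · rw [div_eq_div_iff (sub_ne_zero.mpr hx) hn, hy₁w, hy₂w, hx₁w, hx₂w]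
    field_simp
    simp only [n]
    linear_combination -w₁ * hL
  · rw [eq_div_iff hn, hy₁w, hx₁w]
    simp only [n]
    field_simp
    ring

/-- The tangent at a point close to the origin, in the coordinates `z = -x/y`, `w = -1/y`. -/
theorem CoeffMem.exists_tangent (hW : W.CoeffMem V) {x y p : M}
    (h : W.Equation x y) (hx : x ∉ V) (hp0 : p ≠ 0) (hz : x / y / p ∈ V)
    (hy : y ≠ W.negY x y) : ∃ L n, n ≠ 0 ∧ L / p ^ 2 ∈ V ∧ n / p ^ 3 ∈ V ∧
      (3 * x ^ 2 + 2 * W.a₂ * x + W.a₄ - W.a₁ * y) / (y - W.negY x y) = L / n ∧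
      y = (L * x - 1) / n := by
  obtain ⟨hx0, hy0, hv, hi, hq⟩ := hW.valuation_of_notMem h hx
  have hxi := V.inv_mem_of_notMem hx
  have hxiV := V.mem_of_valuation_lt_one hxi
  have hvV := V.mem_of_valuation_lt_one hv
  have hiV := V.mem_of_valuation_lt_one hi
  rw [equation_iff] at h
  obtain ⟨a1, a2, a3, a4, a6⟩ := hW
  obtain ⟨q, hqe⟩ : ∃ t, t = y ^ 2 / x ^ 3 := ⟨_, rfl⟩
  obtain ⟨t, ht⟩ : ∃ t, t = x / y / p := ⟨_, rfl⟩
  rw [← hqe] at hq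
  rw [← ht] at hz
  have h2 : (2 : M) ∈ V := ofNat_mem V 2
  have h3 : (3 : M) ∈ V := ofNat_mem V 3
  -- With d = 2y + a₁x + a₃ and D = x³ - a₄x - 2a₆ + a₃y, the tangent has intercept -D/d; here u =
  -- D/x³ is a principal unit. An affine line with intercept -1/n and slope L/n then has n = d/D,
  -- and L is the numerator of the slope divided by D.
  let u := 1 - W.a₄ * x⁻¹ * x⁻¹ - 2 * W.a₆ * x⁻¹ ^ 2 * x⁻¹ + W.a₃ * q * y⁻¹
  have hu : V.valuation (u - 1) < 1 := by
    rw [show u - 1 = -(W.a₄ * x⁻¹) * x⁻¹ + -(2 * W.a₆ * x⁻¹ ^ 2) * x⁻¹ + W.a₃ * q * y⁻¹ by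
      simp only [u]; ring]
    refine V.valuation.map_add_lt (V.valuation.map_add_lt ?_ ?_) ?_
    · exact V.valuation_mul_lt_one (neg_mem (mul_mem a4 hxiV)) hxi
    · exact V.valuation_mul_lt_one (by apply_rules [mul_mem, pow_mem, neg_mem]) hxi
    · exact V.valuation_mul_lt_one (mul_mem a3 hq) hi
  obtain ⟨hu0, hui⟩ := V.ne_zero_and_inv_mem_of_sub_one hu
  have hD : x ^ 3 - W.a₄ * x - 2 * W.a₆ + W.a₃ * y = x ^ 3 * u := by
    simp only [u, hqe]; field_simp
  rw [negY] at hy ⊢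
  have hd : y - (-y - W.a₁ * x - W.a₃) ≠ 0 := sub_ne_zero.mpr hy
  have hd' : 2 * y + W.a₁ * x + W.a₃ ≠ 0 := by convert hd using 1; ring
  refine ⟨(3 * x ^ 2 + 2 * W.a₂ * x + W.a₄ - W.a₁ * y) / (x ^ 3 * u),
    (2 * y + W.a₁ * x + W.a₃) / (x ^ 3 * u), div_ne_zero hd' (by simp [hx0, hu0]), ?_, ?_, ?_, ?_⟩
  · rw [show (3 * x ^ 2 + 2 * W.a₂ * x + W.a₄ - W.a₁ * y) / (x ^ 3 * u) / p ^ 2 =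
      (3 + 2 * W.a₂ * x⁻¹ + W.a₄ * x⁻¹ ^ 2 + -(W.a₁ * q * (x / y))) * u⁻¹ * q * t ^ 2 by
      rw [hqe, ht]; field_simp; ring]
    apply_rules [add_mem, mul_mem, pow_mem, neg_mem]
  · rw [show (2 * y + W.a₁ * x + W.a₃) / (x ^ 3 * u) / p ^ 3 =
      (2 + W.a₁ * (x / y) + W.a₃ * y⁻¹) * u⁻¹ * q ^ 2 * t ^ 3 by
      rw [hqe, ht]; field_simp]
    apply_rules [add_mem, mul_mem, pow_mem, neg_mem]
  · rw [div_div_div_cancel_right₀ (by simp [hx0, hu0])]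
    congr 1; ring
  · rw [eq_div_iff (div_ne_zero hd' (by simp [hx0, hu0])), ← hD]
    have : x ^ 3 - W.a₄ * x - 2 * W.a₆ + W.a₃ * y ≠ 0 := by rw [hD]; simp [hx0, hu0]
    rw [mul_div_assoc', div_mul_eq_mul_div, div_sub_one this]
    congr 1
    linear_combination 2 * h

end WeierstrassCurve.Affine

/-! ### The parameter x/y and addition in the kernel of reduction -/

namespace WeierstrassCurve.Affine

variable {M : Type*} [Field M] {W : WeierstrassCurve.Affine M} {V : ValuationSubring M}

theorem CoeffMem.mem_of_equation (hW : W.CoeffMem V) {x y : M} (h : W.Equation x y)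
    (hx : x ∈ V) : y ∈ V := by
  by_contra hy
  have hyi := V.mem_of_valuation_lt_one (V.inv_mem_of_notMem hy)
  have hy0 : y ≠ 0 := by rintro rfl; exact hy (zero_mem V)
  rw [equation_iff] at h
  obtain ⟨a1, a2, a3, a4, a6⟩ := hW
  apply hy
  rw [show y = (x ^ 3 + W.a₂ * x ^ 2 + W.a₄ * x + W.a₆) * y⁻¹ + -(W.a₁ * x + W.a₃) by
    rw [← h]; field_simp; ring]
  apply_rules [add_mem, mul_mem, pow_mem, neg_mem]

/-- Modulo the maximal ideal, a curve with unit discriminant is smooth. -/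
theorem CoeffMem.partial_inv_mem (hW : W.CoeffMem V) (hΔ : W.Δ ≠ 0) (hΔV : W.Δ⁻¹ ∈ V) {x y : M}
    (h : W.Equation x y) (hx : x ∈ V) (hxy : V.valuation (2 * y + W.a₁ * x + W.a₃) < 1) :
    3 * x ^ 2 + 2 * W.a₂ * x + W.a₄ - W.a₁ * y ≠ 0 ∧
      (3 * x ^ 2 + 2 * W.a₂ * x + W.a₄ - W.a₁ * y)⁻¹ ∈ V := by
  have hy := hW.mem_of_equation h hx
  let W₀ : WeierstrassCurve.Affine V :=
    ⟨⟨_, hW.a₁⟩, ⟨_, hW.a₂⟩, ⟨_, hW.a₃⟩, ⟨_, hW.a₄⟩, ⟨_, hW.a₆⟩⟩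
  have hmap : W₀.map V.subtype = W := rfl
  have h0 : W₀.Equation ⟨x, hx⟩ ⟨y, hy⟩ := by
    rw [← map_equation (W := W₀) (f := V.subtype) Subtype.val_injective]
    exact h
  have hD : V.subtype W₀.Δ = W.Δ := (WeierstrassCurve.map_Δ W₀ V.subtype).symm
  have hu : IsUnit W₀.Δ := by
    refine IsUnit.of_mul_eq_one ⟨_, hΔV⟩ (Subtype.ext ?_)
    change V.subtype W₀.Δ * W.Δ⁻¹ = 1
    rw [hD, mul_inv_cancel₀ hΔ]
  -- The reduced curve is smooth since its discriminant is nonzero; the derivative in y vanishes at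
  -- the reduced point, so the derivative in x does not.
  let r := IsLocalRing.residue V
  have hns := (equation_iff_nonsingular_of_Δ_ne_zero (W := W₀.map r) (x := r ⟨x, hx⟩)
    (y := r ⟨y, hy⟩) (by rw [WeierstrassCurve.map_Δ]; exact (hu.map r).ne_zero)).mp (h0.map r)
  rw [nonsingular_iff] at hns
  have hr : r (2 * ⟨y, hy⟩ + W₀.a₁ * ⟨x, hx⟩ + W₀.a₃) = 0 := by
    rw [IsLocalRing.residue_eq_zero_iff]
    exact (V.valuation_lt_one_iff _).mpr hxy
  have hr' : r (3 * ⟨x, hx⟩ ^ 2 + 2 * W₀.a₂ * ⟨x, hx⟩ + W₀.a₄ - W₀.a₁ * ⟨y, hy⟩) ≠ 0 := by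
    intro h'
    rcases hns.2 with h1 | h1
    · apply h1
      simp only [map_a₁, map_a₂, map_a₄]
      simp only [map_sub, map_add, map_mul, map_pow, map_ofNat] at h'
      linear_combination -h'
    · apply h1
      simp only [map_a₁, map_a₃]
      simp only [map_add, map_mul, map_ofNat] at hr
      linear_combination hr
  rw [Ne, IsLocalRing.residue_eq_zero_iff, IsLocalRing.mem_maximalIdeal, mem_nonunits_iff,
    not_not] at hr'
  have := (V.valuation_eq_one_iff _).mp hr'
  change V.valuation (3 * x ^ 2 + 2 * W.a₂ * x + W.a₄ - W.a₁ * y) = 1 at this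
  refine ⟨fun h0 ↦ by simp [h0] at this, ?_⟩
  rw [← V.valuation_le_one_iff, map_inv₀, this, inv_one]

namespace Point

/-- The parameter `x / y` near the origin. -/
def param : W.Point → M
  | zero => 0
  | some x y _ => x / y

variable (V) in
/-- The points that reduce to the origin: the origin and those with non-integral `x`. -/
def IsFormal : W.Point → Prop
  | zero => True
  | some x _ _ => x ∉ V

theorem param_zero : (0 : W.Point).param = 0 := rfl

variable (hW : W.CoeffMem V)
include hW

theorem IsFormal.eq_zero_of_param {P : W.Point} (hP : P.IsFormal V) (h : P.param = 0) : P = 0 := by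
  match P, hP, h with
  | .zero, _, _ => rfl
  | .some x y h', hx, h =>
    have := hW.valuation_of_notMem h'.1 hx
    exact absurd h (div_ne_zero this.1 this.2.1)

theorem IsFormal.valuation_param_lt_one {P : W.Point} (hP : P.IsFormal V) :
    V.valuation P.param < 1 := by
  match P, hP with
  | .zero, _ => simp [param]
  | .some x y h', hx => exact (hW.valuation_of_notMem h'.1 hx).2.2.1

/-- The ordinate of -P is -y times the principal unit 1 + a₁(x/y) + a₃/y, so the two parameters
cancel to second order. The scale p is a separate variable so that one congruence modulo p² can
serve for several points whose parameters p divides. -/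
theorem IsFormal.neg {P : W.Point} (hP : P.IsFormal V) {p : M} (hp : V.valuation p < 1)
    (hz : P.param / p ∈ V) : (-P).IsFormal V ∧ ((-P).param + P.param) / p ^ 2 ∈ V := by
  match P, hP, hz with
  | .zero, _, _ =>
    exact ⟨trivial, by rw [show -(zero : W.Point) = zero from rfl]; simp [param]⟩
  | .some x y h, hx, hz =>
    refine ⟨hx, ?_⟩
    change ((x / W.negY x y) + x / y) / p ^ 2 ∈ V
    change x / y / p ∈ V at hz
    by_cases hp0 : p = 0
    · simp [hp0]
    obtain ⟨hx0, hy0, hv, hi, hq⟩ := hW.valuation_of_notMem h.1 hx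
    have hpV := V.mem_of_valuation_lt_one hp
    obtain ⟨t, ht⟩ : ∃ t, t = x / y / p := ⟨_, rfl⟩
    obtain ⟨q, hqe⟩ : ∃ t, t = y ^ 2 / x ^ 3 := ⟨_, rfl⟩
    rw [← ht] at hz
    rw [← hqe] at hq
    obtain ⟨hu, hui⟩ := V.ne_zero_and_inv_mem_of_sub_one
      (u := 1 + W.a₁ * (x / y) + W.a₃ * y⁻¹) <| by
        rw [show 1 + W.a₁ * (x / y) + W.a₃ * y⁻¹ - 1 = W.a₁ * (x / y) + W.a₃ * y⁻¹ by ring]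
        exact V.valuation.map_add_lt (V.valuation_mul_lt_one hW.a₁ hv)
          (V.valuation_mul_lt_one hW.a₃ hi)
    have hn : W.negY x y = -(y * (1 + W.a₁ * (x / y) + W.a₃ * y⁻¹)) := by
      rw [negY]; field_simp; ring
    have : (x / W.negY x y + x / y) / p ^ 2 =
        (W.a₁ * t ^ 2 + W.a₃ * q * t ^ 4 * p ^ 2) * (1 + W.a₁ * (x / y) + W.a₃ * y⁻¹)⁻¹ := by
      rw [hn, ht, hqe]
      generalize hud : 1 + W.a₁ * (x / y) + W.a₃ * y⁻¹ = u at hu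
      have : W.a₁ * x + W.a₃ = y * (u - 1) := by rw [← hud]; field_simp; ring
      field_simp
      linear_combination -this
    rw [this]
    obtain ⟨a1, -, a3, -, -⟩ := hW
    apply_rules [add_mem, mul_mem, pow_mem]

variable [DecidableEq M]

/-- The line w = Lz + n through the two points has L divisible by p² and n by p³. By `collinear_sum`
the z-coordinates of its three intersections with the curve then sum to a multiple of p²; passing
from the third intersection to its negative is covered by `IsFormal.neg`. -/
theorem IsFormal.add {P Q : W.Point} (hP : P.IsFormal V) (hQ : Q.IsFormal V) {p : M}
    (hp : V.valuation p < 1) (hp0 : p ≠ 0) (hzP : P.param / p ∈ V) (hzQ : Q.param / p ∈ V) :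
    (P + Q).IsFormal V ∧ ((P + Q).param - P.param - Q.param) / p ^ 2 ∈ V := by
  match P, Q, hP, hQ, hzP, hzQ with
  | .zero, Q, _, hQ, _, _ =>
    rw [show (zero : W.Point) + Q = Q from zero_add Q]
    exact ⟨hQ, by simp [param]⟩
  | P, .zero, hP, _, _, _ =>
    rw [show P + (zero : W.Point) = P from add_zero P]
    exact ⟨hP, by simp [param]⟩
  | .some x₁ y₁ h₁, .some x₂ y₂ h₂, hx₁, hx₂, hz₁, hz₂ =>
  by_cases hxy : x₁ = x₂ ∧ y₁ = W.negY x₂ y₂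
  · rw [add_of_Y_eq hxy.1 hxy.2]
    refine ⟨trivial, ?_⟩
    have := (IsFormal.neg hW (P := .some x₂ y₂ h₂) hx₂ hp hz₂).2
    have hs : (some x₁ y₁ h₁ : W.Point) = -some x₂ y₂ h₂ := by
      rw [neg_some]; obtain ⟨rfl, rfl⟩ := hxy; rfl
    rw [hs, param_zero, zero_sub, ← neg_add', neg_div]
    exact neg_mem this
  obtain ⟨L, n, hn, hL, hnV, hsl, hy₁⟩ : ∃ L n, n ≠ 0 ∧ L / p ^ 2 ∈ V ∧ n / p ^ 3 ∈ V ∧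
      W.slope x₁ x₂ y₁ y₂ = L / n ∧ y₁ = (L * x₁ - 1) / n := by
    by_cases hx : x₁ = x₂
    · subst hx
      have hy : y₁ ≠ W.negY x₁ y₂ := fun h ↦ hxy ⟨rfl, h⟩
      have hyy := Y_eq_of_Y_ne h₁.1 h₂.1 rfl hy
      subst hyy
      rw [slope_of_Y_ne rfl hy]
      exact hW.exists_tangent h₁.1 hx₁ hp0 hz₁ hy
    · rw [slope_of_X_ne hx]
      exact hW.exists_chord h₁.1 h₂.1 hx₁ hx₂ hp hp0 hz₁ hz₂ hx
  -- In affine coordinates w = Lz + n reads y = (L/n)x - 1/n.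
  have hm : -1 / n = y₁ - L / n * x₁ := by rw [hy₁]; field_simp; ring
  have hy₂ : y₂ = (L * x₂ - 1) / n := by
    by_cases hx : x₁ = x₂
    · subst hx
      rw [← hy₁]
      exact (Y_eq_of_Y_ne h₁.1 h₂.1 rfl fun h ↦ hxy ⟨rfl, h⟩).symm
    · rw [slope_of_X_ne hx, div_eq_div_iff (sub_ne_zero.mpr hx) hn, hy₁, div_sub' hn,
        div_mul_cancel₀ _ hn] at hsl
      rw [eq_div_iff hn]; linear_combination -hsl
  obtain ⟨e1, e2, e3⟩ := collinear_symmetric h₁.1 h₂.1 hxy hsl hm rfl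
  rw [add_some hxy]
  have hns := nonsingular_add h₁ h₂ hxy
  have hns' := nonsingular_negAdd h₁ h₂ hxy
  rw [hsl] at hns hns'
  let s := W.slope x₁ x₂ y₁ y₂
  change W.addX x₁ x₂ s ∉ V ∧ (W.addX x₁ x₂ s / W.negY (W.addX x₁ x₂ s)
    (W.negAddY x₁ x₂ y₁ s) - x₁ / y₁ - x₂ / y₂) / p ^ 2 ∈ V
  rw [show s = L / n from hsl]
  change x₁ / y₁ / p ∈ V at hz₁
  change x₂ / y₂ / p ∈ V at hz₂
  have hy₃ : W.negAddY x₁ x₂ y₁ (L / n) = (L * W.addX x₁ x₂ (L / n) - 1) / n := by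
    rw [negAddY, hy₁]; field_simp; ring
  generalize W.addX x₁ x₂ (L / n) = x₃ at *
  generalize W.negAddY x₁ x₂ y₁ (L / n) = y₃ at *
  have hpV := V.mem_of_valuation_lt_one hp
  obtain ⟨a1, a2, a3, a4, a6⟩ := id hW
  obtain ⟨l, hl⟩ : ∃ l, l = L / p ^ 2 := ⟨_, rfl⟩
  obtain ⟨k, hk⟩ : ∃ l, l = n / p ^ 3 := ⟨_, rfl⟩
  rw [← hl] at hL
  rw [← hk] at hnV
  have hl' : L = p ^ 2 * l := by rw [hl]; field_simp
  have hk' : n = p ^ 3 * k := by rw [hk]; field_simp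
  obtain ⟨hu, hui⟩ := V.ne_zero_and_inv_mem_of_sub_one
    (u := 1 + W.a₂ * L + W.a₄ * L ^ 2 + W.a₆ * L ^ 3) <| by
      rw [show 1 + W.a₂ * L + W.a₄ * L ^ 2 + W.a₆ * L ^ 3 - 1 =
        (W.a₂ + W.a₄ * L + W.a₆ * L ^ 2) * (p * l) * p by rw [hl']; ring]
      refine V.valuation_mul_lt_one ?_ hp
      have hLV : L ∈ V := by rw [hl']; exact mul_mem (pow_mem hpV 2) hL
      apply_rules [add_mem, mul_mem, pow_mem]
  obtain ⟨hd₁, hd₂, hd₃, hsum⟩ := collinear_sum hn e1 e2 e3 hu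
  have hz (x : M) : x / ((L * x - 1) / n) = -(x * n / (1 - L * x)) := by
    rw [div_div_eq_mul_div, ← neg_sub 1 (L * x), div_neg]
  have hsum' : (x₁ / y₁ + x₂ / y₂ + x₃ / y₃) / p ^ 2 =
      (W.a₁ * l + W.a₂ * p * k + W.a₃ * p ^ 2 * l ^ 2 + 2 * W.a₄ * p ^ 3 * l * k +
        3 * W.a₆ * p ^ 5 * l ^ 2 * k) *
        (1 + W.a₂ * L + W.a₄ * L ^ 2 + W.a₆ * L ^ 3)⁻¹ := by
    rw [hy₁, hy₂, hy₃, hz, hz, hz, ← neg_add, ← neg_add, hsum]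
    generalize (1 + W.a₂ * L + W.a₄ * L ^ 2 + W.a₆ * L ^ 3)⁻¹ = u
    rw [hl', hk']; field_simp
  have h2 : (2 : M) ∈ V := ofNat_mem V 2
  have h3 : (3 : M) ∈ V := ofNat_mem V 3
  have hsumV : (x₁ / y₁ + x₂ / y₂ + x₃ / y₃) / p ^ 2 ∈ V := by
    rw [hsum']
    have : W.a₁ * l + W.a₂ * p * k + W.a₃ * p ^ 2 * l ^ 2 + 2 * W.a₄ * p ^ 3 * l * k ∈ V := by
      apply_rules [add_mem, mul_mem, pow_mem]
    have : 3 * W.a₆ * p ^ 5 * l ^ 2 * k ∈ V := by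
      apply_rules [add_mem, mul_mem, pow_mem]
    apply_rules [add_mem, mul_mem]
  -- The third parameter is divisible by p because the other two and the sum are.
  have hz₃ : x₃ / y₃ / p ∈ V := by
    rw [show x₃ / y₃ / p = (x₁ / y₁ + x₂ / y₂ + x₃ / y₃) / p ^ 2 * p - x₁ / y₁ / p -
      x₂ / y₂ / p by field_simp; ring]
    exact sub_mem (sub_mem (mul_mem hsumV hpV) hz₁) hz₂
  -- Dividing n y₃ = L x₃ - 1 by y₃ expresses 1/y₃ as L(x₃/y₃) - n.
  have hw₃ : V.valuation y₃⁻¹ < 1 := by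
    have : y₃⁻¹ = (-(k * p ^ 2) + p ^ 2 * l * (x₃ / y₃ / p)) * p := by
      have hy₃0 : y₃ ≠ 0 := by
        rw [hy₃, ← neg_sub]; exact div_ne_zero (neg_ne_zero.mpr hd₃) hn
      have : y₃ * n = L * x₃ - 1 := by rw [hy₃]; field_simp
      rw [hl', hk'] at this
      field_simp
      linear_combination this
    rw [this]
    exact V.valuation_mul_lt_one (by apply_rules [add_mem, mul_mem, pow_mem, neg_mem]) hp
  have hy₃V : y₃ ∉ V := fun h ↦ by
    rw [map_inv₀] at hw₃
    have := (V.valuation_le_one_iff _).mpr h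
    have h0 : y₃ ≠ 0 := by
      rw [hy₃, ← neg_sub]; exact div_ne_zero (neg_ne_zero.mpr hd₃) hn
    exact absurd hw₃ (not_lt.mpr ((one_le_inv₀ (by simpa [zero_lt_iff] using h0)).mpr this))
  have hx₃V : x₃ ∉ V := fun h ↦ hy₃V (hW.mem_of_equation hns'.1 h)
  refine ⟨hx₃V, ?_⟩
  have := (IsFormal.neg hW (P := .some x₃ y₃ hns') hx₃V hp hz₃).2
  change (x₃ / W.negY x₃ y₃ + x₃ / y₃) / p ^ 2 ∈ V at this
  rw [show (x₃ / W.negY x₃ y₃ - x₁ / y₁ - x₂ / y₂) / p ^ 2 =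
    (x₃ / W.negY x₃ y₃ + x₃ / y₃) / p ^ 2 - (x₁ / y₁ + x₂ / y₂ + x₃ / y₃) / p ^ 2 by ring]
  exact sub_mem this hsumV

end Point

end WeierstrassCurve.Affine

/-! ### The kernel of reduction: subgroup, torsion, congruent points -/

namespace WeierstrassCurve.Affine.Point

variable {M : Type*} [Field M] [DecidableEq M] {W : WeierstrassCurve.Affine M}
  {V : ValuationSubring M}

/-- Of two nonzero parameters one divides the other in V; that one serves as p in `IsFormal.add`. -/
theorem IsFormal.add_isFormal (hW : W.CoeffMem V) {P Q : W.Point} (hP : P.IsFormal V)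
    (hQ : Q.IsFormal V) : (P + Q).IsFormal V := by
  by_cases hP0 : P.param = 0
  · rwa [hP.eq_zero_of_param hW hP0, zero_add]
  by_cases hQ0 : Q.param = 0
  · rwa [hQ.eq_zero_of_param hW hQ0, add_zero]
  have h := V.mem_or_inv_mem (P.param / Q.param)
  rw [inv_div] at h
  rcases h with h | h
  · exact (hP.add hW hQ (hQ.valuation_param_lt_one hW) hQ0 h (by simp [hQ0, one_mem])).1
  · exact (hP.add hW hQ (hP.valuation_param_lt_one hW) hP0 (by simp [hP0, one_mem]) h).1

variable (W V) in
/-- The subgroup of the points that reduce to the origin. -/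
def formalSubgroup (hW : W.CoeffMem V) : AddSubgroup W.Point where
  carrier := {P | P.IsFormal V}
  zero_mem' := trivial
  add_mem' := IsFormal.add_isFormal hW
  neg_mem' {P} hP := by
    match P, hP with
    | .zero, _ => trivial
    | .some x y h, hx => exact hx

/-- The kernel of reduction has no torsion of order invertible in `V`. -/
theorem IsFormal.eq_zero_of_nsmul (hW : W.CoeffMem V) {P : W.Point} (hP : P.IsFormal V) {N : ℕ}
    (hN0 : (N : M) ≠ 0) (hN : (N : M)⁻¹ ∈ V) (h : N • P = 0) : P = 0 := by
  by_contra hne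
  have hp0 : P.param ≠ 0 := fun h0 ↦ hne (hP.eq_zero_of_param hW h0)
  have hp := hP.valuation_param_lt_one hW
  -- With z the parameter of P, multiplication by k is z ↦ kz modulo z². If N • P = 0 with N a unit,
  -- then z ∈ z²V, impossible for a nonzero z in the maximal ideal.
  have key (k : ℕ) : (k • P).IsFormal V ∧ ((k • P).param - k * P.param) / P.param ^ 2 ∈ V := by
    induction k with
    | zero => rw [zero_smul]; exact ⟨trivial, by simp [param_zero]⟩
    | succ k ih =>
      have hk : (k • P).param / P.param ∈ V := by
        rw [show (k • P).param / P.param =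
          ((k • P).param - k * P.param) / P.param ^ 2 * P.param + k by field_simp; ring]
        exact add_mem (mul_mem ih.2 (V.mem_of_valuation_lt_one hp)) (natCast_mem V k)
      have := ih.1.add hW hP hp hp0 hk (by simp [hp0, one_mem])
      rw [succ_nsmul]
      refine ⟨this.1, ?_⟩
      convert add_mem this.2 ih.2 using 1
      push_cast
      ring
  have h1 := (key N).2
  rw [h, param_zero, zero_sub, ← neg_mul, mul_div_assoc, neg_mul, neg_mem_iff] at h1
  have h2 := mul_mem hN h1
  rw [← mul_assoc, inv_mul_cancel₀ hN0, one_mul, show P.param / P.param ^ 2 = P.param⁻¹ by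
    field_simp, ← V.valuation_le_one_iff, map_inv₀] at h2
  have : 0 < V.valuation P.param := by simpa [zero_lt_iff] using hp0
  exact absurd h2 (not_le.mpr ((one_lt_inv₀ this).mpr hp))

/-- The slope is a root of a monic quadratic whose coefficients are integral as soon as the abscissa
of the sum is. -/
theorem isFormal_add_of_slope (hW : W.CoeffMem V) {x₁ y₁ x₂ y₂ : M} (h₁ : W.Nonsingular x₁ y₁)
    (h₂ : W.Nonsingular x₂ y₂) (hx₁ : x₁ ∈ V) (hx₂ : x₂ ∈ V)
    (hxy : ¬(x₁ = x₂ ∧ y₁ = W.negY x₂ y₂)) (hs : W.slope x₁ x₂ y₁ y₂ ∉ V) :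
    (some x₁ y₁ h₁ + some x₂ y₂ h₂).IsFormal V := by
  rw [add_some hxy]
  change W.addX x₁ x₂ _ ∉ V
  intro h
  apply hs
  generalize W.slope x₁ x₂ y₁ y₂ = s at *
  have hs0 : s ≠ 0 := by rintro rfl; exact hs (zero_mem V)
  have hsi := V.mem_of_valuation_lt_one (V.inv_mem_of_notMem hs)
  rw [show s = (W.addX x₁ x₂ s + W.a₂ + x₁ + x₂) * s⁻¹ + -W.a₁ by rw [addX]; field_simp; ring]
  obtain ⟨a1, a2, a3, a4, a6⟩ := hW
  apply_rules [add_mem, mul_mem, neg_mem]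

/-- The two points have opposite reductions. If the slope of the line joining them were integral,
both partial derivatives of the equation at the first point would lie in the maximal ideal, against
smoothness of the reduction. -/
theorem isFormal_add_of_congr (hW : W.CoeffMem V) (hΔ : W.Δ ≠ 0) (hΔV : W.Δ⁻¹ ∈ V)
    {x₁ y₁ x₂ y₂ : M} (h₁ : W.Nonsingular x₁ y₁)
    (h₂ : W.Nonsingular x₂ y₂) (hx₁ : x₁ ∈ V) (hx₂ : x₂ ∈ V) (hx : V.valuation (x₁ - x₂) < 1)
    (hy : V.valuation (y₁ - W.negY x₂ y₂) < 1) :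
    (some x₁ y₁ h₁ + some x₂ y₂ h₂).IsFormal V := by
  by_cases hxy : x₁ = x₂ ∧ y₁ = W.negY x₂ y₂
  · rw [add_of_Y_eq hxy.1 hxy.2]
    trivial
  refine isFormal_add_of_slope hW h₁ h₂ hx₁ hx₂ hxy fun hs ↦ ?_
  by_cases hxe : x₁ = x₂
  · subst hxe
    have hye : y₁ ≠ W.negY x₁ y₂ := fun h ↦ hxy ⟨rfl, h⟩
    have hyy := Y_eq_of_Y_ne h₁.1 h₂.1 rfl hye
    subst hyy
    rw [slope_of_Y_ne rfl hye] at hs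
    have hd : y₁ - W.negY x₁ y₁ ≠ 0 := sub_ne_zero.mpr hye
    obtain ⟨hT0, hT⟩ := hW.partial_inv_mem hΔ hΔV h₁.1 hx₁ (by convert hy using 2; rw [negY]; ring)
    apply V.not_valuation_lt_one_of_inv_mem hT0 hT
    have := V.valuation_mul_lt_one hs hy
    rwa [div_mul_cancel₀ _ hd] at this
  · rw [slope_of_X_ne hxe] at hs
    obtain ⟨s, hse⟩ : ∃ s, s = (y₁ - y₂) / (x₁ - x₂) := ⟨_, rfl⟩
    rw [← hse] at hs
    have hd : x₁ - x₂ ≠ 0 := sub_ne_zero.mpr hxe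
    have hN : y₁ - y₂ = s * (x₁ - x₂) := by rw [hse]; field_simp
    obtain ⟨a1, a2, a3, a4, a6⟩ := id hW
    obtain ⟨hT0, hT⟩ := hW.partial_inv_mem hΔ hΔV h₁.1 hx₁ <| by
      rw [show 2 * y₁ + W.a₁ * x₁ + W.a₃ = s * (x₁ - x₂) + W.a₁ * (x₁ - x₂) +
        (y₁ - W.negY x₂ y₂) by rw [← hN, negY]; ring]
      exact V.valuation.map_add_lt (V.valuation.map_add_lt (V.valuation_mul_lt_one hs hx)
        (V.valuation_mul_lt_one a1 hx)) hy
    apply V.not_valuation_lt_one_of_inv_mem hT0 hT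
    have e₁ := (equation_iff ..).mp h₁.1
    have e₂ := (equation_iff ..).mp h₂.1
    -- The difference of the two Weierstrass equations, divided by x₁ - x₂. The right side is
    -- congruent to the derivative in x at the first point.
    have hU : s * (y₁ - W.negY x₂ y₂) =
        x₁ ^ 2 + x₁ * x₂ + x₂ ^ 2 + W.a₂ * (x₁ + x₂) + W.a₄ - W.a₁ * y₁ := by
      apply mul_left_cancel₀ hd
      rw [negY]
      linear_combination e₁ - e₂ - (y₁ + y₂ + W.a₁ * x₂ + W.a₃) * hN
    rw [show 3 * x₁ ^ 2 + 2 * W.a₂ * x₁ + W.a₄ - W.a₁ * y₁ = s * (y₁ - W.negY x₂ y₂) +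
      (2 * x₁ + x₂ + W.a₂) * (x₁ - x₂) by rw [hU]; ring]
    exact V.valuation.map_add_lt (V.valuation_mul_lt_one hs hy)
      (V.valuation_mul_lt_one (add_mem (add_mem (mul_mem (ofNat_mem V 2) hx₁) hx₂) a2)
        hx)

/-- Points with the same reduction differ by a point that reduces to the origin. -/
theorem isFormal_sub_of_congr (hW : W.CoeffMem V) (hΔ : W.Δ ≠ 0) (hΔV : W.Δ⁻¹ ∈ V)
    {x₁ y₁ x₂ y₂ : M} (h₁ : W.Nonsingular x₁ y₁)
    (h₂ : W.Nonsingular x₂ y₂) (hx₁ : x₁ ∈ V) (hx₂ : x₂ ∈ V) (hx : V.valuation (x₁ - x₂) < 1)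
    (hy : V.valuation (y₁ - y₂) < 1) : (some x₁ y₁ h₁ - some x₂ y₂ h₂).IsFormal V := by
  rw [sub_eq_add_neg, neg_some]
  exact isFormal_add_of_congr hW hΔ hΔV _ _ hx₁ hx₂ hx (by rwa [negY_negY])

end WeierstrassCurve.Affine.Point

/-! ### Places of a field over an algebraically closed constant field -/

namespace ValuationSubring

open Polynomial

variable {k M : Type*} [Field k] [Field M] [Algebra k M] (V : ValuationSubring M)

/-- A valuation ring containing the field `k`. -/
def ContainsField (k : Type*) {M : Type*} [Field k] [Field M] [Algebra k M]
    (V : ValuationSubring M) : Prop :=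
  ∀ c : k, algebraMap k M c ∈ V

variable {V}

namespace ContainsField

variable (hV : V.ContainsField k)
include hV

theorem aeval_mem {u : M} (hu : u ∈ V) (c : k[X]) : aeval u c ∈ V := by
  induction c using Polynomial.induction_on' with
  | add p q hp hq => rw [map_add]; exact V.add_mem _ _ hp hq
  | monomial n a => rw [aeval_monomial]; exact V.mul_mem _ _ (hV a) (pow_mem hu n)

theorem valuation_algebraMap {c : k} (hc : c ≠ 0) : V.valuation (algebraMap k M c) = 1 := by
  refine le_antisymm ((V.valuation_le_one_iff _).mpr (hV c)) ?_
  have h := (V.valuation_le_one_iff _).mpr (hV c⁻¹)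
  rw [map_inv₀, map_inv₀] at h
  refine (inv_le_one₀ ?_).mp h
  simpa [zero_lt_iff] using hc

theorem eq_of_valuation_sub_lt_one {x : M} {a b : k} (ha : V.valuation (x - algebraMap k M a) < 1)
    (hb : V.valuation (x - algebraMap k M b) < 1) : a = b := by
  by_contra hne
  have := hV.valuation_algebraMap (sub_ne_zero.mpr hne)
  rw [map_sub, show algebraMap k M a - algebraMap k M b =
    (x - algebraMap k M b) - (x - algebraMap k M a) by ring] at this
  exact (V.valuation.map_sub_lt hb ha).ne this

theorem valuation_aeval_sub_lt_one {u : M} {a : k} (hu : V.valuation (u - algebraMap k M a) < 1)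
    (c : k[X]) : V.valuation (aeval u c - algebraMap k M (c.eval a)) < 1 := by
  obtain ⟨d, hd⟩ := X_sub_C_dvd_sub_C_eval (a := a) (p := c)
  have hu' : u ∈ V := by
    have := V.add_mem _ _ (V.mem_of_valuation_lt_one hu) (hV a)
    rwa [sub_add_cancel] at this
  have := congrArg (aeval u) hd
  simp only [map_sub, aeval_C, map_mul, aeval_X] at this
  rw [this, mul_comm]
  exact V.valuation_mul_lt_one (hV.aeval_mem hu' d) hu

/-- As g splits, g(x) is a nonzero constant times a product of factors x - b, and a product of units
is a unit. -/
theorem exists_root_of_aeval [IsAlgClosed k] {x : M} (hx : x ∈ V) {g : k[X]} (hg : g ≠ 0)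
    (h : V.valuation (aeval x g) < 1) :
    ∃ b ∈ g.roots, V.valuation (x - algebraMap k M b) < 1 := by
  by_contra! hb
  have hs := (IsAlgClosed.splits g).eq_prod_roots
  rw [hs, map_mul, aeval_C, map_mul, hV.valuation_algebraMap (leadingCoeff_ne_zero.mpr hg),
    one_mul, map_multiset_prod, map_multiset_prod, Multiset.map_map, Multiset.map_map] at h
  refine h.ne (Multiset.prod_eq_one fun y hy ↦ ?_)
  obtain ⟨b, hbr, rfl⟩ := Multiset.mem_map.mp hy
  simp only [Function.comp_apply, map_sub, aeval_X, aeval_C]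
  exact le_antisymm ((V.valuation_le_one_iff _).mpr (sub_mem hx (hV b))) (hb b hbr)

end ContainsField

theorem aevalAeval_eq_eval₂ (u x : M) (G : k[X][X]) :
    aevalAeval u x G = G.eval₂ (aeval (R := k) u).toRingHom x := by
  induction G using Polynomial.induction_on' with
  | add p q hp hq => rw [map_add, hp, hq, eval₂_add]
  | monomial n c =>
    rw [eval₂_monomial, ← C_mul_X_pow_eq_monomial, map_mul, map_pow, aevalAeval_C, aevalAeval_Y]
    rfl

/-- If `u` and `x` are algebraically dependent and `u` specializes to `a`, then `x` is not integral
or specializes to one of finitely many values. -/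
theorem exists_finset_specialization [IsAlgClosed k] {u x : M} {G : k[X][X]} (hG : G ≠ 0)
    (h : aevalAeval u x G = 0) {a : k} (hua : u ≠ algebraMap k M a) :
    ∃ B : Finset k, ∀ V : ValuationSubring M, V.ContainsField k →
      V.valuation (u - algebraMap k M a) < 1 → x ∈ V →
        ∃ b ∈ B, V.valuation (x - algebraMap k M b) < 1 := by
  classical
  have hirr : Irreducible (C (X - C a) : k[X][X]) :=
    (Polynomial.prime_C_iff.mpr (prime_X_sub_C a)).irreducible
  -- Removing all factors u - a from G keeps a relation between u and x, as u ≠ a, and makes the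
  -- specialization g at u = a a nonzero polynomial. The possible values of x are the roots of g.
  obtain ⟨n, G', hG', rfl⟩ := WfDvdMonoid.max_power_factor hG hirr
  rw [map_mul, map_pow, aevalAeval_C, mul_eq_zero, or_iff_right] at h
  swap
  · refine pow_ne_zero _ ?_
    simpa [sub_eq_zero] using hua
  let g := G'.map (evalRingHom a)
  have hg : g ≠ 0 := fun h0 ↦ hG' <| (C_dvd_iff_dvd_coeff _ _).mpr fun i ↦ by
    rw [dvd_iff_isRoot, IsRoot, ← coe_evalRingHom, ← coeff_map]
    change g.coeff i = 0
    rw [h0, coeff_zero]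
  refine ⟨g.roots.toFinset, fun V hV hu hx ↦ ?_⟩
  have key (H : k[X][X]) :
      V.valuation (aevalAeval u x H - aeval x (H.map (evalRingHom a))) < 1 := by
    rw [aevalAeval_eq_eval₂]
    induction H using Polynomial.induction_on' with
    | add p q hp hq =>
      rw [eval₂_add, Polynomial.map_add, map_add, add_sub_add_comm]
      exact V.valuation.map_add_lt hp hq
    | monomial n c =>
      rw [eval₂_monomial, map_monomial, aeval_monomial, ← sub_mul, mul_comm]
      exact V.valuation_mul_lt_one (pow_mem hx n) (hV.valuation_aeval_sub_lt_one hu c)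
  have := key G'
  rw [h, zero_sub, Valuation.map_neg] at this
  obtain ⟨b, hb, hb'⟩ := hV.exists_root_of_aeval hx hg this
  exact ⟨b, by simpa using hb, hb'⟩

/-- Every specialization of a transcendental element extends to a place. -/
theorem exists_specialization {u : M} (hu : Transcendental k u) (a : k) :
    ∃ V : ValuationSubring M, V.ContainsField k ∧ V.valuation (u - algebraMap k M a) < 1 := by
  let A : Subring M := (aeval (R := k) u).range.toSubring
  have hA (c : k[X]) : aeval u c ∈ A := ⟨c, rfl⟩
  -- Since u is transcendental, u - a generates a proper ideal of k[u]; some valuation ring contains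
  -- k[u] and has this ideal in its maximal ideal.
  let I : Ideal A := Ideal.span {⟨aeval u (X - C a), hA _⟩}
  have hI : I ≠ ⊤ := by
    intro h
    rw [Ideal.span_singleton_eq_top] at h
    obtain ⟨⟨_, c, rfl⟩, hc⟩ := h.exists_right_inv
    have hc' : aeval u ((X - C a) * c - 1) = 0 := by
      rw [map_sub, map_mul, map_one, sub_eq_zero]
      exact congrArg Subtype.val hc
    have := congrArg (eval a) ((transcendental_iff.mp hu) _ hc')
    simp at this
  obtain ⟨V, hAV, hIV⟩ := I.image_subset_nonunits_valuationSubring hI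
  refine ⟨V, fun c ↦ hAV ⟨C c, by simp⟩, ?_⟩
  rw [← V.mem_nonunits_iff]
  exact hIV ⟨_, Ideal.mem_span_singleton_self _, by simp⟩

end ValuationSubring

/-! ### Specialization of points to constant points -/

noncomputable section

open Polynomial WeierstrassCurve

namespace Points

variable {F : Type*} [Field F] {W : WeierstrassCurve F} {M : Type*} [Field M] [Algebra F M]

/-- The affine curve underlying `Points W M`. -/
abbrev _root_.WeierstrassCurve.over (W : WeierstrassCurve F) (M : Type*) [Field M] [Algebra F M] :
    WeierstrassCurve.Affine M := (W.baseChange M).toAffine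

variable {V : ValuationSubring M}

/-- The affine point `(x, y)`. -/
abbrev mk {x y : M} (h : (W.over M).Nonsingular x y) : Points W M := Affine.Point.some x y h

open scoped Classical in
/-- The subgroup of the points that reduce to the origin modulo `V`. -/
def formal (hW : (W.over M).CoeffMem V) : AddSubgroup (Points W M) :=
  WeierstrassCurve.Affine.Point.formalSubgroup (W.over M) V hW

theorem some_mem_formal_iff (hW : (W.over M).CoeffMem V) {x y : M}
    (h : (W.over M).Nonsingular x y) :
    mk h ∈ formal hW ↔ x ∉ V := Iff.rfl

theorem eq_zero_of_nsmul_of_mem_formal (hW : (W.over M).CoeffMem V) {P : Points W M}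
    (hP : P ∈ formal hW) {N : ℕ} (hN0 : (N : M) ≠ 0) (hN : (N : M)⁻¹ ∈ V) (h : N • P = 0) :
    P = 0 := by
  classical
  exact WeierstrassCurve.Affine.Point.IsFormal.eq_zero_of_nsmul hW hP hN0 hN h

theorem sub_mem_formal (hW : (W.over M).CoeffMem V) (hΔ : (W.over M).Δ ≠ 0)
    (hΔV : (W.over M).Δ⁻¹ ∈ V) {x₁ y₁ x₂ y₂ : M} (h₁ : (W.over M).Nonsingular x₁ y₁)
    (h₂ : (W.over M).Nonsingular x₂ y₂) (hx₁ : x₁ ∈ V) (hx₂ : x₂ ∈ V)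
    (hx : V.valuation (x₁ - x₂) < 1) (hy : V.valuation (y₁ - y₂) < 1) :
    mk h₁ - mk h₂ ∈
      formal hW := by
  classical
  exact WeierstrassCurve.Affine.Point.isFormal_sub_of_congr hW hΔ hΔV h₁ h₂ hx₁ hx₂ hx hy

theorem eq_or_eq_neg_of_X_eq {x y₁ y₂ : M} (h₁ : (W.over M).Nonsingular x y₁)
    (h₂ : (W.over M).Nonsingular x y₂) :
    mk h₁ = mk h₂ ∨
      mk h₁ = -mk h₂ :=
  WeierstrassCurve.Affine.Point.X_eq_iff.mp rfl

section constant

variable {k : Type*} [Field k] [Algebra F k] [Algebra k M] [IsScalarTower F k M]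

variable (W M k) in
/-- Constant points. -/
def const : Points W k →+ Points W M := Points.map W (IsScalarTower.toAlgHom F k M)

theorem coeffMem_of_containsField (hV : V.ContainsField k) : (W.over M).CoeffMem V := by
  have (a : F) : algebraMap F M a ∈ V := by
    rw [IsScalarTower.algebraMap_apply F k M]; exact hV _
  exact ⟨this _, this _, this _, this _, this _⟩

theorem discr_over : (W.over M).Δ = algebraMap F M W.Δ := W.map_Δ _

theorem discr_inv_mem_of_containsField (hV : V.ContainsField k) : (W.over M).Δ⁻¹ ∈ V := by
  rw [discr_over, ← map_inv₀, IsScalarTower.algebraMap_apply F k M]; exact hV _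

/-- Constants are integral, so a constant affine point never reduces to the origin: reduction is
injective on constant points. -/
theorem eq_zero_of_const_mem_formal (hV : V.ContainsField k) {P : Points W k}
    (h : const W M k P ∈ formal (coeffMem_of_containsField (W := W) hV)) : P = 0 := by
  match P, h with
  | .zero, _ => rfl
  | .some x y h', h => exact absurd (hV x) h

variable [IsAlgClosed k]

theorem exists_equation (x : k) : ∃ y, (W.over k).Equation x y := by
  let p : k[X] := X ^ 2 + C ((W.over k).a₁ * x + (W.over k).a₃) * X -
    C (x ^ 3 + (W.over k).a₂ * x ^ 2 + (W.over k).a₄ * x + (W.over k).a₆)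
  have hp : p.degree = 2 := by
    have : p = C 1 * X ^ 2 + C ((W.over k).a₁ * x + (W.over k).a₃) * X +
      C (-(x ^ 3 + (W.over k).a₂ * x ^ 2 + (W.over k).a₄ * x + (W.over k).a₆)) := by
      simp only [p, map_one, one_mul, map_neg, sub_eq_add_neg]
    rw [this]
    exact degree_quadratic one_ne_zero
  obtain ⟨y, hy⟩ := IsAlgClosed.exists_root p (by rw [hp]; decide)
  refine ⟨y, ?_⟩
  rw [Affine.equation_iff]
  simp only [p, IsRoot, eval_add, eval_sub, eval_mul, eval_pow, eval_X, eval_C] at hy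
  linear_combination hy

theorem nonsingular_of_equation [W.IsElliptic] {x y : M} (h : (W.over M).Equation x y) :
    (W.over M).Nonsingular x y := by
  have : (W.over M).IsElliptic := inferInstanceAs (W.map _).IsElliptic
  exact Affine.equation_iff_nonsingular.mp h

theorem discr_over_ne_zero [W.IsElliptic] : (W.over M).Δ ≠ 0 := by
  rw [discr_over]
  exact (_root_.map_ne_zero _).mpr W.isUnit_Δ.ne_zero

/-- A point whose abscissa specializes to the constant `b` specializes to a constant point. -/
theorem exists_const_of_X [W.IsElliptic] (hV : V.ContainsField k) {x y : M} {b : k}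
    (h : (W.over M).Nonsingular x y) (hxb : V.valuation (x - algebraMap k M b) < 1) :
    ∃ (c : k) (h' : (W.over k).Nonsingular b c), mk h -
      const W M k (mk h') ∈ formal (coeffMem_of_containsField hV) := by
  have hW := coeffMem_of_containsField (W := W) hV
  have hx : x ∈ V := by
    have := add_mem (V.mem_of_valuation_lt_one hxb) (hV b)
    rwa [sub_add_cancel] at this
  obtain ⟨c, hc⟩ := exists_equation (W := W) b
  have hc' : (W.over k).Equation b ((W.over k).negY b c) := (Affine.equation_neg ..).mpr hc
  obtain ⟨y', hy'⟩ : ∃ y' : k, (W.over k).Equation b y' ∧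
      V.valuation (y - algebraMap k M y') < 1 := by
    -- The Weierstrass equations at x and at b are subtracted. The product is a multiple of x - b,
    -- so one of the two ordinates over b is the specialization of y.
    have hm : (y - algebraMap k M c) * (y - algebraMap k M ((W.over k).negY b c)) =
        (x ^ 2 + x * algebraMap k M b + (algebraMap k M b) ^ 2 + (W.over M).a₂ *
          (x + algebraMap k M b) + (W.over M).a₄ - (W.over M).a₁ * y) * (x - algebraMap k M b) := by
      have e₁ := (Affine.equation_iff ..).mp h.1
      have e₂ := congrArg (algebraMap k M) ((Affine.equation_iff ..).mp hc)
      have t₁ : algebraMap k M (W.over k).a₁ = (W.over M).a₁ := (IsScalarTower.algebraMap_apply F k M _).symm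
      have t₂ : algebraMap k M (W.over k).a₂ = (W.over M).a₂ := (IsScalarTower.algebraMap_apply F k M _).symm
      have t₃ : algebraMap k M (W.over k).a₃ = (W.over M).a₃ := (IsScalarTower.algebraMap_apply F k M _).symm
      have t₄ : algebraMap k M (W.over k).a₄ = (W.over M).a₄ := (IsScalarTower.algebraMap_apply F k M _).symm
      have t₆ : algebraMap k M (W.over k).a₆ = (W.over M).a₆ := (IsScalarTower.algebraMap_apply F k M _).symm
      simp only [Affine.negY, map_sub, map_neg, map_mul, map_add, map_pow, t₁, t₂, t₃, t₄, t₆]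
        at e₂ ⊢
      linear_combination e₁ - e₂
    have hlt : V.valuation ((y - algebraMap k M c) *
        (y - algebraMap k M ((W.over k).negY b c))) < 1 := by
      rw [hm]
      refine V.valuation_mul_lt_one ?_ hxb
      have hy := hW.mem_of_equation h.1 hx
      have hb := hV b
      obtain ⟨a1, a2, a3, a4, a6⟩ := hW
      refine sub_mem ?_ (mul_mem a1 hy)
      apply_rules [add_mem, mul_mem, pow_mem]
    by_cases h1 : V.valuation (y - algebraMap k M c) < 1
    · exact ⟨c, hc, h1⟩
    · refine ⟨_, hc', ?_⟩
      rw [map_mul] at hlt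
      by_contra h2
      exact absurd hlt (not_lt.mpr (one_le_mul (not_lt.mp h1) (not_lt.mp h2)))
  exact ⟨y', nonsingular_of_equation hy'.1, sub_mem_formal hW discr_over_ne_zero
    (discr_inv_mem_of_containsField hV) _ _ hx (hV b) hxb hy'.2⟩

end constant

end Points

end

/-! ### The generic point: divisibility and finiteness of torsion -/

section

open Polynomial WeierstrassCurve

-- The field is an algebraic closure of k(t), with t the abscissa of a generic point; clearing
-- denominators turns algebraicity over k(t) into a polynomial relation over k.
universe u in
theorem exists_isAlgClosed_transcendenceDegree_one (k : Type u) [Field k] :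
    ∃ (M : Type u) (_ : Field M) (_ : Algebra k M) (t : M), IsAlgClosed M ∧ Transcendental k t ∧
      ∀ u : M, ∃ G : k[X][X], G ≠ 0 ∧ aevalAeval t u G = 0 := by
  let M := AlgebraicClosure (FractionRing k[X])
  have hinj : Function.Injective (algebraMap k[X] M) := by
    rw [IsScalarTower.algebraMap_eq k[X] (FractionRing k[X]) M]
    exact (algebraMap (FractionRing k[X]) M).injective.comp (IsFractionRing.injective _ _)
  refine ⟨M, inferInstance, inferInstance, algebraMap k[X] M X, inferInstance,
    (transcendental_algebraMap_iff hinj).mpr (transcendental_X k), fun u ↦ ?_⟩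
  obtain ⟨G, hG, h⟩ := (IsFractionRing.isAlgebraic_iff k[X] (FractionRing k[X]) M).mpr
    (Algebra.IsAlgebraic.isAlgebraic (R := FractionRing k[X]) u)
  refine ⟨G, hG, ?_⟩
  rw [ValuationSubring.aevalAeval_eq_eval₂, ← h, aeval_def]
  congr 1
  refine RingHom.ext fun p ↦ ?_
  change aeval (algebraMap k[X] M X) p = _
  rw [aeval_algebraMap_apply, aeval_X_left_apply]

theorem Transcendental.inv {k M : Type*} [Field k] [Field M] [Algebra k M] {x : M}
    (h : Transcendental k x) : Transcendental k x⁻¹ :=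
  fun h' ↦ h (by simpa using h'.inv)

namespace Points

variable {F : Type*} [Field F] {W : WeierstrassCurve F} {k : Type*} [Field k]
  [Algebra F k] {M : Type*} [Field M] [Algebra F M] [Algebra k M] [IsScalarTower F k M]

section generic

variable {n : ℕ} {t y x' y' : M}
  {h : (W.over M).Nonsingular t y} {h' : (W.over M).Nonsingular x' y'}

theorem notMem_of_nsmul_of_notMem (hn : n • mk h = mk h') {V : ValuationSubring M}
    (hV : V.ContainsField k) (ht : t ∉ V) : x' ∉ V := by
  have hW := coeffMem_of_containsField (W := W) hV
  have := (formal hW).nsmul_mem ((some_mem_formal_iff hW h).mpr ht) n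
  rwa [hn, some_mem_formal_iff] at this

variable [W.IsElliptic] [IsAlgClosed k]

omit [W.IsElliptic] in
/-- A multiple of a generic point is generic. -/
theorem exists_generic_nsmul (hn : (n : k) ≠ 0) (ht : Transcendental k t)
    (h : (W.over M).Nonsingular t y) : ∃ (x' y' : M) (h' : (W.over M).Nonsingular x' y'),
      n • mk h = mk h' ∧ Transcendental k x' := by
  -- At a place with t = ∞ the generic point lies in the kernel of reduction, which has no
  -- n-torsion.
  obtain ⟨V, hV, htV⟩ := ValuationSubring.exists_specialization ht.inv 0
  have ht0 : t ≠ 0 := fun h ↦ ht (h ▸ isAlgebraic_zero)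
  have htm : t ∉ V := fun hm ↦ by
    rw [map_zero, sub_zero] at htV
    exact V.not_valuation_lt_one_of_inv_mem (inv_ne_zero ht0) (by rwa [inv_inv]) htV
  have hW := coeffMem_of_containsField (W := W) hV
  have hm := (some_mem_formal_iff hW h).mpr htm
  have hnM : (n : M) = algebraMap k M n := (map_natCast _ n).symm
  have hne : n • mk h ≠ 0 := fun h0 ↦ by
    have := eq_zero_of_nsmul_of_mem_formal hW hm (N := n)
      (by rwa [hnM, _root_.map_ne_zero]) (by rw [hnM, ← map_inv₀]; exact hV _) h0
    cases this
  match hP : n • mk h, hne with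
  | .zero, hne => exact absurd rfl hne
  | .some x' y' h', _ =>
    -- An x' algebraic over k would be a constant, hence integral at V, although the multiple still
    -- reduces to the origin.
    refine ⟨x', y', h', rfl, fun hx ↦ notMem_of_nsmul_of_notMem hP hV htm ?_⟩
    obtain ⟨c, rfl⟩ := minpoly.mem_range_of_degree_eq_one k x'
      (IsAlgClosed.degree_eq_one_of_irreducible k (minpoly.irreducible hx.isIntegral))
    exact hV c

/-- Specialize x' to the abscissa a of Q. Then t is finite, since t = ∞ would force x' = ∞, and
takes a constant value. The generic point reduces to a constant point whose n-th multiple has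
abscissa a, so it is Q or -Q. -/
theorem exists_nsmul_eq_of_generic (hn : n • mk h = mk h') (hx : Transcendental k x')
    {G : k[X][X]} (hG : G ≠ 0) (hG0 : aevalAeval x' t G = 0) (Q : Points W k) :
    ∃ P : Points W k, n • P = Q := by
  match Q with
  | .zero => exact ⟨0, smul_zero n⟩
  | .some a c hQ =>
    obtain ⟨B, hB⟩ := ValuationSubring.exists_finset_specialization hG hG0 (a := a)
      (fun h0 ↦ hx (h0 ▸ isAlgebraic_algebraMap a))
    obtain ⟨V, hV, ha⟩ := ValuationSubring.exists_specialization hx a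
    have htV : t ∈ V := by
      by_contra htV
      refine notMem_of_nsmul_of_notMem hn hV htV ?_
      have := V.add_mem _ _ (V.mem_of_valuation_lt_one ha) (hV a)
      rwa [sub_add_cancel] at this
    obtain ⟨b, -, hb⟩ := hB V hV ha htV
    obtain ⟨d, hd, hd'⟩ := exists_const_of_X hV h hb
    obtain ⟨e, he, he'⟩ := exists_const_of_X hV h' ha
    have key : n • mk hd - mk he = 0 := by
      refine eq_zero_of_const_mem_formal (M := M) hV ?_
      have := sub_mem he' (AddSubgroup.nsmul_mem _ hd' n)
      rwa [nsmul_sub, hn, sub_sub_sub_cancel_left, ← map_nsmul, ← map_sub] at this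
    rw [sub_eq_zero] at key
    rcases eq_or_eq_neg_of_X_eq he hQ with h1 | h1
    · exact ⟨mk hd, key.trans h1⟩
    · exact ⟨-mk hd, by rw [smul_neg, key, h1, neg_neg]⟩

/-- Specialize t to the abscissa a of a torsion point. The n-th multiple of the generic point
reduces to the origin, so 1/x' specializes to 0, and the relation between 1/x' and t then leaves
finitely many values for a. -/
theorem finite_torsion_of_generic (hn : n • mk h = mk h') (ht : Transcendental k t)
    (hx : Transcendental k x') {G : k[X][X]} (hG : G ≠ 0) (hG0 : aevalAeval x'⁻¹ t G = 0) :
    {P : Points W k | n • P = 0}.Finite := by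
  obtain ⟨B, hB⟩ := ValuationSubring.exists_finset_specialization hG hG0 (a := 0)
      (fun h0 ↦ hx.inv (h0 ▸ isAlgebraic_algebraMap 0))
  have hfin (b : k) : {P : Points W k | ∃ c, ∃ hc : (W.over k).Nonsingular b c,
      P = mk hc}.Finite := by
    by_cases H : ∃ c, (W.over k).Nonsingular b c
    · obtain ⟨c, hc⟩ := H
      refine (Set.toFinite {mk hc, -mk hc}).subset ?_
      rintro _ ⟨d, hd, rfl⟩
      exact eq_or_eq_neg_of_X_eq hd hc
    · refine Set.finite_empty.subset ?_
      rintro _ ⟨d, hd, rfl⟩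
      exact H ⟨d, hd⟩
  refine ((B.finite_toSet.biUnion fun b _ ↦ hfin b).insert 0).subset fun P hP ↦ ?_
  match P, hP with
  | .zero, _ => exact Or.inl rfl
  | .some a c hP', hP =>
    refine Or.inr (Set.mem_biUnion (x := a) ?_ ⟨c, hP', rfl⟩)
    obtain ⟨V, hV, ha⟩ := ValuationSubring.exists_specialization ht a
    have htV : t ∈ V := by
      have := V.add_mem _ _ (V.mem_of_valuation_lt_one ha) (hV a)
      rwa [sub_add_cancel] at this
    obtain ⟨d, hd, hd'⟩ := exists_const_of_X hV h ha
    have hd0 : n • mk hd = 0 := by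
      rcases eq_or_eq_neg_of_X_eq hd hP' with h1 | h1
      · rw [h1]; exact hP
      · rw [h1, smul_neg, neg_eq_zero]; exact hP
    have hxV : x' ∉ V := by
      have := AddSubgroup.nsmul_mem _ hd' n
      rw [nsmul_sub, hn, ← map_nsmul, hd0, map_zero, sub_zero] at this
      exact this
    obtain ⟨b, hb, hb'⟩ := hB V hV (by
      rw [map_zero, sub_zero]; exact V.inv_mem_of_notMem hxV) htV
    rwa [hV.eq_of_valuation_sub_lt_one ha hb']

end generic

theorem exists_nsmul_eq_and_finite_torsion [W.IsElliptic] [IsAlgClosed k] {n : ℕ}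
    (hn : (n : k) ≠ 0) :
    (∀ Q : Points W k, ∃ P, n • P = Q) ∧ {P : Points W k | n • P = 0}.Finite := by
  obtain ⟨M, _, _, t, _, ht, H⟩ := exists_isAlgClosed_transcendenceDegree_one k
  let _ : Algebra F M := ((algebraMap k M).comp (algebraMap F k)).toAlgebra
  have : IsScalarTower F k M := .of_algebraMap_eq fun _ ↦ rfl
  -- The variables are swapped, because t has to be bounded in terms of the specialization of u.
  have H' (u : M) : ∃ G : k[X][X], G ≠ 0 ∧ aevalAeval u t G = 0 := by
    obtain ⟨G, hG, h⟩ := H u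
    refine ⟨Bivariate.swap G, (EmbeddingLike.map_ne_zero_iff).mpr hG, ?_⟩
    rwa [Bivariate.aevalAeval_swap]
  obtain ⟨y, hy⟩ := exists_equation (W := W) t
  have h := nonsingular_of_equation hy
  obtain ⟨x', y', h', hn', hx⟩ := exists_generic_nsmul hn ht h
  obtain ⟨G, hG, hG0⟩ := H' x'
  obtain ⟨G', hG', hG0'⟩ := H' x'⁻¹
  exact ⟨exists_nsmul_eq_of_generic hn' hx hG hG0, finite_torsion_of_generic hn' ht hx hG' hG0'⟩

end Points

end

/-! ### Endomorphisms of torsion in a divisible group -/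

section divisible

variable {A : Type*} [AddCommGroup A] {n : ℕ}

theorem finite_pow_torsion (hfin : {P : A | n • P = 0}.Finite) (m : ℕ) :
    {P : A | n ^ m • P = 0}.Finite := by
  induction m with
  | zero => simp
  | succ m ih =>
    have : {P : A | n ^ (m + 1) • P = 0} = (fun P ↦ n • P) ⁻¹' {P | n ^ m • P = 0} := by
      ext P; simp [pow_succ, mul_smul]
    rw [this]
    refine ih.preimage' fun Q _ ↦ ?_
    rcases ((fun P : A ↦ n • P) ⁻¹' {Q}).eq_empty_or_nonempty with h | ⟨P, hP⟩
    · rw [h]; exact Set.finite_empty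
    · refine (hfin.image (P + ·)).subset fun P' hP' ↦ ⟨P' - P, ?_, add_sub_cancel _ _⟩
      have h1 : n • P = Q := hP
      have h2 : n • P' = Q := hP'
      change n • (P' - P) = 0
      rw [nsmul_sub, h1, h2, sub_self]

theorem exists_pow_nsmul_eq (hdiv : ∀ Q : A, ∃ P, n • P = Q) (m : ℕ) (Q : A) :
    ∃ P, n ^ m • P = Q := by
  induction m generalizing Q with
  | zero => exact ⟨Q, by simp⟩
  | succ m ih =>
    obtain ⟨P, rfl⟩ := ih Q
    obtain ⟨R, rfl⟩ := hdiv P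
    exact ⟨R, by rw [pow_succ, mul_smul]⟩

/-- In a finite group the kernel has as many elements as the cokernel, and the order of the cokernel
kills it. -/
theorem AddMonoidHom.card_ker_nsmul_mem_range {B : Type*} [AddCommGroup B] [Finite B] (ψ : B →+ B)
    (Q : B) : Nat.card ψ.ker • Q ∈ ψ.range := by
  have h1 := ψ.ker.card_mul_index
  have h2 := ψ.range.card_mul_index
  rw [AddSubgroup.index_ker] at h1
  rw [mul_comm, ← h1, mul_eq_mul_right_iff, or_iff_left Nat.card_pos.ne'] at h2
  rw [← h2]
  exact ψ.range.nsmul_index_mem Q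

/-- On the `n`-power torsion of an `n`-divisible group with finitely many points of order `n`, an
endomorphism that fixes only finitely many points has a surjective difference to the identity. -/
theorem exists_map_sub_eq (hdiv : ∀ Q : A, ∃ P, n • P = Q) (hfin : {P : A | n • P = 0}.Finite)
    (φ : A →+ A) (hφ : {P | (∃ m, n ^ m • P = 0) ∧ φ P = P}.Finite) {Q : A} {m : ℕ}
    (hQ : n ^ m • Q = 0) : ∃ (P : A) (m : ℕ), n ^ m • P = 0 ∧ φ P - P = Q := by
  let K : AddSubgroup A :=
    { carrier := {P | (∃ m, n ^ m • P = 0) ∧ φ P = P}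
      zero_mem' := ⟨⟨0, smul_zero _⟩, map_zero φ⟩
      add_mem' := by
        rintro a b ⟨⟨i, hi⟩, ha⟩ ⟨⟨j, hj⟩, hb⟩
        refine ⟨⟨i + j, ?_⟩, by rw [map_add, ha, hb]⟩
        rw [nsmul_add, pow_add, mul_smul _ _ b, hj, mul_comm, mul_smul _ _ a, hi]
        simp
      neg_mem' := by
        rintro a ⟨⟨i, hi⟩, ha⟩
        exact ⟨⟨i, by rw [smul_neg, hi, neg_zero]⟩, by rw [map_neg, ha]⟩ }
  have : Finite K := hφ
  -- The finite group K of fixed points has exponent dividing a power of n, and its order divides a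
  -- power of its exponent.
  obtain ⟨N, hN⟩ : ∃ N, Nat.card K ∣ n ^ N := by
    have hexp : ∃ r, AddMonoid.exponent K ∣ n ^ r := by
      choose e he using fun P : K ↦ P.2.1
      have := Fintype.ofFinite K
      refine ⟨∑ P, e P, AddMonoid.exponent_dvd_of_forall_nsmul_eq_zero fun P ↦ ?_⟩
      obtain ⟨j, hj⟩ := Nat.exists_eq_add_of_le'
        (Finset.single_le_sum (f := e) (fun _ _ ↦ Nat.zero_le _) (Finset.mem_univ P))
      rw [hj, pow_add, mul_smul]
      have : n ^ e P • P = 0 := Subtype.ext (he P)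
      rw [this, smul_zero]
    obtain ⟨r, hr⟩ := hexp
    refine ⟨r * AddGroup.rank K, ?_⟩
    rw [pow_mul]
    exact (card_dvd_exponent_nsmul_rank K).trans (pow_dvd_pow_of_dvd hr _)
  obtain ⟨q, hq⟩ := hN
  -- On the finite group T of points killed by n^(m+N), the order of ker(φ - 1) divides |K| and
  -- hence n^N. Since that order carries R into the image of φ - 1, so does n^N, and n^N • R = Q.
  obtain ⟨R, hR⟩ := exists_pow_nsmul_eq hdiv N Q
  let T : AddSubgroup A := (nsmulAddMonoidHom (n ^ (m + N)) : A →+ A).ker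
  have hT (P : A) : P ∈ T ↔ n ^ (m + N) • P = 0 := Iff.rfl
  have : Finite T := finite_pow_torsion hfin (m + N)
  let ψ : T →+ T := ((φ - AddMonoidHom.id A).comp T.subtype).codRestrict T fun P ↦ by
    have : n ^ (m + N) • (P : A) = 0 := P.2
    rw [hT]
    change n ^ (m + N) • (φ P - P) = 0
    rw [nsmul_sub, ← map_nsmul, this, map_zero, sub_zero]
  have hcard : Nat.card ψ.ker ∣ Nat.card K := by
    let i : ψ.ker →+ K := (T.subtype.comp ψ.ker.subtype).codRestrict K fun P ↦
      ⟨⟨m + N, P.1.2⟩, sub_eq_zero.mp (congrArg Subtype.val P.2)⟩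
    exact AddSubgroup.card_dvd_of_injective i fun P P' h ↦
      Subtype.ext (Subtype.ext (congrArg (fun P : K ↦ (P : A)) h))
  obtain ⟨s, hs⟩ := hcard
  let R' : T := ⟨R, by rw [hT, pow_add, mul_smul, hR, hQ]⟩
  obtain ⟨P, hP⟩ := ψ.card_ker_nsmul_mem_range R'
  refine ⟨s • q • P, m + N, ?_, ?_⟩
  · rw [smul_comm, smul_comm _ q]
    have : n ^ (m + N) • (P : A) = 0 := P.2
    rw [this]; simp
  · have h1 : φ P - P = Nat.card ψ.ker • R := congrArg Subtype.val hP
    rw [map_nsmul, map_nsmul, ← nsmul_sub, ← nsmul_sub, h1, ← hR, hq, hs]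
    simp only [smul_smul]
    congr 1; ring

end divisible

/-- A cocycle trivial on U is a function on Γ/U. Summing f(gq) = g • f(q) + f(g) over the cosets q
shows that the index of U kills its class, with S the sum of its values. -/
theorem groupCohomology.IsCocycle₁.exists_card_nsmul_eq {Γ A : Type*} [Group Γ] [AddCommGroup A]
    [DistribMulAction Γ A] {f : Γ → A} (hf : groupCohomology.IsCocycle₁ f) (U : Subgroup Γ) [Finite (Γ ⧸ U)]
    (hU : ∀ u ∈ U, f u = 0) : ∃ S : A, ∀ g, Nat.card (Γ ⧸ U) • f g = S - g • S := by
  have := Fintype.ofFinite (Γ ⧸ U)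
  have h1 (g u : Γ) (hu : u ∈ U) : f (g * u) = f g := by rw [hf, hU u hu, smul_zero, zero_add]
  let F : Γ ⧸ U → A := fun q ↦ f q.out
  have hF (g : Γ) : F (g : Γ ⧸ U) = f g := by
    obtain ⟨u, hu⟩ := QuotientGroup.mk_out_eq_mul U g
    change f (QuotientGroup.mk (s := U) g).out = _
    rw [hu, h1 g u u.2]
  refine ⟨∑ q, F q, fun g ↦ ?_⟩
  have h2 (q : Γ ⧸ U) : F (g • q) = g • F q + f g := by
    induction q using QuotientGroup.induction_on with
    | H a => rw [MulAction.Quotient.smul_coe, hF, hF, smul_eq_mul, hf]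
  have h3 := Fintype.sum_equiv (MulAction.toPerm g : Equiv.Perm (Γ ⧸ U)) (fun q ↦ F (g • q)) F
    fun q ↦ rfl
  simp only [h2, Finset.sum_add_distrib, Finset.sum_const, Finset.card_univ] at h3
  rw [Finset.smul_sum, eq_sub_iff_add_eq', Nat.card_eq_fintype_card, h3]

/-! ### Cocycles with torsion values -/

section

variable {F Ω : Type*} [Field F] [Field Ω] [Algebra F Ω] {W : WeierstrassCurve F}
  {S : Type*} [Field S] [Algebra F S] [Algebra S Ω] [IsScalarTower F S Ω]

theorem Points.smul_some (σ : Ω ≃ₐ[S] Ω) {x y : Ω} (h : (W.over Ω).Nonsingular x y) :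
    ∃ h' : (W.over Ω).Nonsingular (σ x) (σ y), σ • Points.mk h = Points.mk h' :=
  ⟨_, rfl⟩

theorem Points.mk_congr {x x' y y' : Ω} {h : (W.over Ω).Nonsingular x y}
    {h' : (W.over Ω).Nonsingular x' y'} (hx : x = x') (hy : y = y') :
    Points.mk h = Points.mk h' := by
  subst hx hy; rfl

theorem Points.smul_eq_of_fixed (σ : Ω ≃ₐ[S] Ω) {x y : Ω} (h : (W.over Ω).Nonsingular x y)
    (hx : σ x = x) (hy : σ y = y) : σ • Points.mk h = Points.mk h := by
  obtain ⟨h', h1⟩ := Points.smul_some σ h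
  rw [h1]
  exact Points.mk_congr hx hy

open IntermediateField in
theorem Points.stabilizer_mem_nhds [Algebra.IsAlgebraic S Ω] (P : Points W Ω) :
    {σ : Ω ≃ₐ[S] Ω | σ • P = P} ∈ nhds 1 := by
  match P with
  | .zero => exact Filter.mem_of_superset Filter.univ_mem fun σ _ ↦ smul_zero σ
  | .some x y h =>
    rw [krullTopology_mem_nhds_one_iff]
    refine ⟨S⟮x, y⟯, finiteDimensional_adjoin fun z _ ↦ (Algebra.IsAlgebraic.isAlgebraic z).isIntegral,
      fun σ hσ ↦ ?_⟩
    rw [SetLike.mem_coe, IntermediateField.mem_fixingSubgroup_iff] at hσ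
    exact Points.smul_eq_of_fixed σ h (hσ _ (subset_adjoin _ _ (by simp)))
      (hσ _ (subset_adjoin _ _ (by simp)))

-- The element α is a primitive element of a finite subextension whose fixator lies in U.
open IntermediateField in
theorem exists_forall_fixed_mem [CharZero S] [Normal S Ω] {U : Set (Ω ≃ₐ[S] Ω)} (hU : U ∈ nhds 1) :
    ∃ α : Ω, ∀ σ : Ω ≃ₐ[S] Ω, σ α = α → σ ∈ U := by
  obtain ⟨L, _, hL⟩ := (krullTopology_mem_nhds_one_iff S Ω U).mp hU
  obtain ⟨α, hα⟩ := Field.exists_primitive_element S L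
  refine ⟨α, fun σ hσ ↦ hL ?_⟩
  have hL' : L = S⟮(α : Ω)⟯ := by
    have := congrArg lift hα
    rwa [lift_top, lift_adjoin_simple, eq_comm] at this
  rw [SetLike.mem_coe, hL']
  have : S⟮(α : Ω)⟯ ≤ fixedField (Subgroup.zpowers σ) := by
    rw [adjoin_simple_le_iff]
    rintro ⟨_, m, rfl⟩
    exact (MulAction.stabilizer (Ω ≃ₐ[S] Ω) (α : Ω)).zpow_mem hσ m
  exact le_iff_le _ _ |>.mp this (Subgroup.mem_zpowers σ)

/-- A cocycle is cohomologous to one that has values in the torsion and is trivial on the fixator of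
some element. -/
theorem exists_nsmul_eq_zero_of_cocycle [CharZero F] [W.IsElliptic] [IsAlgClosure F Ω]
    (f : Z1 (Ω ≃ₐ[F] Ω) (Points W Ω)) : ∃ (n : ℕ) (T : Points W Ω) (α : Ω), n ≠ 0 ∧
      (∀ σ, n • (f.1 σ + (σ • T - T)) = 0) ∧
      ∀ σ : Ω ≃ₐ[F] Ω, σ α = α → f.1 σ + (σ • T - T) = 0 := by
  have : IsAlgClosed Ω := IsAlgClosure.isAlgClosed F
  have : Algebra.IsAlgebraic F Ω := IsAlgClosure.isAlgebraic
  have : Normal F Ω := IsAlgClosure.normal F Ω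
  have : CharZero Ω := charZero_of_injective_algebraMap (algebraMap F Ω).injective
  have : IsGalois F Ω := ⟨⟩
  have h1 : f.1 1 = 0 := groupCohomology.map_one_of_isCocycle₁ f.2.1
  have hU : {σ | f.1 σ = 0} ∈ nhds (1 : Ω ≃ₐ[F] Ω) :=
    (f.2.2.isOpen_fiber 0).mem_nhds h1
  obtain ⟨L, _, hL⟩ := (krullTopology_mem_nhds_one_iff F Ω _).mp hU
  have : Finite ((Ω ≃ₐ[F] Ω) ⧸ L.fixingSubgroup) :=
    Subgroup.quotient_finite_of_isOpen _ L.fixingSubgroup_isOpen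
  obtain ⟨S, hS⟩ := f.2.1.exists_card_nsmul_eq L.fixingSubgroup fun u hu ↦ hL hu
  set n := Nat.card ((Ω ≃ₐ[F] Ω) ⧸ L.fixingSubgroup)
  have hn : n ≠ 0 := Nat.card_pos.ne'
  -- With n • T = S, adding the coboundary of T to f cancels n • f(σ) = S - σ • S.
  obtain ⟨T, hT⟩ := (Points.exists_nsmul_eq_and_finite_torsion (W := W) (k := Ω) (n := n)
    (Nat.cast_ne_zero.mpr hn)).1 S
  obtain ⟨α, hα⟩ := exists_forall_fixed_mem (Filter.inter_mem hU (Points.stabilizer_mem_nhds T))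
  refine ⟨n, T, α, hn, fun σ ↦ ?_, fun σ hσ ↦ ?_⟩
  · rw [nsmul_add, hS, nsmul_sub, ← smul_comm σ, hT]; abel
  · obtain ⟨h1, h2⟩ := hα σ hσ
    change f.1 σ = 0 at h1
    change σ • T = T at h2
    rw [h1, h2, sub_self, add_zero]

end

/-! ### Frobenius and the residue action -/

noncomputable section

open scoped Pointwise

namespace ValuationSubring

variable {S C : Type*} [Field S] [Field C] [Algebra S C] {V : ValuationSubring C}

/-- The action of the Galois group on an invariant valuation ring. -/
abbrev galAction (hV : ∀ (σ : C ≃ₐ[S] C), ∀ x ∈ V, σ x ∈ V) : MulSemiringAction (C ≃ₐ[S] C) V where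
  smul σ x := ⟨σ x, hV σ x x.2⟩
  one_smul _ := rfl
  mul_smul _ _ _ := rfl
  smul_zero σ := Subtype.ext (map_zero σ)
  smul_add σ _ _ := Subtype.ext (map_add σ _ _)
  smul_one σ := Subtype.ext (map_one σ)
  smul_mul σ _ _ := Subtype.ext (map_mul σ _ _)

theorem valuation_algEquiv_lt_one (hV : ∀ (σ : C ≃ₐ[S] C), ∀ x ∈ V, σ x ∈ V) (σ : C ≃ₐ[S] C) {x : C}
    (hx : V.valuation x < 1) : V.valuation (σ x) < 1 := by
  rcases eq_or_ne x 0 with rfl | h0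
  · simp
  by_contra h
  rw [not_lt] at h
  have h1 : (σ x)⁻¹ ∈ V := by
    rw [← V.valuation_le_one_iff, map_inv₀]
    exact inv_le_one_of_one_le₀ h
  have := hV σ⁻¹ _ h1
  rw [map_inv₀] at this
  change (σ.symm (σ x))⁻¹ ∈ V at this
  rw [AlgEquiv.symm_apply_apply] at this
  exact V.not_valuation_lt_one_of_inv_mem h0 this hx

/-- The Frobenius automorphism of a local field, and its powers as the only automorphisms of the
finite extensions of the residue field. -/
theorem exists_frobenius [CharZero S] [IsAlgClosure S C]
    (hV : ∀ (σ : C ≃ₐ[S] C), ∀ x ∈ V, σ x ∈ V)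
    (hres : ∃ R : Set S, R.Finite ∧ ∀ a, algebraMap S C a ∈ V →
      ∃ r ∈ R, V.valuation (algebraMap S C (a - r)) < 1) :
    ∃ (φ : C ≃ₐ[S] C) (q : ℕ), 1 < q ∧ (∀ x ∈ V, V.valuation (φ x - x ^ q) < 1) ∧
      ∀ (σ : C ≃ₐ[S] C) (X : Set C), X.Finite → X ⊆ V →
        ∃ j : ℕ, ∀ x ∈ X, V.valuation (σ x - x ^ (q ^ j)) < 1 := by
  have : IsAlgClosed C := IsAlgClosure.isAlgClosed S
  have : Algebra.IsAlgebraic S C := IsAlgClosure.isAlgebraic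
  have : Normal S C := IsAlgClosure.normal S C
  have : IsGalois S C := ⟨⟩
  let A : ValuationSubring S := V.comap (algebraMap S C)
  let i : A →+* V := (algebraMap S C).restrict A.toSubring V.toSubring fun x hx ↦ hx
  let _ : Algebra A V := i.toAlgebra
  let _ : MulSemiringAction (C ≃ₐ[S] C) V := galAction hV
  have : SMulCommClass (C ≃ₐ[S] C) A V := ⟨fun σ a x ↦ Subtype.ext <| by
    change σ (algebraMap S C a * x) = algebraMap S C a * σ x
    rw [map_mul, σ.commutes]⟩
  -- By Galois theory the invariants of V are the integers A of S. Together with continuity of the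
  -- action this makes V integral over A and lifts residue automorphisms to the decomposition group.
  have : Algebra.IsInvariant A V (C ≃ₐ[S] C) := ⟨fun x hx ↦ by
    obtain ⟨y, hy⟩ := (InfiniteGalois.mem_range_algebraMap_iff_fixed (k := S) (x : C)).mpr
      fun σ ↦ congrArg Subtype.val (hx σ)
    exact ⟨⟨y, by change algebraMap S C y ∈ V; rw [hy]; exact x.2⟩, Subtype.ext hy⟩⟩
  let _ : TopologicalSpace V := ⊥
  have : DiscreteTopology V := ⟨rfl⟩
  have : ContinuousSMul (C ≃ₐ[S] C) V := by
    refine continuousSMul_iff_stabilizer_isOpen.mpr fun x ↦ ?_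
    convert stabilizer_isOpen_of_isIntegral (K := S) (x : C) using 1
    ext σ
    exact Subtype.ext_iff
  have : Algebra.IsIntegral A V := Algebra.IsInvariant.isIntegral_of_profinite (G := C ≃ₐ[S] C)
  let Q := IsLocalRing.maximalIdeal V
  let P := Q.under A
  have hQ (x : V) : x ∈ Q ↔ V.valuation (x : C) < 1 := by
    rw [V.valuation_lt_one_iff]
  have : P.IsMaximal := Ideal.isMaximal_comap_of_isIntegral_of_isMaximal Q
  have hP : Q.LiesOver P := ⟨rfl⟩
  let _ : Field (A ⧸ P) := Ideal.Quotient.field P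
  let _ : Field (V ⧸ Q) := Ideal.Quotient.field Q
  have : Finite (A ⧸ P) := by
    classical
    obtain ⟨R, hR, hR'⟩ := hres
    have : Finite R := hR
    let g : R → A ⧸ P := fun r ↦ if h : r.1 ∈ A then Ideal.Quotient.mk P ⟨r.1, h⟩ else 0
    refine Finite.of_surjective g fun a ↦ ?_
    obtain ⟨a, rfl⟩ := Ideal.Quotient.mk_surjective a
    obtain ⟨r, hr, hr'⟩ := hR' a.1 a.2
    have hrA : r ∈ A := by
      have := sub_mem a.2 (V.mem_of_valuation_lt_one hr' : a.1 - r ∈ A)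
      rwa [sub_sub_cancel] at this
    refine ⟨⟨r, hr⟩, ?_⟩
    simp only [g, dif_pos hrA]
    rw [eq_comm, Ideal.Quotient.mk_eq_mk_iff_sub_mem]
    exact (hQ _).mpr hr'
  let _ := Fintype.ofFinite (A ⧸ P)
  -- As V is invariant, the decomposition group of its maximal ideal is the whole Galois group.
  have hst (σ : C ≃ₐ[S] C) : σ ∈ MulAction.stabilizer (C ≃ₐ[S] C) Q := by
    rw [MulAction.mem_stabilizer_iff]
    refine Ideal.ext fun x ↦ ?_
    rw [Ideal.mem_pointwise_smul_iff_inv_smul_mem, hQ, hQ]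
    refine ⟨fun h ↦ ?_, fun h ↦ valuation_algEquiv_lt_one hV σ⁻¹ h⟩
    have := valuation_algEquiv_lt_one hV σ h
    rwa [show σ (σ⁻¹ • x : V) = x from σ.apply_symm_apply x] at this
  have hint : Algebra.IsIntegral (A ⧸ P) (V ⧸ Q) := inferInstance
  have : Algebra.IsAlgebraic (A ⧸ P) (V ⧸ Q) := inferInstance
  obtain ⟨φ, hφ⟩ := Ideal.Quotient.stabilizerHom_surjective_of_profinite (G := C ≃ₐ[S] C) P Q
    (FiniteField.frobeniusAlgEquivOfAlgebraic (A ⧸ P) (V ⧸ Q))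
  have hmk (x y : V) : Ideal.Quotient.mk Q x = Ideal.Quotient.mk Q y ↔
      V.valuation (x - y : C) < 1 := by
    rw [Ideal.Quotient.mk_eq_mk_iff_sub_mem, hQ]; rfl
  refine ⟨φ, Fintype.card (A ⧸ P), Fintype.one_lt_card, fun x hx ↦ ?_, fun σ X hX hXV ↦ ?_⟩
  · have := DFunLike.congr_fun hφ (Ideal.Quotient.mk Q ⟨x, hx⟩)
    rw [Ideal.Quotient.stabilizerHom_apply, FiniteField.frobeniusAlgEquivOfAlgebraic_apply,
      ← map_pow, hmk] at this
    exact this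
  · let s : (V ⧸ Q) ≃ₐ[A ⧸ P] (V ⧸ Q) := Ideal.Quotient.stabilizerHom Q P (C ≃ₐ[S] C) ⟨σ, hst σ⟩
    let X' : Set (V ⧸ Q) := Ideal.Quotient.mk Q '' (Subtype.val ⁻¹' X)
    have hX' : X'.Finite := (hX.preimage Subtype.val_injective.injOn).image _
    -- The residues of X generate a finite field, whose automorphisms over the finite field A/P are
    -- powers of Frobenius.
    let L : IntermediateField (A ⧸ P) (V ⧸ Q) := IntermediateField.adjoin _ X'
    have hfd : FiniteDimensional (A ⧸ P) L := by
      have := hX'.to_subtype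
      exact IntermediateField.finiteDimensional_adjoin fun x _ ↦ Algebra.IsIntegral.isIntegral x
    have : Finite L := Module.finite_of_finite (A ⧸ P)
    obtain ⟨j, hj⟩ := (FiniteField.bijective_frobeniusAlgEquivOfAlgebraic_pow (A ⧸ P) L).2
      (s.restrictNormal L)
    refine ⟨j, fun x hx ↦ ?_⟩
    let y : L := ⟨Ideal.Quotient.mk Q ⟨x, hXV hx⟩,
      IntermediateField.subset_adjoin _ _ ⟨⟨x, hXV hx⟩, hx, rfl⟩⟩
    have hy := congrArg Subtype.val (DFunLike.congr_fun hj y)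
    have h1 : ((s.restrictNormal L y : L) : V ⧸ Q) = s y := s.restrictNormal_commutes L y
    have h2 (m : ℕ) : (FiniteField.frobeniusAlgEquivOfAlgebraic (A ⧸ P) L ^ m) y =
        y ^ Fintype.card (A ⧸ P) ^ m := by
      induction m with
      | zero => simp
      | succ m ih =>
        rw [pow_succ', AlgEquiv.mul_apply, ih, FiniteField.frobeniusAlgEquivOfAlgebraic_apply,
          ← pow_mul, pow_succ]
    rw [h1, h2, eq_comm] at hy
    have h3 : s y = Ideal.Quotient.mk Q ⟨σ x, hV σ x (hXV hx)⟩ :=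
      Ideal.Quotient.stabilizerHom_apply ..
    rw [h3] at hy
    exact (hmk _ _).mp (hy.trans (map_pow _ _ _).symm)

end ValuationSubring

end

/-! ### Vanishing of unramified torsion classes -/

namespace Points

variable {F : Type*} [Field F] {W : WeierstrassCurve F} {C : Type*} [Field C]
  [Algebra F C] {V : ValuationSubring C} (hW : (W.over C).CoeffMem V) {n : ℕ}
  (hn0 : (n : C) ≠ 0) (hn : (n : C)⁻¹ ∈ V)

include hW hn0 hn

theorem eq_zero_of_pow_nsmul_of_mem_formal {P : Points W C} (hP : P ∈ formal hW) {m : ℕ}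
    (h : n ^ m • P = 0) : P = 0 := by
  refine eq_zero_of_nsmul_of_mem_formal hW hP (N := n ^ m) ?_ ?_ h
  · rw [Nat.cast_pow]; exact pow_ne_zero m hn0
  · rw [Nat.cast_pow, ← inv_pow]; exact pow_mem hn m

theorem mem_of_pow_nsmul_eq_zero {x y : C} (h : (W.over C).Nonsingular x y) {m : ℕ}
    (hm : n ^ m • mk h = 0) : x ∈ V ∧ y ∈ V := by
  have hx : x ∈ V := by
    by_contra hx
    cases eq_zero_of_pow_nsmul_of_mem_formal hW hn0 hn ((some_mem_formal_iff hW h).mpr hx) hm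
  exact ⟨hx, hW.mem_of_equation h.1 hx⟩

/-- The difference of the two points is n-power torsion in the kernel of reduction, hence zero. -/
theorem eq_of_reduction_eq [W.IsElliptic] (hΔ : (W.over C).Δ⁻¹ ∈ V) {x y x' y' : C}
    {h : (W.over C).Nonsingular x y} {h' : (W.over C).Nonsingular x' y'} {m m' : ℕ}
    (hm : n ^ m • mk h = 0) (hm' : n ^ m' • mk h' = 0) (hx : V.valuation (x - x') < 1)
    (hy : V.valuation (y - y') < 1) : mk h = mk h' := by
  have h1 := sub_mem_formal hW discr_over_ne_zero hΔ h h'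
    (mem_of_pow_nsmul_eq_zero hW hn0 hn h hm).1 (mem_of_pow_nsmul_eq_zero hW hn0 hn h' hm').1 hx hy
  refine sub_eq_zero.mp (eq_zero_of_pow_nsmul_of_mem_formal hW hn0 hn h1 (m := m + m') ?_)
  rw [nsmul_sub, pow_add, mul_smul _ _ (mk h'), hm', mul_comm, mul_smul, hm, smul_zero, smul_zero,
    sub_zero]

end Points

-- After subtracting the coboundary of a suitable torsion point P, the cocycle vanishes at Frobenius
-- and so on its powers. Any σ is a power of Frobenius times an element τ acting trivially on the
-- residues of α and of the coordinates of P. Distinct conjugates of α have distinct residues, and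
-- torsion points are determined by their reductions, so τ fixes α and P and the cocycle vanishes at
-- τ too.
open ValuationSubring in
theorem H1.eq_zero_of_unramified {F S C : Type*} [Field F] [Field S] [CharZero S] [Field C] [Algebra S C]
    [IsAlgClosure S C] [Algebra F S] [Algebra F C] [IsScalarTower F S C] {W : WeierstrassCurve F}
    [W.IsElliptic] {V : ValuationSubring C} (hV : ∀ (σ : C ≃ₐ[S] C), ∀ x ∈ V, σ x ∈ V)
    (hres : ∃ R : Set S, R.Finite ∧ ∀ a, algebraMap S C a ∈ V →
      ∃ r ∈ R, V.valuation (algebraMap S C (a - r)) < 1)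
    (hW : (W.over C).CoeffMem V) (hΔ : (W.over C).Δ⁻¹ ∈ V) {n : ℕ} (hn0 : n ≠ 0)
    (hn : (n : C)⁻¹ ∈ V) (f : Z1 (C ≃ₐ[S] C) (Points W C)) (T : Points W C) {α : C} (hα : α ∈ V)
    (hα' : ∀ σ : C ≃ₐ[S] C, σ α ≠ α → (σ α - α)⁻¹ ∈ V)
    (h1 : ∀ σ, n • (f.1 σ + (σ • T - T)) = 0)
    (h2 : ∀ σ : C ≃ₐ[S] C, σ α = α → f.1 σ + (σ • T - T) = 0) :
    (f : H1 (C ≃ₐ[S] C) (Points W C)) = 0 := by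
  have : IsAlgClosed C := IsAlgClosure.isAlgClosed S
  have : CharZero C := charZero_of_injective_algebraMap (algebraMap S C).injective
  have hnC : (n : C) ≠ 0 := Nat.cast_ne_zero.mpr hn0
  obtain ⟨φ, q, hq, hφ, hσ⟩ := exists_frobenius hV hres
  obtain ⟨hdiv, hfin⟩ := Points.exists_nsmul_eq_and_finite_torsion (W := W) hnC
  have hker : {P : Points W C | (∃ m, n ^ m • P = 0) ∧ φ • P = P}.Finite := by
    let κ := IsLocalRing.ResidueField V
    have hfix : {z : κ | z ^ q = z}.Finite := by
      refine ((Polynomial.X ^ q - Polynomial.X : Polynomial κ).rootSet_finite κ).subset fun z hz ↦ ?_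
      rw [Polynomial.mem_rootSet]
      exact ⟨FiniteField.X_pow_card_sub_X_ne_zero κ hq, by simpa [sub_eq_zero] using hz⟩
    have hres (x y : V) : IsLocalRing.residue V x = IsLocalRing.residue V y ↔
        V.valuation (x - y : C) < 1 := by
      rw [← sub_eq_zero, ← map_sub, IsLocalRing.residue_eq_zero_iff]
      exact V.valuation_lt_one_iff (x - y)
    classical
    -- Reduction is injective on n-power torsion and takes points fixed by φ to points whose
    -- coordinates satisfy z^q = z. The value `none` stands for the origin; its use for non-integral
    -- points is harmless, as torsion points are integral.
    let g : Points W C → Option (κ × κ) := fun P ↦ match P with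
      | .zero => none
      | .some x y _ => if h : x ∈ V ∧ y ∈ V then
          some (IsLocalRing.residue V ⟨x, h.1⟩, IsLocalRing.residue V ⟨y, h.2⟩) else none
    have hfx (x : C) (hx : x ∈ V) (h : φ x = x) :
        IsLocalRing.residue V ⟨x, hx⟩ ^ q = IsLocalRing.residue V ⟨x, hx⟩ := by
      have := hφ x hx
      rw [h, V.valuation.map_sub_swap] at this
      rw [← map_pow, hres]
      exact this
    refine Set.Finite.of_injOn (f := g) (t := insert none (some '' ({z | z ^ q = z} ×ˢ
      {z | z ^ q = z}))) ?_ ?_ (((hfix.prod hfix).image _).insert none)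
    · rintro (_ | ⟨x, y, h⟩) ⟨⟨m, hm⟩, hfx'⟩
      · exact Or.inl rfl
      · have hxy := Points.mem_of_pow_nsmul_eq_zero hW hnC hn h hm
        have h3 := WeierstrassCurve.Affine.Point.some.inj hfx'
        simp only [g, dif_pos hxy]
        exact Or.inr ⟨(_, _), ⟨hfx x hxy.1 h3.1, hfx y hxy.2 h3.2⟩, rfl⟩
    · rintro (_ | ⟨x, y, h⟩) ⟨⟨m, hm⟩, -⟩ (_ | ⟨x', y', h'⟩) ⟨⟨m', hm'⟩, -⟩ hg
      · rfl
      · have hxy := Points.mem_of_pow_nsmul_eq_zero hW hnC hn h' hm'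
        simp [g, dif_pos hxy] at hg
      · have hxy := Points.mem_of_pow_nsmul_eq_zero hW hnC hn h hm
        simp [g, dif_pos hxy] at hg
      · have hxy := Points.mem_of_pow_nsmul_eq_zero hW hnC hn h hm
        have hxy' := Points.mem_of_pow_nsmul_eq_zero hW hnC hn h' hm'
        simp only [g, dif_pos hxy, dif_pos hxy', Option.some.injEq, Prod.mk.injEq, hres] at hg
        exact Points.eq_of_reduction_eq hW hnC hn hΔ hm hm' hg.1 hg.2
  obtain ⟨P, m, hP, hPf⟩ := exists_map_sub_eq hdiv hfin
    (DistribSMul.toAddMonoidHom (Points W C) φ) hker (Q := f.1 φ + (φ • T - T)) (m := 1)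
    (by rw [pow_one, h1])
  rw [DistribSMul.toAddMonoidHom_apply] at hPf
  let h : (C ≃ₐ[S] C) → Points W C := fun σ ↦ f.1 σ + (σ • T - T) - (σ • P - P)
  have hmul (σ τ) : h (σ * τ) = σ • h τ + h σ := by
    simp only [h, f.2.1 σ τ, smul_add, smul_sub, mul_smul]; abel
  have hφ0 (j : ℕ) : h (φ ^ j) = 0 := by
    induction j with
    | zero =>
      have := hmul 1 1
      rw [one_smul, mul_one] at this
      rw [pow_zero]
      exact left_eq_add.mp this
    | succ j ih => 
      rw [pow_succ', hmul, ih, smul_zero, zero_add]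
      simp only [h, hPf, sub_self]
  have key (σ : C ≃ₐ[S] C) : h σ = 0 := by
    -- X consists of the coordinates of P: their residues decide whether P is fixed.
    obtain ⟨X, hX, hXV, hPX⟩ : ∃ X : Set C, X.Finite ∧ X ⊆ V ∧ ∀ τ : C ≃ₐ[S] C,
        (∀ x ∈ X, V.valuation (τ x - x) < 1) → τ • P = P := by
      match P, hP with
      | .zero, _ => exact ⟨∅, Set.finite_empty, Set.empty_subset _, fun τ _ ↦ smul_zero τ⟩
      | .some x y h, hP =>
        obtain ⟨hx, hy⟩ := Points.mem_of_pow_nsmul_eq_zero hW hnC hn h hP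
        refine ⟨{x, y}, Set.toFinite _, by rintro z (rfl | rfl) <;> assumption, fun τ hτ ↦ ?_⟩
        obtain ⟨h', hh'⟩ := Points.smul_some τ h
        have : n ^ m • Points.mk h' = 0 := by
          rw [← hh', smul_comm]; exact (congrArg (τ • ·) hP).trans (smul_zero τ)
        exact hh'.trans (Points.eq_of_reduction_eq hW hnC hn hΔ this hP (hτ _ (by simp)) (hτ _ (by simp)))
    obtain ⟨j, hj⟩ := hσ σ (insert α X) (hX.insert α) (Set.insert_subset hα hXV)
    have hpow (x : C) (hx : x ∈ V) (i : ℕ) : V.valuation ((φ ^ i) x - x ^ (q ^ i)) < 1 := by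
      induction i with
      | zero => simp
      | succ i ih =>
        have := V.valuation.map_add_lt (valuation_algEquiv_lt_one hV φ ih) (hφ _ (pow_mem hx (q ^ i)))
        rwa [map_sub, sub_add_sub_cancel, ← pow_mul, ← pow_succ, ← AlgEquiv.mul_apply, ← pow_succ']
          at this
    let τ := (φ ^ j)⁻¹ * σ
    have hτ : ∀ x ∈ insert α X, V.valuation (τ x - x) < 1 := by
      intro x hx
      have hxV := Set.insert_subset hα hXV hx
      have h3 := valuation_algEquiv_lt_one hV (φ ^ j)⁻¹
        (V.valuation.map_sub_lt (hj x hx) (hpow x hxV j))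
      rwa [sub_sub_sub_cancel_right, map_sub, show (φ ^ j)⁻¹ ((φ ^ j) x) = x from
        (φ ^ j).symm_apply_apply x] at h3
    have hτα : τ α = α := by
      by_contra hne
      exact V.not_valuation_lt_one_of_inv_mem (sub_ne_zero.mpr hne) (hα' τ hne) (hτ α (by simp))
    have hτ0 : h τ = 0 := by
      simp only [h, h2 τ hτα, hPX τ fun x hx ↦ hτ x (Set.mem_insert_of_mem _ hx), sub_self]
    rw [show σ = φ ^ j * τ by simp [τ], hmul, hτ0, smul_zero, zero_add, hφ0]
  refine (QuotientAddGroup.eq_zero_iff f).mpr ⟨P - T, fun σ ↦ ?_⟩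
  have := key σ
  simp only [h] at this
  rw [smul_sub, ← sub_eq_zero, ← neg_eq_zero, ← this]
  abel

/-! ### Valuation rings above the primes of a number field -/

noncomputable section

open IsDedekindDomain NumberField

namespace ValuationSubring

section spectral

variable (S C : Type*) [NontriviallyNormedField S] [IsUltrametricDist S] [CompleteSpace S]
  [Field C] [Algebra S C] [Algebra.IsAlgebraic S C]

variable {S C} in
theorem _root_.spectralNorm_mul_eq (x y : C) :
    spectralNorm S C (x * y) = spectralNorm S C x * spectralNorm S C y := by
  simpa only [spectralAlgNorm_def] using spectralAlgNorm_mul (K := S) x y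

variable {S C} in
theorem _root_.spectralNorm_inv (x : C) : spectralNorm S C x⁻¹ = (spectralNorm S C x)⁻¹ := by
  rcases eq_or_ne x 0 with rfl | h
  · simp [spectralNorm_zero]
  · refine eq_inv_of_mul_eq_one_left ?_
    rw [← spectralNorm_mul_eq, inv_mul_cancel₀ h, spectralNorm_one]

/-- The valuation ring of the extension of a complete non-archimedean absolute value to an algebraic
extension. -/
def ofSpectralNorm : ValuationSubring C where
  carrier := {x | spectralNorm S C x ≤ 1}
  mul_mem' {a b} ha hb := by
    rw [Set.mem_ofPred_eq, spectralNorm_mul_eq]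
    exact mul_le_one₀ ha (spectralNorm_nonneg b) hb
  one_mem' := spectralNorm_one.le
  add_mem' {a b} ha hb := (isNonarchimedean_spectralNorm a b).trans (max_le ha hb)
  zero_mem' := by
    rw [Set.mem_ofPred_eq, spectralNorm_zero]; exact zero_le_one
  neg_mem' {a} ha := by
    rw [Set.mem_ofPred_eq, spectralNorm_neg (Algebra.IsAlgebraic.isAlgebraic a)]; exact ha
  mem_or_inv_mem' x := by
    rw [Set.mem_ofPred_eq, Set.mem_ofPred_eq, spectralNorm_inv]
    exact (le_total _ 1).imp_right inv_le_one_of_one_le₀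

variable {S C}

theorem mem_ofSpectralNorm {x : C} : x ∈ ofSpectralNorm S C ↔ spectralNorm S C x ≤ 1 := Iff.rfl

theorem algebraMap_mem_ofSpectralNorm {x : S} :
    algebraMap S C x ∈ ofSpectralNorm S C ↔ ‖x‖ ≤ 1 := by
  rw [mem_ofSpectralNorm, spectralNorm_extends]

theorem valuation_ofSpectralNorm_lt_one {x : C} (h : spectralNorm S C x < 1) :
    (ofSpectralNorm S C).valuation x < 1 := by
  rcases eq_or_ne x 0 with rfl | h0
  · simp
  rw [← inv_inv x]
  refine inv_mem_of_notMem _ fun hm ↦ ?_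
  have h1 : 0 < spectralNorm S C x := spectralNorm_zero_lt h0 (Algebra.IsAlgebraic.isAlgebraic x)
  rw [mem_ofSpectralNorm, spectralNorm_inv, inv_le_one₀ h1] at hm
  exact absurd h (not_lt.mpr hm)

end spectral

theorem mem_of_monic {F C : Type*} [Field F] [Field C] [Algebra F C] {V : ValuationSubring C}
    {p : Polynomial F} (hp : p.Monic) (h : ∀ i, algebraMap F C (p.coeff i) ∈ V) {x : C}
    (hx : Polynomial.aeval x p = 0) : x ∈ V := by
  have hl : p.map (algebraMap F C) ∈ Polynomial.lifts (algebraMap V C) := by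
    rw [Polynomial.lifts_iff_coeff_lifts]
    intro i
    rw [Polynomial.coeff_map]
    exact ⟨⟨_, h i⟩, rfl⟩
  obtain ⟨q, hq, -, hqm⟩ := Polynomial.lifts_and_natDegree_eq_and_monic hl (hp.map _)
  have hi : IsIntegral V x := ⟨q, hqm, by
    rw [← Polynomial.eval_map, hq, Polynomial.eval_map_algebraMap, hx]⟩
  obtain ⟨y, hy⟩ := (IsIntegrallyClosed.isIntegral_iff (K := C)).mp hi
  rw [← hy]
  exact y.2

end ValuationSubring

section places

variable {F : Type*} [Field F] [NumberField F]

/-- The valuation ring `V` contains the `v`-integers. -/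
def ValuationSubring.LiesAbove {C : Type*} [Field C] [Algebra F C] (V : ValuationSubring C)
    (v : HeightOneSpectrum (𝓞 F)) : Prop :=
  ∀ a : F, v.valuation F a ≤ 1 → algebraMap F C a ∈ V

/-- The places at which an algebraic number might not be integral. -/
def nonintegralPlaces (F : Type*) [Field F] [NumberField F] {Ω : Type*} [Field Ω] [Algebra F Ω] (d : Ω) :
    Set (HeightOneSpectrum (𝓞 F)) :=
  {v | ∃ i, 1 < v.valuation F ((minpoly F d).coeff i)}

theorem finite_nonintegralPlaces {Ω : Type*} [Field Ω] [Algebra F Ω] (d : Ω) :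
    (nonintegralPlaces F d).Finite := by
  refine (Set.Finite.biUnion (minpoly F d).support.finite_toSet fun i _ ↦
    HeightOneSpectrum.Support.finite (𝓞 F) ((minpoly F d).coeff i)).subset ?_
  rintro v ⟨i, hi⟩
  refine Set.mem_biUnion (x := i) ?_ hi
  rw [SetLike.mem_coe, Polynomial.mem_support_iff]
  intro h0
  simp [h0] at hi

theorem ValuationSubring.LiesAbove.map_mem {Ω C : Type*} [Field Ω] [Algebra F Ω] [Algebra.IsAlgebraic F Ω]
    [Field C] [Algebra F C] {V : ValuationSubring C} {v : HeightOneSpectrum (𝓞 F)}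
    (hV : V.LiesAbove v) (i : Ω →ₐ[F] C) {d : Ω} (hd : v ∉ nonintegralPlaces F d) : i d ∈ V := by
  refine mem_of_monic (minpoly.monic (Algebra.IsAlgebraic.isAlgebraic (R := F) d).isIntegral)
    (fun j ↦ hV _ ?_) (x := i d) ?_
  · by_contra h
    exact hd ⟨j, not_le.mp h⟩
  · rw [Polynomial.aeval_algHom_apply, minpoly.aeval, map_zero]

open scoped Valued in
/-- An algebraic extension of `F_v` has a valuation ring invariant under all automorphisms. -/
theorem exists_valuationSubring (v : HeightOneSpectrum (𝓞 F)) (C : Type*) [Field C]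
    [Algebra (v.adicCompletion F) C] [Algebra.IsAlgebraic (v.adicCompletion F) C] :
    ∃ V : ValuationSubring C, (∀ (σ : C ≃ₐ[v.adicCompletion F] C), ∀ x ∈ V, σ x ∈ V) ∧
      (∀ a : F, v.valuation F a ≤ 1 →
        algebraMap (v.adicCompletion F) C (algebraMap F (v.adicCompletion F) a) ∈ V) ∧
      ∃ R : Set (v.adicCompletion F), R.Finite ∧ ∀ a, algebraMap (v.adicCompletion F) C a ∈ V →
        ∃ r ∈ R, V.valuation (algebraMap (v.adicCompletion F) C (a - r)) < 1 := by
  let S := v.adicCompletion F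
  have hnorm (a : F) : Valued.v (algebraMap F S a) = v.valuation F a :=
    HeightOneSpectrum.valuedAdicCompletion_eq_valuation' v a
  refine ⟨ValuationSubring.ofSpectralNorm S C, fun σ x hx ↦ ?_, fun a ha ↦ ?_, ?_⟩
  · rwa [ValuationSubring.mem_ofSpectralNorm, ← spectralNorm_eq_of_equiv]
  · rwa [ValuationSubring.algebraMap_mem_ofSpectralNorm, Valued.toNormedField.norm_le_one_iff, hnorm]
  · have : Finite (𝓞 F ⧸ v.asIdeal) := v.asIdeal.finiteQuotientOfFreeOfNeBot v.ne_bot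
    -- Representatives of 𝓞_F/v suffice: an integral a is approximated by k in F, then k by s in
    -- 𝓞_F, then s by the representative of its class, each time with error of norm below 1.
    refine ⟨Set.range fun q : 𝓞 F ⧸ v.asIdeal ↦ algebraMap F S (algebraMap (𝓞 F) F q.out),
      Set.finite_range _, fun a ha ↦ ?_⟩
    rw [ValuationSubring.algebraMap_mem_ofSpectralNorm] at ha
    obtain ⟨k, hk⟩ := (v.denseRange_algebraMap F).exists_dist_lt a one_pos
    rw [dist_eq_norm] at hk
    have hk1 : v.valuation F k ≤ 1 := by
      rw [← hnorm, ← Valued.toNormedField.norm_le_one_iff, ← sub_add_cancel (algebraMap F S k) a]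
      rw [norm_sub_rev] at hk
      exact (IsUltrametricDist.norm_add_le_max _ _).trans (max_le hk.le ha)
    obtain ⟨s, hs⟩ := v.exists_valuation_sub_lt_of_integer (K := F) hk1 1
    refine ⟨_, ⟨Ideal.Quotient.mk _ s, rfl⟩, ValuationSubring.valuation_ofSpectralNorm_lt_one ?_⟩
    rw [spectralNorm_extends]
    set s' := (Ideal.Quotient.mk v.asIdeal s).out
    have hs' : v.valuation F (algebraMap (𝓞 F) F (s - s')) < 1 := by
      rw [HeightOneSpectrum.valuation_lt_one_iff_mem, ← Ideal.Quotient.mk_eq_mk_iff_sub_mem]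
      exact (Quotient.out_eq' _).symm
    have h2 : ‖algebraMap F S (k - algebraMap (𝓞 F) F s)‖ < 1 := by
      rw [Valued.toNormedField.norm_lt_one_iff, hnorm, Valuation.map_sub_swap]; exact hs
    have h3 : ‖algebraMap F S (algebraMap (𝓞 F) F (s - s'))‖ < 1 := by
      rw [Valued.toNormedField.norm_lt_one_iff, hnorm]; exact hs'
    have : a - algebraMap F S (algebraMap (𝓞 F) F s') = (a - algebraMap F S k) +
        (algebraMap F S (k - algebraMap (𝓞 F) F s) +
          algebraMap F S (algebraMap (𝓞 F) F (s - s'))) := by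
      simp only [map_sub]; abel
    rw [this]
    exact (IsUltrametricDist.norm_add_le_max _ _).trans_lt (max_lt hk ((IsUltrametricDist.norm_add_le_max _ _).trans_lt (max_lt h2 h3)))

end places

end

/-! ### Local triviality of a global class at almost all places -/

noncomputable section

open IsDedekindDomain NumberField

variable {F K : Type*} [Field F] [NumberField F] [Field K] [NumberField K] [Algebra F K]

instance Place.charZero_completion (v : Place F) : CharZero v.Completion :=
  charZero_of_injective_algebraMap (algebraMap F v.Completion).injective

instance Place.Above.isAlgClosure [Normal F K] {v : Place F} (w : v.Above K) :
    IsAlgClosure v.Completion w.Closure :=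
  ⟨inferInstance, Algebra.IsAlgebraic.trans v.Completion w.Completion w.Closure⟩

variable {Ω : Type*} [Field Ω] [Algebra F Ω] [Algebra K Ω] [IsScalarTower F K Ω] [IsAlgClosure F Ω]
  [IsGalois F K] (W : WeierstrassCurve F) [W.IsElliptic]

/-- A global class is locally trivial at almost all finite places. -/
theorem finite_locG_ne_zero_finite (w : ∀ v : Place F, v.Above K) (c : H1 (Ω ≃ₐ[F] Ω) (Points W Ω)) :
    {v : HeightOneSpectrum (𝓞 F) | locG Ω W (w (.finite v)) c ≠ 0}.Finite := by
  have : Algebra.IsAlgebraic F Ω := IsAlgClosure.isAlgebraic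
  have : Normal F Ω := IsAlgClosure.normal F Ω
  induction c using QuotientAddGroup.induction_on with
  | H f =>
  obtain ⟨n, T, α, hn0, h1, h2⟩ := exists_nsmul_eq_zero_of_cocycle f
  -- Integrality of D at v gives good reduction, invertibility of n, and distinct residues for the
  -- conjugates of α. The conjugate β = α contributes only 0⁻¹ = 0.
  let D : Set Ω := {algebraMap F Ω W.a₁, algebraMap F Ω W.a₂, algebraMap F Ω W.a₃,
    algebraMap F Ω W.a₄, algebraMap F Ω W.a₆, algebraMap F Ω W.Δ⁻¹, (n : Ω)⁻¹, α} ∪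
    (fun β ↦ (β - α)⁻¹) '' (minpoly F α).rootSet Ω
  have hD : D.Finite := (Set.toFinite _).union ((Polynomial.rootSet_finite _ _).image _)
  refine (hD.biUnion fun d _ ↦ finite_nonintegralPlaces (F := F) d).subset fun v hv ↦ ?_
  by_contra hvD
  refine hv ?_
  set w := w (.finite v)
  let S := (Place.finite v).Completion
  obtain ⟨V, hV, hVv, hres⟩ : ∃ V : ValuationSubring w.Closure,
      (∀ (σ : w.Closure ≃ₐ[S] w.Closure), ∀ x ∈ V, σ x ∈ V) ∧
      (∀ a : F, v.valuation F a ≤ 1 → algebraMap S w.Closure (algebraMap F S a) ∈ V) ∧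
      ∃ R : Set S, R.Finite ∧ ∀ a, algebraMap S w.Closure a ∈ V →
        ∃ r ∈ R, V.valuation (algebraMap S w.Closure (a - r)) < 1 :=
    have h : Algebra.IsAlgebraic S w.Closure := IsAlgClosure.isAlgebraic
    letI : Algebra (v.adicCompletion F) w.Closure := inferInstanceAs (Algebra S w.Closure)
    haveI : Algebra.IsAlgebraic (v.adicCompletion F) w.Closure := h
    exists_valuationSubring v w.Closure
  have hVv' : V.LiesAbove v := fun a ha ↦ by
    rw [IsScalarTower.algebraMap_apply F S]; exact hVv a ha
  let i : Ω →ₐ[F] w.Closure := (w.embed Ω).restrictScalars F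
  have hi {d : Ω} (hd : d ∈ D) : i d ∈ V :=
    hVv'.map_mem i fun h ↦ hvD (Set.mem_biUnion hd h)
  have hiF {a : F} (ha : algebraMap F Ω a ∈ D) : algebraMap F w.Closure a ∈ V := by
    rw [← i.commutes]; exact hi ha
  have hg (σ : w.Closure ≃ₐ[S] w.Closure) (x : Ω) : i (galRes S i σ x) = σ (i x) := galRes_apply i σ x
  have hsmul (σ : w.Closure ≃ₐ[S] w.Closure) (P : Points W Ω) :
      σ • Points.map W i P = Points.map W i (galRes S i σ • P) := by
    rw [Points.smul_def, Points.smul_def, Points.map_map, Points.map_map]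
    congr 1
    exact congrArg _ (AlgHom.ext fun x ↦ (hg σ x).symm)
  have hfσ (σ : w.Closure ≃ₐ[S] w.Closure) : Points.map W i (f.1 (galRes S i σ)) +
      (σ • Points.map W i T - Points.map W i T) =
      Points.map W i (f.1 (galRes S i σ) + (galRes S i σ • T - T)) := by
    rw [map_add, map_sub, hsmul]
  refine H1.eq_zero_of_unramified (S := S) (V := V) (n := n) hV hres ⟨hiF ?_, hiF ?_, hiF ?_, hiF ?_, hiF ?_⟩ ?_ hn0 ?_
    (Z1.map (galRes S i) (continuous_galRes i) (Points.map W i) _ f) (Points.map W i T)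
    (α := i α) (hi ?_) (fun σ hσ ↦ ?_) (fun σ ↦ ?_) fun σ hσ ↦ ?_
  · simp [D]
  · simp [D]
  · simp [D]
  · simp [D]
  · simp [D]
  · rw [Points.discr_over, ← map_inv₀]
    exact hiF (by simp [D])
  · rw [← map_natCast i, ← map_inv₀]
    exact hi (by simp [D])
  · simp [D]
  · rw [← hg, ← map_sub, ← map_inv₀]
    refine hi (Or.inr ⟨_, ?_, rfl⟩)
    rw [Polynomial.mem_rootSet]
    refine ⟨minpoly.ne_zero (Algebra.IsAlgebraic.isAlgebraic (R := F) α).isIntegral, ?_⟩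
    rw [Polynomial.aeval_algHom_apply, minpoly.aeval, map_zero]
  · have := hfσ σ
    refine (congrArg (n • ·) this).trans ?_
    rw [← map_nsmul, h1, map_zero]
  · refine (hfσ σ).trans ?_
    rw [h2 _ (i.injective ((hg σ α).trans hσ)), map_zero]

/-- A global class is locally trivial at almost all places. -/
theorem finite_locG_ne_zero (w : ∀ v : Place F, v.Above K) (c : H1 (Ω ≃ₐ[F] Ω) (Points W Ω)) :
    {v : Place F | locG Ω W (w v) c ≠ 0}.Finite := by
  refine (((finite_locG_ne_zero_finite W w c).image Place.finite).union
    (Set.finite_range (Place.infinite (F := F)))).subset ?_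
  rintro (v | v) hv
  · exact Or.inl ⟨v, hv, rfl⟩
  · exact Or.inr ⟨v, rfl⟩

end

/-! ### Exactness at the transgression -/

noncomputable section

open groupCohomology (IsCocycle₁ map_one_of_isCocycle₁)

theorem groupCohomology.IsCocycle₁.isLocallyConstant {Γ A : Type*} [Group Γ] [TopologicalSpace Γ]
    [IsTopologicalGroup Γ] [AddCommGroup A] [DistribMulAction Γ A] {f : Γ → A} (hf : IsCocycle₁ f)
    (h : ∀ᶠ g in nhds (1 : Γ), f g = 0) : IsLocallyConstant f := by
  rw [IsLocallyConstant.iff_eventually_eq]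
  intro g
  have h1 : Filter.Tendsto (fun x ↦ g⁻¹ * x) (nhds g) (nhds 1) := by
    have := (continuous_const_mul g⁻¹).tendsto g
    rwa [inv_mul_cancel] at this
  filter_upwards [h1.eventually h] with x hx
  have := hf g (g⁻¹ * x)
  rwa [mul_inv_cancel_left, hx, smul_zero, zero_add] at this

theorem Z1.eventually_eq_zero {Γ A : Type*} [Group Γ] [TopologicalSpace Γ] [AddCommGroup A]
    [DistribMulAction Γ A] (f : Z1 Γ A) : ∀ᶠ g in nhds (1 : Γ), f.1 g = 0 := by
  have := (IsLocallyConstant.iff_eventually_eq _).mp f.2.2 1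
  rwa [map_one_of_isCocycle₁ f.2.1] at this

namespace NormalExtension

variable {N Γ Q B A : Type*} [Group N] [Group Γ] [Group Q] [TopologicalSpace N] [TopologicalSpace Γ]
  [AddCommGroup A] [AddCommGroup B] [DistribMulAction N A] [DistribMulAction Γ A]
  [DistribMulAction Q B] (D : NormalExtension N Γ Q B A) [IsTopologicalGroup Γ]

/-- A cocycle on Γ is itself a cochain extending its restriction, with zero coboundary;
transgressions are unique. -/
theorem trans_res (c : H1 Γ A) : D.trans (D.res c) = 0 := by
  refine (D.isTransgression_trans (D.res c)).unique ?_
  induction c using QuotientAddGroup.induction_on with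
  | H f =>
  refine ⟨Z1.map D.ι D.isInducing_ι.continuous (AddMonoidHom.id A) (fun n a ↦ D.smul_ι n a) f, f.1, 0,
    rfl, rfl, fun n ↦ rfl, fun g h ↦ ?_⟩
  rw [f.2.1 g h]
  change _ = D.incl 0
  rw [map_zero]; abel

/-- If the transgression is the coboundary of y, subtracting the inflation of y from the extending
cochain b gives a cocycle on Γ. It still extends f, and as N is open its continuity follows from
that of f. -/
theorem exists_res_eq_of_trans_eq_zero (hι : IsOpen (Set.range D.ι)) {c : D.invariants}
    (hc : D.trans c = 0) : ∃ d, D.res d = c := by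
  obtain ⟨f, b, z, hf, hz, h1, h2⟩ := D.isTransgression_trans c
  rw [hc] at hz
  obtain ⟨y, hy⟩ := (QuotientAddGroup.eq_zero_iff z).mp hz
  let b' : Γ → A := fun g ↦ b g - D.incl (y (D.π g))
  have hb' : IsCocycle₁ b' := fun g h ↦ by
    have h3 := h2 g h
    rw [← hy] at h3
    simp only [map_add, map_sub, D.incl_smul] at h3
    rw [← sub_eq_zero] at h3 ⊢
    rw [← neg_eq_zero, ← h3]
    simp only [b', map_mul, smul_sub]
    abel
  have hb1 := map_one_of_isCocycle₁ hb'
  -- Cocycles vanish at 1, so the correction is zero on all of N.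
  have hy1 : D.incl (y 1) = 0 := by
    have h3 : b' 1 = f.1 1 - D.incl (y 1) := by
      simp only [b', map_one, ← h1]
    rwa [hb1, map_one_of_isCocycle₁ f.2.1, zero_sub, eq_comm, neg_eq_zero] at h3
  have hbι (n : N) : b' (D.ι n) = f.1 n := by
    simp only [b', D.π_ι, hy1, h1, sub_zero]
  have hloc : IsLocallyConstant b' := by
    refine hb'.isLocallyConstant ?_
    have h3 := Z1.eventually_eq_zero f
    rw [D.isInducing_ι.nhds_eq_comap, map_one, Filter.eventually_comap] at h3
    filter_upwards [h3, hι.mem_nhds ⟨1, map_one D.ι⟩]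
    rintro _ h4 ⟨n, rfl⟩
    rw [hbι, h4 n rfl]
  refine ⟨((⟨b', hb', hloc⟩ : Z1 Γ A) : H1 Γ A), Subtype.ext (Eq.trans ?_ hf)⟩
  exact congrArg _ (Subtype.ext (funext hbι))

end NormalExtension

/-! ### Inflation and restriction for a tower of fields -/

section inflation

theorem Points.exists_map_eq_of_fixed {F L C : Type*} [Field F] [Field L] [CharZero L] [Field C]
    [Algebra F L] [Algebra F C] [Algebra L C] [IsScalarTower F L C] [Normal L C]
    (W : WeierstrassCurve F) (P : Points W C) (hP : ∀ σ : C ≃ₐ[L] C, σ • P = P) :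
    ∃ Q : Points W L, Points.map W (IsScalarTower.toAlgHom F L C) Q = P := by
  have : IsGalois L C := ⟨⟩
  have hfix (x : C) (h : ∀ σ : C ≃ₐ[L] C, σ x = x) : ∃ y : L, algebraMap L C y = x :=
    (InfiniteGalois.mem_range_algebraMap_iff_fixed x).mpr h
  match P, hP with
  | .zero, _ => exact ⟨0, rfl⟩
  | .some x y h, hP =>
    have hx (σ : C ≃ₐ[L] C) : σ x = x ∧ σ y = y := by
      simpa using WeierstrassCurve.Affine.Point.some.inj (hP σ)
    obtain ⟨x', rfl⟩ := hfix x fun σ ↦ (hx σ).1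
    obtain ⟨y', rfl⟩ := hfix y fun σ ↦ (hx σ).2
    exact ⟨.some x' y' ((W.toAffine.baseChange_nonsingular
      (f := IsScalarTower.toAlgHom F L C) (algebraMap L C).injective x' y').mp h), rfl⟩

variable {F S L C : Type*} [Field F] [Field S] [Field L] [Field C]
  [Algebra F S] [Algebra F L] [Algebra F C] [Algebra S L] [Algebra S C] [Algebra L C]
  [IsScalarTower S L C] [IsScalarTower F S L] [IsScalarTower F S C] [IsScalarTower F L C]
  (W : WeierstrassCurve F)

theorem galRes_id_apply [Normal S C] (σ : C ≃ₐ[L] C) (x : C) : galRes L (AlgHom.id S C) σ x = σ x :=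
  galRes_apply (AlgHom.id S C) σ x

omit [IsScalarTower F S L] in
theorem Points.smul_galRes_id [Normal S C] (σ : C ≃ₐ[L] C) (P : Points W C) :
    galRes L (AlgHom.id S C) σ • P = σ • P := by
  rw [Points.smul_def, Points.smul_def]
  congr 1
  exact congrArg _ (AlgHom.ext fun x ↦ galRes_id_apply (S := S) σ x)

variable [Normal S L]

theorem smul_map_toAlgHom (σ : C ≃ₐ[S] C) (P : Points W L) :
    σ • Points.map W (IsScalarTower.toAlgHom F L C) P =
      Points.map W (IsScalarTower.toAlgHom F L C)
        (galRes S (IsScalarTower.toAlgHom S L C) σ • P) := by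
  rw [Points.smul_def, Points.smul_def, Points.map_map, Points.map_map]
  congr 1
  exact congrArg _ (AlgHom.ext fun x ↦ (galRes_apply (IsScalarTower.toAlgHom S L C) σ x).symm)

theorem galRes_galRes_id [Normal S C] (σ : C ≃ₐ[L] C) :
    galRes S (IsScalarTower.toAlgHom S L C) (galRes L (AlgHom.id S C) σ) = 1 :=
  AlgEquiv.ext fun x ↦ (algebraMap L C).injective <|
    (galRes_apply (IsScalarTower.toAlgHom S L C) _ x).trans <|
      (galRes_id_apply σ _).trans (σ.commutes x)

variable [IsAlgClosure S C]

variable (S L C) in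
/-- The inflation map. -/
abbrev galInf : H1 (L ≃ₐ[S] L) (Points W L) →+ H1 (C ≃ₐ[S] C) (Points W C) :=
  galMap S W (IsScalarTower.toAlgHom S L C)

variable (S L C) in
/-- The restriction map. -/
abbrev galRestriction : H1 (C ≃ₐ[S] C) (Points W C) →+ H1 (C ≃ₐ[L] C) (Points W C) :=
  haveI : Normal S C := IsAlgClosure.normal S C
  galMap L W (AlgHom.id S C)

theorem galRes_surjective : Function.Surjective (galRes S (IsScalarTower.toAlgHom S L C)) := by
  have : Normal S C := IsAlgClosure.normal S C
  intro τ
  obtain ⟨σ, hσ⟩ := AlgEquiv.restrictNormalHom_surjective (F := S) (K₁ := L) C τ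
  refine ⟨σ, AlgEquiv.ext fun x ↦ (algebraMap L C).injective ?_⟩
  rw [← hσ]
  exact (galRes_apply (IsScalarTower.toAlgHom S L C) σ x).trans
    (AlgEquiv.restrictNormal_commutes σ L x).symm

variable [CharZero S]

/-- An inflated cocycle vanishes on Gal(C/L). If it is the coboundary of P, then P is fixed by
Gal(C/L), so P is already defined over L. -/
theorem galInf_injective : Function.Injective (galInf S L C W) := by
  have : Normal S C := IsAlgClosure.normal S C
  have : Normal L C := Normal.tower_top_of_normal S L C
  have : CharZero L := charZero_of_injective_algebraMap (algebraMap S L).injective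
  rw [injective_iff_map_eq_zero]
  intro c hc
  induction c using QuotientAddGroup.induction_on with
  | H f =>
  obtain ⟨P, hP⟩ := (QuotientAddGroup.eq_zero_iff _).mp hc
  have hP' (σ : C ≃ₐ[S] C) : σ • P - P = Points.map W (IsScalarTower.toAlgHom F L C)
    (f.1 (galRes S (IsScalarTower.toAlgHom S L C) σ)) := hP σ
  obtain ⟨Q, rfl⟩ := Points.exists_map_eq_of_fixed (L := L) W P fun σ ↦ by
    rw [← Points.smul_galRes_id (S := S), ← sub_eq_zero, hP', galRes_galRes_id,
      map_one_of_isCocycle₁ f.2.1, map_zero]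
  refine (QuotientAddGroup.eq_zero_iff f).mpr ⟨Q, fun τ ↦ ?_⟩
  obtain ⟨σ, rfl⟩ := galRes_surjective (C := C) τ
  refine Points.map_injective (IsScalarTower.toAlgHom F L C) ?_
  rw [← hP', map_sub, smul_map_toAlgHom]

theorem galRestriction_eq_zero_iff [FiniteDimensional S L] (c : H1 (C ≃ₐ[S] C) (Points W C)) :
    galRestriction S L C W c = 0 ↔ c ∈ (galInf S L C W).range := by
  have : Normal S C := IsAlgClosure.normal S C
  have : Normal L C := Normal.tower_top_of_normal S L C
  have : CharZero L := charZero_of_injective_algebraMap (algebraMap S L).injective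
  constructor
  · intro hc
    induction c using QuotientAddGroup.induction_on with
    | H f =>
    obtain ⟨P, hP⟩ := (QuotientAddGroup.eq_zero_iff _).mp hc
    have hP' (σ : C ≃ₐ[L] C) : σ • P - P = f.1 (galRes L (AlgHom.id S C) σ) :=
      (hP σ).trans (Points.map_id _)
    -- This cohomologous cocycle vanishes on the normal subgroup Gal(C/L). It is therefore constant
    -- on cosets with values fixed by Gal(C/L), and descends to Gal(L/S) with values in E(L).
    let f' : (C ≃ₐ[S] C) → Points W C := fun σ ↦ f.1 σ - (σ • P - P)
    have hf' : IsCocycle₁ f' := fun σ τ ↦ by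
      simp only [f', f.2.1 σ τ, smul_sub, mul_smul]; abel
    have hN {ν : C ≃ₐ[S] C} (h : galRes S (IsScalarTower.toAlgHom S L C) ν = 1) :
        ∃ σ : C ≃ₐ[L] C, galRes L (AlgHom.id S C) σ = ν := by
      refine ⟨AlgEquiv.ofRingEquiv (f := ν.toRingEquiv) fun x ↦ ?_,
        AlgEquiv.ext fun x ↦ galRes_id_apply _ x⟩
      have := galRes_apply (S' := S) (IsScalarTower.toAlgHom S L C) ν x
      rw [h] at this
      exact this.symm
    have h0 (σ : C ≃ₐ[L] C) : f' (galRes L (AlgHom.id S C) σ) = 0 := by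
      simp only [f', ← hP', Points.smul_galRes_id, sub_self]
    have hr {σ τ : C ≃ₐ[S] C} (h : galRes S (IsScalarTower.toAlgHom S L C) σ =
        galRes S (IsScalarTower.toAlgHom S L C) τ) : f' σ = f' τ := by
      obtain ⟨ν, hν⟩ := hN (ν := τ⁻¹ * σ) (by rw [map_mul, map_inv, h, inv_mul_cancel])
      have := hf' τ (τ⁻¹ * σ)
      rwa [← hν, h0, hν, mul_inv_cancel_left, smul_zero, zero_add] at this
    have hfix (σ : C ≃ₐ[S] C) : ∃ Q : Points W L,
        Points.map W (IsScalarTower.toAlgHom F L C) Q = f' σ := by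
      refine Points.exists_map_eq_of_fixed W _ fun ν ↦ ?_
      have h1 := hf' (galRes L (AlgHom.id S C) ν) σ
      rw [h0, add_zero, Points.smul_galRes_id] at h1
      rw [← h1]
      exact hr (by rw [map_mul, galRes_galRes_id, one_mul])
    choose y hy using hfix
    choose s hs using galRes_surjective (S := S) (L := L) (C := C)
    have hy' (σ) : Points.map W (IsScalarTower.toAlgHom F L C)
        (y (s (galRes S (IsScalarTower.toAlgHom S L C) σ))) = f' σ := by
      rw [hy]; exact hr (hs _)
    have : DiscreteTopology (L ≃ₐ[S] L) := krullTopology_discreteTopology_of_finiteDimensional S L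
    let z : Z1 (L ≃ₐ[S] L) (Points W L) := ⟨fun τ ↦ y (s τ), fun τ τ' ↦ by
      refine Points.map_injective (IsScalarTower.toAlgHom F L C) ?_
      rw [map_add, hy, hy, hr (τ := s τ * s τ') (by rw [hs, map_mul, hs, hs]), hf', ← hy (s τ'),
        smul_map_toAlgHom, hs], IsLocallyConstant.of_discrete _⟩
    refine ⟨z, ?_⟩
    refine QuotientAddGroup.eq.mpr ⟨P, fun σ ↦ ?_⟩
    change σ • P - P = -Points.map W (IsScalarTower.toAlgHom F L C)
        (y (s (galRes S (IsScalarTower.toAlgHom S L C) σ))) + f.1 σ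
    rw [hy']
    simp only [f']
    abel
  · rintro ⟨d, rfl⟩
    rw [galRestriction, galInf, galMap_comp _ _ _ _ (IsScalarTower.toAlgHom S L C) fun x ↦ rfl]
    induction d using QuotientAddGroup.induction_on with
    | H f =>
    refine (QuotientAddGroup.eq_zero_iff _).mpr ⟨0, fun σ ↦ ?_⟩
    have : galRes L (IsScalarTower.toAlgHom S L C) σ = 1 :=
      AlgEquiv.ext fun x ↦ (algebraMap L C).injective <|
        (galRes_apply (IsScalarTower.toAlgHom S L C) σ x).trans (σ.commutes x)
    rw [smul_zero, sub_zero]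
    change 0 = Points.map W _ (f.1 (galRes L (IsScalarTower.toAlgHom S L C) σ))
    rw [this, map_one_of_isCocycle₁ f.2.1, map_zero]

end inflation

end

/-! ### Independence of the embedding -/

noncomputable section

section transfer

variable {F k Ω : Type*} [Field F] [Field k] [Field Ω] [Algebra F k] [Algebra F Ω] [Algebra k Ω]
  [IsScalarTower F k Ω] [Normal k Ω] (W : WeierstrassCurve F)

/-- Inner automorphisms act trivially on cohomology: the change in f is the coboundary of f(τ), up
to sign. -/
theorem galMap_algEquiv (τ : Ω ≃ₐ[k] Ω) (c : H1 (Ω ≃ₐ[k] Ω) (Points W Ω)) :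
    galMap k W (τ : Ω →ₐ[k] Ω) c = c := by
  induction c using QuotientAddGroup.induction_on with
  | H f =>
  refine Eq.symm (QuotientAddGroup.eq.mpr ⟨f.1 τ, fun σ ↦ ?_⟩)
  have h1 : τ * galRes k (τ : Ω →ₐ[k] Ω) σ = σ * τ :=
    AlgEquiv.ext fun x ↦ galRes_apply (τ : Ω →ₐ[k] Ω) σ x
  have h2 := f.2.1 τ (galRes k (τ : Ω →ₐ[k] Ω) σ)
  rw [h1, f.2.1 σ τ] at h2
  change σ • f.1 τ - f.1 τ = -f.1 σ + τ • f.1 (galRes k (τ : Ω →ₐ[k] Ω) σ)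
  rw [← sub_eq_zero] at h2 ⊢
  rw [← h2]
  abel

variable {S₁ S₂ C₁ C₂ : Type*} [Field S₁] [Field S₂] [Field C₁] [Field C₂]
  [Algebra k S₁] [Algebra k S₂] [Algebra k C₁] [Algebra k C₂] [Algebra S₁ C₁] [Algebra S₂ C₂]
  [IsScalarTower k S₁ C₁] [IsScalarTower k S₂ C₂] [Algebra F S₁] [Algebra F S₂] [Algebra F C₁]
  [Algebra F C₂] [IsScalarTower F k S₁]
  [IsScalarTower F S₁ C₁] [IsScalarTower F S₂ C₂] [IsScalarTower F k C₁] [IsScalarTower F k C₂]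
  [IsAlgClosure S₁ C₁] [IsAlgClosed C₂]

/-- The kernel of a localization map does not depend on the choice of embeddings, and grows when
the local field does. -/
theorem galMap_eq_zero_of_algHom (s : S₁ →ₐ[k] S₂) (i₁ : Ω →ₐ[k] C₁) (i₂ : Ω →ₐ[k] C₂)
    {c : H1 (Ω ≃ₐ[k] Ω) (Points W Ω)} (h : galMap S₁ W i₁ c = 0) : galMap S₂ W i₂ c = 0 := by
  let _ : Algebra S₁ S₂ := s.toRingHom.toAlgebra
  let _ : Algebra S₁ C₂ := ((algebraMap S₂ C₂).comp s.toRingHom).toAlgebra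
  have : IsScalarTower S₁ S₂ C₂ := .of_algebraMap_eq fun _ ↦ rfl
  have : IsScalarTower k S₁ S₂ := .of_algebraMap_eq fun x ↦ (s.commutes x).symm
  have : IsScalarTower k S₁ C₂ := .of_algebraMap_eq fun x ↦ by
    rw [IsScalarTower.algebraMap_apply k S₂ C₂, ← s.commutes]; rfl
  have : IsScalarTower F S₁ C₂ := .of_algebraMap_eq fun x ↦ by
    rw [IsScalarTower.algebraMap_apply F k C₂, IsScalarTower.algebraMap_apply k S₁ C₂,
      IsScalarTower.algebraMap_apply F k S₁]
  have : Algebra.IsAlgebraic S₁ C₁ := IsAlgClosure.isAlgebraic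
  have : Normal S₁ C₁ := IsAlgClosure.normal S₁ C₁
  let j : C₁ →ₐ[S₁] C₂ := IsAlgClosed.lift
  let i : Ω →ₐ[k] C₂ := (j.restrictScalars k).comp i₁
  have hi : galMap S₂ W i c = 0 := by
    rw [← galMap_comp S₁ W i₁ j i fun x ↦ rfl, h, map_zero]
  -- Two embeddings of the normal extension Ω differ by an automorphism of Ω, which does not change
  -- the class.
  obtain ⟨τ, hτ⟩ : ∃ τ : Ω ≃ₐ[k] Ω, ∀ x, i ((τ : Ω →ₐ[k] Ω) x) = i₂ x := by
    let _ : Algebra Ω C₂ := i.toRingHom.toAlgebra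
    have : IsScalarTower k Ω C₂ := .of_algebraMap_eq fun x ↦ (i.commutes x).symm
    exact ⟨i₂.restrictNormal' Ω, fun x ↦ i₂.restrictNormal_commutes Ω x⟩
  rw [← galMap_comp k W (τ : Ω →ₐ[k] Ω) i i₂ hτ, galMap_algEquiv, hi]

end transfer

end

/-! ### Localizations, restriction and Ш -/

noncomputable section

open IsDedekindDomain NumberField

variable {F K Ω : Type*} [Field F] [NumberField F] [Field K] [NumberField K] [Algebra F K]
  [Field Ω] [Algebra F Ω] [Algebra K Ω] [IsScalarTower F K Ω] [IsAlgClosure F Ω]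
  [IsGalois F K] (W : WeierstrassCurve F)

theorem finiteDimensional_of_span_range_algebraMap {F K A B : Type*} [Field F] [Field K] [Algebra F K]
    [FiniteDimensional F K] [Field A] [Field B] [Algebra A B] [Algebra F A] [Algebra K B]
    [Algebra F B] [IsScalarTower F K B] [IsScalarTower F A B]
    (h : Submodule.span A (Set.range (algebraMap K B)) = ⊤) : FiniteDimensional A B := by
  let b := Module.finBasis F K
  classical
  refine ⟨⟨Finset.univ.image (algebraMap K B ∘ b), ?_⟩⟩
  rw [eq_top_iff, ← h, Submodule.span_le]
  rintro _ ⟨k, rfl⟩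
  rw [← b.sum_repr k, map_sum]
  refine Submodule.sum_mem _ fun i _ ↦ ?_
  rw [Algebra.smul_def, map_mul, ← IsScalarTower.algebraMap_apply F K B,
    IsScalarTower.algebraMap_apply F A B, ← Algebra.smul_def]
  exact Submodule.smul_mem _ _ (Submodule.subset_span (by simp))

instance Place.Above.finiteDimensional {v : Place F} (w : v.Above K) :
    FiniteDimensional v.Completion w.Completion :=
  finiteDimensional_of_span_range_algebraMap (F := F) w.span_range_algebraMap

omit [NumberField F] [IsGalois F K] in
theorem localMap_eq_zero_iff (u : Place K) {S C : Type*} [Field S] [Field C] [Algebra K S]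
    [Algebra F S] [Algebra S C] [Algebra K C] [Algebra F C] [IsScalarTower F K S]
    [IsScalarTower K S C] [IsScalarTower F S C] [IsScalarTower F K C] [IsAlgClosure S C]
    [Normal K Ω] (e : u.Completion ≃ₐ[K] S) (i : Ω →ₐ[K] C) (c : H1 (Ω ≃ₐ[K] Ω) (Points W Ω)) :
    localMap F Ω W u c = 0 ↔ galMap S W i c = 0 := by
  have : IsAlgClosed C := IsAlgClosure.isAlgClosed S
  exact ⟨galMap_eq_zero_of_algHom W (e : u.Completion →ₐ[K] S) _ _,
    galMap_eq_zero_of_algHom W (e.symm : S →ₐ[K] u.Completion) _ _⟩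

/-- Ш uses an algebraic closure of F_v, whereas 𝓖 uses one of K_w with its own embedding of Ω; the
kernels agree by `localMap_eq_zero_iff`. -/
theorem mem_sha_iff_locG_eq_zero (w : ∀ v : Place F, v.Above K) (c : H1 (Ω ≃ₐ[F] Ω) (Points W Ω)) :
    c ∈ sha F F Ω W ↔ ∀ v, locG Ω W (w v) c = 0 := by
  have : Normal F Ω := IsAlgClosure.normal F Ω
  simp only [sha, AddSubgroup.mem_iInf, AddMonoidHom.mem_ker]
  exact forall_congr' fun v ↦ localMap_eq_zero_iff W v AlgEquiv.refl _ c

theorem coe_globalRes (c : H1 (Ω ≃ₐ[F] Ω) (Points W Ω)) :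
    (globalRes F K Ω W c : H1 (Ω ≃ₐ[K] Ω) (Points W Ω)) = galRestriction F K Ω W c := by
  have : Normal F Ω := IsAlgClosure.normal F Ω
  induction c using QuotientAddGroup.induction_on with
  | H f =>
  refine congrArg _ (Subtype.ext (funext fun σ ↦ ?_))
  have h : galRes K (AlgHom.id F Ω) σ = AlgEquiv.restrictScalarsHom F σ :=
    AlgEquiv.ext fun x ↦ galRes_id_apply σ x
  change f.1 (AlgEquiv.restrictScalarsHom F σ) =
    Points.map W _ (f.1 (galRes K (AlgHom.id F Ω) σ))
  rw [h]
  exact (Points.map_id _).symm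

theorem localMap_globalRes (u : Place K) (c : H1 (Ω ≃ₐ[F] Ω) (Points W Ω)) :
    haveI : Normal F Ω := IsAlgClosure.normal F Ω
    localMap F Ω W u (globalRes F K Ω W c) =
      galMap u.Completion W ((u.embed F Ω).restrictScalars F) c := by
  have : Normal F Ω := IsAlgClosure.normal F Ω
  have : Normal K Ω := IsAlgClosure.normal_top F K Ω
  rw [coe_globalRes, galRestriction, localMap]
  exact galMap_comp _ _ _ _ _ (fun x ↦ rfl) c

/-- This is inflation-restriction for K_w/F_v, since restricting the localization of c to K_w is the
same as localizing Res c. -/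
theorem locG_mem_range_locInf_iff {v : Place F} (w : v.Above K) (c : H1 (Ω ≃ₐ[F] Ω) (Points W Ω)) :
    locG Ω W w c ∈ (locInf W w).range ↔ localMap F Ω W w.1 (globalRes F K Ω W c) = 0 := by
  have : Normal F Ω := IsAlgClosure.normal F Ω
  have : Normal v.Completion w.Closure := IsAlgClosure.normal _ _
  let e : w.Completion ≃ₐ[F] w.1.Completion :=
    AlgEquiv.ofRingEquiv (f := RingEquiv.refl w.1.Completion) fun x ↦ rfl
  rw [localMap_globalRes, locInf, ← galRestriction_eq_zero_iff, galRestriction, locG,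
    galMap_comp _ _ _ _ ((w.embed Ω).restrictScalars F) fun x ↦ rfl]
  exact ⟨galMap_eq_zero_of_algHom W (e : w.Completion →ₐ[F] w.1.Completion) _ _,
    galMap_eq_zero_of_algHom W (e.symm : w.1.Completion →ₐ[F] w.Completion) _ _⟩

end

/-! ### Conjugate places of a Galois extension -/

noncomputable section

open IsDedekindDomain NumberField
open scoped Pointwise

variable {F K Ω : Type*} [Field F] [NumberField F] [Field K] [NumberField K] [Algebra F K]

omit [NumberField F] in
/-- An automorphism of `K` that maps the place `w` to the place `u` extends to the completions. -/
theorem Place.nonempty_algHom_of_liesAbove {w u : Place K} (τ : K →ₐ[F] K)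
    (h : @LiesAbove K K _ _ τ.toRingHom.toAlgebra u w) :
    Nonempty (w.Completion →ₐ[F] u.Completion) := by
  -- K is made an extension of itself through τ, so that u lies above w and the map of completions
  -- for an extension applies.
  refine ⟨⟨@completionMap K K _ _ _ _ τ.toRingHom.toAlgebra u w h, fun x ↦ ?_⟩⟩
  have h1 := @completionMap_algebraMap K K _ _ _ _ τ.toRingHom.toAlgebra u w h (algebraMap F K x)
  have h2 : @algebraMap K K _ _ τ.toRingHom.toAlgebra (algebraMap F K x) = algebraMap F K x :=
    τ.commutes x
  rw [h2] at h1
  exact h1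

variable [IsGalois F K]

/-- The completions at the places of `K` above a place of `F` are isomorphic. -/
theorem Place.exists_algHom_completion (u : Place K) :
    ∃ v : Place F, ∀ w : v.Above K, Nonempty (w.1.Completion →ₐ[F] u.Completion) := by
  match u with
  | .finite u =>
    refine ⟨.finite (u.under (𝓞 F)), ?_⟩
    rintro ⟨w | w, hw⟩
    swap
    · exact hw.elim
    have hw : w.asIdeal.LiesOver (u.under (𝓞 F)).asIdeal := hw
    have hu : u.asIdeal.LiesOver (u.under (𝓞 F)).asIdeal := ⟨rfl⟩
    have := w.isPrime
    have := u.isPrime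
    -- The Galois group permutes the primes above a prime of F transitively.
    obtain ⟨τ, hτ⟩ := Ideal.exists_smul_eq_of_isGaloisGroup (u.under (𝓞 F)).asIdeal w.asIdeal
      u.asIdeal (K ≃ₐ[F] K)
    refine nonempty_algHom_of_liesAbove (τ : K →ₐ[F] K) ?_
    have h : w.asIdeal = u.asIdeal.comap (RingOfIntegers.mapRingHom (τ : K →ₐ[F] K)) := by
      refine Ideal.ext fun x ↦ ?_
      rw [Ideal.mem_comap, ← hτ, Ideal.mem_pointwise_smul_iff_inv_smul_mem]
      have : τ⁻¹ • (RingOfIntegers.mapRingHom (τ : K →ₐ[F] K) x) = x :=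
        RingOfIntegers.ext (τ.symm_apply_apply (x : K))
      rw [this]
    exact @Ideal.LiesOver.mk _ _ _ _ (_) _ _ h
  | .infinite u =>
    refine ⟨.infinite (u.comap (algebraMap F K)), ?_⟩
    rintro ⟨w | w, hw⟩
    · exact hw.elim
    have hw : w.LiesOver (u.comap (algebraMap F K)) := hw
    obtain ⟨τ, hτ⟩ := InfinitePlace.exists_smul_eq_of_comap_eq (InfinitePlace.LiesOver.comap_eq w
      (u.comap (algebraMap F K)))
    refine nonempty_algHom_of_liesAbove (τ : K →ₐ[F] K) ?_
    let _ : Algebra K K := (τ : K →ₐ[F] K).toRingHom.toAlgebra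
    change u.LiesOver w
    refine ⟨AbsoluteValue.ext fun x ↦ ?_⟩
    change u (τ x) = w x
    rw [← hτ, InfinitePlace.smul_apply, AlgEquiv.symm_apply_apply]

variable [Field Ω] [Algebra F Ω] [Algebra K Ω] [IsScalarTower F K Ω] [IsAlgClosure F Ω]
  (W : WeierstrassCurve F)

/-- The restriction of a class to `K` is everywhere locally trivial if and only if all its
localizations are inflated from the completions of `K`. -/
theorem globalRes_mem_sha_iff (w : ∀ v : Place F, v.Above K) (c : H1 (Ω ≃ₐ[F] Ω) (Points W Ω)) :
    (globalRes F K Ω W c : H1 (Ω ≃ₐ[K] Ω) (Points W Ω)) ∈ sha F K Ω W ↔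
      ∀ v, locG Ω W (w v) c ∈ (locInf W (w v)).range := by
  have : Normal F Ω := IsAlgClosure.normal F Ω
  simp only [sha, AddSubgroup.mem_iInf, AddMonoidHom.mem_ker, locG_mem_range_locInf_iff]
  refine ⟨fun h v ↦ h _, fun h u ↦ ?_⟩
  -- For an arbitrary place u of K, the completion at the chosen place above v embeds in K_u over F,
  -- and triviality passes along this embedding.
  obtain ⟨v, hv⟩ := u.exists_algHom_completion (F := F)
  obtain ⟨s⟩ := hv (w v)
  have h1 := h v
  rw [localMap_globalRes] at h1 ⊢
  exact galMap_eq_zero_of_algHom W s _ _ h1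

end

/-! ### The two surjections from the matching classes -/

noncomputable section

open scoped DirectSum

theorem nonempty_addEquiv_of_surjective {A B C : Type*} [AddCommGroup A] [AddCommGroup B]
    [AddCommGroup C] (f : A →+ B) (g : A →+ C) (hf : Function.Surjective f)
    (hg : Function.Surjective g) (h : ∀ a, f a = 0 ↔ g a = 0) : Nonempty (B ≃+ C) := by
  have : f.ker = g.ker := AddSubgroup.ext h
  exact ⟨(QuotientAddGroup.quotientKerEquivOfSurjective f hf).symm.trans
    ((QuotientAddGroup.quotientAddEquivOfEq this).trans
      (QuotientAddGroup.quotientKerEquivOfSurjective g hg))⟩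

theorem DirectSum.exists_apply_eq {ι : Type*} {β : ι → Type*} [∀ i, AddCommMonoid (β i)]
    (x : ∀ i, β i) (h : {i | x i ≠ 0}.Finite) : ∃ y : ⨁ i, β i, ∀ i, y i = x i := by
  classical
  refine ⟨DirectSum.mk β h.toFinset fun i ↦ x i, fun i ↦ ?_⟩
  by_cases hi : i ∈ h.toFinset
  · exact DirectSum.mk_apply_of_mem hi
  · rw [DirectSum.mk_apply_of_notMem hi]
    exact (by simpa using hi : x i = 0).symm

variable {F K Ω : Type*} [Field F] [NumberField F] [Field K] [NumberField K]
  [Algebra F K] [IsGalois F K] [Field Ω] [Algebra F Ω] [Algebra K Ω] [IsScalarTower F K Ω]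
  [IsAlgClosure F Ω] (W : WeierstrassCurve F) (w : ∀ v : Place F, v.Above K)

theorem globalRes_eq_zero_iff (c : H1 (Ω ≃ₐ[F] Ω) (Points W Ω)) :
    globalRes F K Ω W c = 0 ↔ c ∈ (globalInf (K := K) Ω W).range := by
  rw [← Subtype.coe_inj, coe_globalRes]
  exact galRestriction_eq_zero_iff W c

theorem locInf_injective {v : Place F} (w : v.Above K) : Function.Injective (locInf W w) :=
  galInf_injective W

theorem globalTrans_globalRes (c : H1 (Ω ≃ₐ[F] Ω) (Points W Ω)) :
    globalTrans F K Ω W (globalRes F K Ω W c) = 0 :=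
  (galExtension F K Ω W).trans_res c

theorem exists_globalRes_eq {c : (galExtension F K Ω W).invariants}
    (hc : globalTrans F K Ω W c = 0) : ∃ d, globalRes F K Ω W d = c := by
  have : Normal F Ω := IsAlgClosure.normal F Ω
  refine (galExtension F K Ω W).exists_res_eq_of_trans_eq_zero ?_ hc
  change IsOpen (Set.range (AlgEquiv.restrictScalarsHom F : (Ω ≃ₐ[K] Ω) →* (Ω ≃ₐ[F] Ω)))
  -- G_K is open in G_F, being the kernel of a continuous homomorphism to the discrete group
  -- Gal(K/F).
  rw [← MonoidHom.coe_range, ← ker_restrictNormalHom]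
  have : DiscreteTopology (K ≃ₐ[F] K) := krullTopology_discreteTopology_of_finiteDimensional F K
  have h : galRes F (IsScalarTower.toAlgHom F K Ω) = AlgEquiv.restrictNormalHom K :=
    MonoidHom.ext fun σ ↦ AlgEquiv.ext fun x ↦ (algebraMap K Ω).injective <|
      (galRes_apply (IsScalarTower.toAlgHom F K Ω) σ x).trans
        (AlgEquiv.restrictNormal_commutes σ K x).symm
  rw [← h]
  exact (isOpen_discrete {(1 : K ≃ₐ[F] K)}).preimage
    (continuous_galRes (S' := F) (IsScalarTower.toAlgHom F K Ω))

theorem mem_kerTransSha_iff {c : (galExtension F K Ω W).invariants} :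
    c ∈ kerTransSha F K Ω W ↔ (c : H1 (Ω ≃ₐ[K] Ω) (Points W Ω)) ∈ sha F K Ω W ∧
      globalTrans F K Ω W c = 0 :=
  ⟨by rintro ⟨d, hd, rfl⟩; exact ⟨d.2, hd⟩, fun h ↦ ⟨⟨c, h.1⟩, h.2, rfl⟩⟩

theorem globalRes_mem_kerTransSha_iff (c : H1 (Ω ≃ₐ[F] Ω) (Points W Ω)) :
    globalRes F K Ω W c ∈ kerTransSha F K Ω W ↔
      ∀ v, locG Ω W (w v) c ∈ (locInf W (w v)).range := by
  rw [mem_kerTransSha_iff, globalRes_mem_sha_iff W w, and_iff_left (globalTrans_globalRes W c)]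

include w in
theorem range_resSha_le : (resSha F K Ω W).range ≤ kerTransSha F K Ω W := by
  rintro _ ⟨⟨c, hc⟩, rfl⟩
  refine (globalRes_mem_kerTransSha_iff W w c).mpr fun v ↦ ?_
  rw [(mem_sha_iff_locG_eq_zero W w c).mp hc v]
  exact zero_mem _

/-- The global classes together with local classes whose inflations are the localizations. -/
def matchingClasses : AddSubgroup (H1 (Ω ≃ₐ[F] Ω) (Points W Ω) × ⨁ v, LocalH1 W (w v)) where
  carrier := {p | ∀ v, locG Ω W (w v) p.1 = locInf W (w v) (p.2 v)}
  zero_mem' v := by simp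
  add_mem' {a b} ha hb v := by
    have h1 := ha v
    have h2 := hb v
    simp [h1, h2]
  neg_mem' {a} ha v := by
    have h1 := ha v
    have : (-a).2 v = -(a.2 v) := DFinsupp.neg_apply _ _
    rw [this, map_neg, ← h1, Prod.fst_neg, map_neg]

theorem mapI_mk_eq_zero_iff (x : ⨁ v, LocalH1 W (w v)) :
    mapI Ω W w x = 0 ↔ ∃ c, (c, x) ∈ matchingClasses (Ω := Ω) W w := by
  refine (QuotientAddGroup.eq_zero_iff _).trans ⟨?_, ?_⟩
  · rintro ⟨c, hc⟩
    refine ⟨c, fun v ↦ ?_⟩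
    have h : locG Ω W (w v) c = DirectSum.map (fun v ↦ locInf W (w v)) x v := congrFun hc v
    rwa [DirectSum.map_apply] at h
  · rintro ⟨c, hc⟩
    refine ⟨c, funext fun v ↦ ?_⟩
    change locG Ω W (w v) c = DirectSum.map (fun v ↦ locInf W (w v)) x v
    rw [DirectSum.map_apply]
    exact hc v

/-- If x consists of the localizations of d, then c - inf d is in Ш(E/F) and has the same
restriction as c. Conversely, if Res c = Res c' with c' in Ш(E/F), then c - c' = inf d, and
injectivity of local inflation identifies x with the localizations of d. -/
theorem mem_imF_iff {c : H1 (Ω ≃ₐ[F] Ω) (Points W Ω)} {x : ⨁ v, LocalH1 W (w v)}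
    (h : (c, x) ∈ matchingClasses W w) :
    x ∈ imF W w ↔ globalRes F K Ω W c ∈ (resSha F K Ω W).range := by
  constructor
  · rintro ⟨d, hd⟩
    refine ⟨⟨c - globalInf Ω W d, (mem_sha_iff_locG_eq_zero W w _).mpr fun v ↦ ?_⟩, ?_⟩
    · have h1 : locF W (w v) d = x v := congrFun hd v
      have h2 : locG Ω W (w v) c = locInf W (w v) (x v) := h v
      rw [map_sub, h2, ← locInf_locF, h1, sub_self]
    · change globalRes F K Ω W (c - globalInf Ω W d) = _
      rw [map_sub, (globalRes_eq_zero_iff W (globalInf Ω W d)).mpr ⟨d, rfl⟩, sub_zero]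
  · rintro ⟨⟨c', hc'⟩, hres⟩
    have hres : globalRes F K Ω W c' = globalRes F K Ω W c := hres
    rw [eq_comm, ← sub_eq_zero, ← map_sub, globalRes_eq_zero_iff] at hres
    obtain ⟨d, hd⟩ := hres
    refine ⟨d, funext fun v ↦ locInf_injective W (w v) ?_⟩
    change locInf W (w v) (locF W (w v) d) = locInf W (w v) (x v)
    rw [locInf_locF Ω, hd, map_sub, (mem_sha_iff_locG_eq_zero W w c').mp hc' v, sub_zero]
    exact h v

/-- The local preimages form an element of the direct sum: c vanishes at almost all places, and
there injectivity of inflation forces the preimage to be zero. -/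
theorem exists_mem_matchingClasses [W.IsElliptic] {c : H1 (Ω ≃ₐ[F] Ω) (Points W Ω)}
    (h : ∀ v, locG Ω W (w v) c ∈ (locInf W (w v)).range) :
    ∃ x, (c, x) ∈ matchingClasses W w := by
  choose x hx using h
  obtain ⟨y, hy⟩ := DirectSum.exists_apply_eq x <| (finite_locG_ne_zero W w c).subset fun v hv h0 ↦
    hv (locInf_injective W (w v) (by rw [hx, h0, map_zero]))
  exact ⟨y, fun v ↦ by rw [hy, hx]⟩

variable (K Ω) in
/-- The local part of a pair of matching classes, as an element of `Ker 𝓘`. -/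
def matchingToKer : matchingClasses (K := K) (Ω := Ω) W w →+ (mapI Ω W w).ker :=
  ((QuotientAddGroup.mk' (imF W w)).comp
    ((AddMonoidHom.snd _ _).comp (matchingClasses W w).subtype)).codRestrict _ fun p ↦
      (mapI_mk_eq_zero_iff W w p.1.2).mpr ⟨p.1.1, p.2⟩

variable (K Ω) in
/-- The restriction of the global part of a pair of matching classes. -/
def matchingToKerTrans : matchingClasses (K := K) (Ω := Ω) W w →+ kerTransSha F K Ω W :=
  ((globalRes F K Ω W).comp
    ((AddMonoidHom.fst _ _).comp (matchingClasses W w).subtype)).codRestrict _ fun p ↦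
      (globalRes_mem_kerTransSha_iff W w p.1.1).mpr fun v ↦ ⟨p.1.2 v, (p.2 v).symm⟩

theorem matchingToKer_surjective : Function.Surjective (matchingToKer K Ω W w) := by
  rintro ⟨x, hx⟩
  induction x using QuotientAddGroup.induction_on with
  | H x =>
  obtain ⟨c, hc⟩ := (mapI_mk_eq_zero_iff (Ω := Ω) W w x).mp hx
  exact ⟨⟨(c, x), hc⟩, rfl⟩

theorem matchingToKerTrans_surjective [W.IsElliptic] :
    Function.Surjective (matchingToKerTrans K Ω W w) := by
  rintro ⟨y, hy⟩
  obtain ⟨c, rfl⟩ := exists_globalRes_eq W ((mem_kerTransSha_iff W).mp hy).2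
  obtain ⟨x, hx⟩ := exists_mem_matchingClasses W w ((globalRes_mem_kerTransSha_iff W w c).mp hy)
  exact ⟨⟨(c, x), hx⟩, rfl⟩

theorem matchingToKer_eq_zero_iff (p : matchingClasses (K := K) (Ω := Ω) W w) :
    matchingToKer K Ω W w p = 0 ↔ (matchingToKerTrans K Ω W w p :
      kerTransSha F K Ω W ⧸ (resSha F K Ω W).range.addSubgroupOf (kerTransSha F K Ω W)) = 0 := by
  rw [QuotientAddGroup.eq_zero_iff, AddSubgroup.mem_addSubgroupOf]
  refine Iff.trans ?_ (mem_imF_iff W w p.2)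
  rw [← QuotientAddGroup.eq_zero_iff]
  exact Subtype.ext_iff

end

/-- For a finite Galois extension `K/F` of number fields with group `G`, an elliptic curve `E/F`,
and any choice of a place `w v` of `K` above every place `v` of `F`: the image of
`Ш(E/F) → H¹(G_K, E) ^ G` lies in the kernel of the transgression `Ш(E/K) ^ G → H²(G, E(K))`, and
the quotient is isomorphic to the kernel of `𝓘 : Coker 𝓕 → Coker 𝓖`. -/
theorem mainTheorem4 {F K Ω : Type*} [Field F] [NumberField F] [Field K] [NumberField K]
    [Algebra F K] [IsGalois F K] [Field Ω] [Algebra F Ω] [Algebra K Ω] [IsScalarTower F K Ω]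
    [IsAlgClosure F Ω] (W : WeierstrassCurve F) [W.IsElliptic]
    (w : ∀ v : Place F, v.Above K) :
    (resSha F K Ω W).range ≤ kerTransSha F K Ω W ∧
      Nonempty ((mapI Ω W w).ker ≃+
        kerTransSha F K Ω W ⧸ (resSha F K Ω W).range.addSubgroupOf (kerTransSha F K Ω W)) :=
  ⟨range_resSha_le W w, nonempty_addEquiv_of_surjective (matchingToKer K Ω W w)
    ((QuotientAddGroup.mk' _).comp (matchingToKerTrans K Ω W w)) (matchingToKer_surjective W w)
    ((QuotientAddGroup.mk'_surjective _).comp (matchingToKerTrans_surjective W w))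
    (matchingToKer_eq_zero_iff W w)⟩
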